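/- **Conventions.** Sectors lie in the Riemann surface of the logarithm: $S(d,\gamma)=\{|\arg z-d|<\gamma\pi/2\}$, $S(d,\gamma,r)=S(d,\gamma)\cap\{|z|<r\}$, $S_\gamma=S(0,\gamma)$. A sectorial region $G(d,\gamma)$ is a connected open set $G\subset S(d,\gamma)$ such that for every $\beta\in(0,\gamma)$ there is $\rho>0$ with $S(d,\beta,\rho)\subset G$. Proper subsectors are sectors whose closure (in the surface, so without the vertex) lies in the set. For a positive sequence $\mathbb M=(M_p)_{p\ge0}$ put $m_p=M_{p+1}/M_p$, $\omega(\mathbb M)=\liminf_p \log m_p/\log p$, $h_{\mathbb M}(t)=\inf_p M_pt^p$, $\omega_{\mathbb M}(t)=\sup_p\log(t^p/M_p)$. $\mathbb M$ is a weight sequence if $M_0=1$ and $(m_p)$ is nondecreasing with $m_p\to\infty$; it is normalized if $M_1=1$. A nonzero proximate order is a function $\rho\ge 0$ on some $(c,\infty)$, $c\ge0$, which is continuous, differentiable except possibly at a sequence of points tending to infinity where it has distinct finite lateral derivatives, and satisfies $\lim_{r\to\infty}\rho(r)\in(0,\infty)$ and $r\rho'(r)\log r\to0$. $\mathbb M$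 admits a nonzero proximate order if for such a $\rho$ the function $\log (t)\,\bigl(\rho(t)-\log\omega_{\mathbb M}(t)/\log t\bigr)$ is bounded for large $t$. $f\sim_{\mathbb M}\sum a_nz^n$ in $G$ means: $f$ is holomorphic in $G$ and for every bounded proper subsector $T$ of $G$ there are $C,A>0$ with $|f(z)-\sum_{n<p}a_nz^n|\le CA^pM_p|z|^p$ for all $p\ge0$, $z\in T$. For an unbounded sector $S$, $\mathcal O^{\mathbb M}(S)$ is the set of holomorphic $f$ in $S$ that have a limit at $0$ in every bounded proper subsector of $S$ and satisfy, on every unbounded proper subsector, $|f(z)|\le c/h_{\mathbb M}(k/|z|)$ for $|z|\ge r$, with some $r,c,k>0$. A strong kernel of $\mathbb M$-summability ($\omega(\mathbb M)<2$) is a function $e$, holomorphic in $S_{\omega(\mathbb M)}$ and positive on $(0,\infty)$, with moments $m_e(\lambda)=\int_0^\infty t^{\lambda-1}e(t)\,dt$ and $E(z)=\sum_n z^n/m_e(n)$, such that: there is $a>0$ such that $|e(z)|\le C_\tau|z|^a$ for small $z\in S_\tau$, for each $\tau\in(0,\omega(\mathbb M))$; for every $\varepsilon>0$ there are $c,k>0$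 with $|e(z)|\le c\,h_{\mathbb M}(k/|z|)$ in $S_{\omega(\mathbb M)-\varepsilon}$; $E$ is entire with $|E(z)|\le Ce^{\omega_{\mathbb M}(|z|/K)}$ for some $C,K>0$; there is $b>0$ such that $|E(z)|\le K_\tau|z|^{-b}$ for large $z\in S(\pi,\tau)$, for each $\tau\in(0,2-\omega(\mathbb M))$. The $e$-Laplace transform $T_ef$ of $f\in\mathcal O^{\mathbb M}(S(d,\alpha))$ is the holomorphic function, in a sectorial region $G(d,\alpha+\omega(\mathbb M))$, given near $0$ by $\int_0^{\infty(\tau)}e(u/z)f(u)\,du/u$ for directions $\tau$ in $S(d,\alpha)$, $|\arg z-\tau|<\omega(\mathbb M)\pi/2$. The $e$-Borel transform in direction $\tau$ is $(T^-_ef)(u)=\frac{-1}{2\pi i}\int_\delta E(u/z)f(z)\,dz/z$, where $\delta$ consists of the segment from $0$ to a point of argument $\tau+\omega(\mathbb M)(\pi+\varepsilon)/2$, the clockwise circular arc to argument $\tau-\omega(\mathbb M)(\pi+\varepsilon)/2$, and the segment back to $0$ ($\varepsilon>0$ small). **Theorem.** Let $\mathbb M_1,\mathbb M_2$ be normalized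 weight sequences admitting nonzero proximate orders, with $\omega(\mathbb M_1)<\omega(\mathbb M_2)<2$, and let $e_j$ be a strong kernel of $\mathbb M_j$-summability, $j=1,2$. Let $(e_1\triangleleft e_2)(z)=T^-_{e_1}(e_2(1/u))(1/z)$ be the acceleration kernel, on $S_{\omega(\mathbb M_2/\mathbb M_1)}$, and let $A_{e_1,e_2}$ be the Laplace transform for the kernel $e_1\triangleleft e_2$ and the sequence $\mathbb M_2/\mathbb M_1=(M_{2,p}/M_{1,p})_p$. Let $d\in\mathbb R$, $\alpha>0$. (i) Let $\mathbb M'$ be a sequence of positive real numbers such that $M'_p\ge B^p$ for all $p\ge0$, for some $B>0$. If $f\in\mathcal O^{\mathbb M_2/\mathbb M_1}(S(d,\alpha))$ and $f\sim_{\mathbb M'}\hat f=\sum a_pz^p$ in $S(d,\alpha)$, then $A_{e_1,e_2}f\sim_{\mathbb M'\cdot(\mathbb M_2/\mathbb M_1)}\widehat A_{e_1,e_2}\hat f$ in a sectorial region $G(d,\alpha+\omega(\mathbb M_2/\mathbb M_1))$, where $\widehat A_{e_1,e_2}\hat f=\sum_p a_p\frac{m_{e_2}(p)}{m_{e_1}(p)}z^p$.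 (ii) If $f\in\mathcal O^{\mathbb M_2}(S(d,\alpha))$, then $A_{e_1,e_2}f$ extends holomorphically to an element of $\mathcal O^{\mathbb M_1}(S(d,\alpha+\omega(\mathbb M_2/\mathbb M_1)))$, and, for this extension, $T_{e_1}(A_{e_1,e_2}f)=T_{e_2}f$ in a sectorial region $G(d,\alpha+\omega(\mathbb M_2))$. -/

import Mathlib

open Filter Topology Set

noncomputable section

namespace Accel

/- ## The Riemann surface of the logarithm

A point `z` of the Riemann surface of the logarithm is represented by `w = log z`, which is an
arbitrary complex number: `|z| = exp (re w)`, `arg z = im w`, the projection of `z` to the plane is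
`exp w`, the quotient `u / z` becomes a difference, and `z → 0` means `re w → -∞`. The map
`z ↦ log z` is biholomorphic onto `ℂ`, so closures, connectedness and holomorphy are those of `ℂ`. -/

/-- The Riemann surface of the logarithm, in the global coordinate `w = log z`. -/
abbrev LogSurface : Type := ℂ

/-- The modulus `|z|` of the point with coordinate `w = log z`. -/
def modulus (w : LogSurface) : ℝ := Real.exp w.re

/-- The argument of the point with coordinate `w = log z`, a real number. -/
def argument (w : LogSurface) : ℝ := w.im

/-- The projection of the point with coordinate `w = log z` to the punctured plane. -/
def proj (w : LogSurface) : ℂ := Complex.exp w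

/-- The point with modulus `exp s` and argument `τ`. -/
def pt (s τ : ℝ) : LogSurface := (s : ℂ) + (τ : ℂ) * Complex.I

/-- The unbounded sector `S(d, γ)`. -/
def sector (d γ : ℝ) : Set LogSurface := {w | |argument w - d| < γ * Real.pi / 2}

/-- The bounded sector `S(d, γ, r)`. -/
def bddSector (d γ r : ℝ) : Set LogSurface :=
  {w | |argument w - d| < γ * Real.pi / 2 ∧ modulus w < r}

/-- `G` is a sectorial region `G(d, γ)`. -/
structure IsSectorialRegion (d γ : ℝ) (G : Set LogSurface) : Prop where
  isOpen : IsOpen G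
  isConnected : IsConnected G
  subset_sector : G ⊆ sector d γ
  exists_subset : ∀ β, 0 < β → β < γ → ∃ ρ, 0 < ρ ∧ bddSector d β ρ ⊆ G

/-- `T` is a bounded proper subsector of `G`. -/
def IsBddProperSubsector (T G : Set LogSurface) : Prop :=
  (∃ d β r : ℝ, 0 < β ∧ 0 < r ∧ T = bddSector d β r) ∧ closure T ⊆ G

/-- `T` is an unbounded proper subsector of `G`. -/
def IsUnbddProperSubsector (T G : Set LogSurface) : Prop :=
  (∃ d β : ℝ, 0 < β ∧ T = sector d β) ∧ closure T ⊆ G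

/- ## Sequences -/

/-- The sequence of quotients `m_p = M_{p+1} / M_p`. -/
def quot (M : ℕ → ℝ) (p : ℕ) : ℝ := M (p + 1) / M p

/-- Weight sequences: positive, `M_0 = 1`, logarithmically convex, with quotients tending to
infinity. -/
structure IsWeightSequence (M : ℕ → ℝ) : Prop where
  pos : ∀ p, 0 < M p
  zero : M 0 = 1
  logConvex : ∀ p, M (p + 1) ^ 2 ≤ M p * M (p + 2)
  tendsto : Tendsto (quot M) atTop atTop

/-- `h_M(t) = inf_p M_p t^p`. -/
def hFun (M : ℕ → ℝ) (t : ℝ) : ℝ := ⨅ p : ℕ, M p * t ^ p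

/-- `ω_M(t) = sup_p log (t^p / M_p)`, a finite supremum when `M` is a weight sequence. It is `0`
at `t = 0` if `M_0 = 1`. -/
def omegaFun (M : ℕ → ℝ) (t : ℝ) : ℝ := ⨆ p : ℕ, Real.log (t ^ p / M p)

/-- The growth index `ω(M) = liminf log m_p / log p`. (It is used only where the limit exists and
is finite: sequences that admit a nonzero proximate order, and quotients of two of these.) -/
def growthIndex (M : ℕ → ℝ) : ℝ :=
  liminf (fun p : ℕ => Real.log (quot M p) / Real.log p) atTop

/-- `d_M(t) = log ω_M(t) / log t`. -/
def dFun (M : ℕ → ℝ) (t : ℝ) : ℝ := Real.log (omegaFun M t) / Real.log t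

/-- `ρ` is a proximate order with limit `l` at infinity: on some `(c, ∞)` it is continuous,
nonnegative, and differentiable except at the points of a set `P` without finite accumulation
points, where it has distinct finite lateral derivatives; and `r ρ'(r) log r → 0`. -/
def IsProximateOrder (ρ : ℝ → ℝ) (l : ℝ) : Prop :=
  ∃ c : ℝ, 0 ≤ c ∧ ContinuousOn ρ (Ioi c) ∧ (∀ r, c < r → 0 ≤ ρ r) ∧
    Tendsto ρ atTop (𝓝 l) ∧
    ∃ P : Set ℝ, P ⊆ Ioi c ∧ (∀ R, (P ∩ Iic R).Finite) ∧
      (∀ r ∈ Ioi c \ P, DifferentiableAt ℝ ρ r) ∧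
      (∀ r ∈ P, ∃ a b : ℝ, a ≠ b ∧ HasDerivWithinAt ρ a (Iic r) r ∧
        HasDerivWithinAt ρ b (Ici r) r) ∧
      Tendsto (fun r => r * deriv ρ r * Real.log r) (atTop ⊓ 𝓟 Pᶜ) (𝓝 0)

/-- `M` admits a nonzero proximate order. -/
def AdmitsNonzeroProximateOrder (M : ℕ → ℝ) : Prop :=
  ∃ (ρ : ℝ → ℝ) (l C D : ℝ), 0 < l ∧ IsProximateOrder ρ l ∧
    ∀ᶠ t in atTop, C ≤ Real.log t * (ρ t - dFun M t) ∧ Real.log t * (ρ t - dFun M t) ≤ D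

/- ## Asymptotic expansions and functions of `M`-growth -/

/-- `f` is holomorphic in `G` and `f ∼_M fhat` in `G`. -/
def HasAsymptoticExpansion (M : ℕ → ℝ) (G : Set LogSurface) (f : LogSurface → ℂ)
    (fhat : PowerSeries ℂ) : Prop :=
  DifferentiableOn ℂ f G ∧
    ∀ T, IsBddProperSubsector T G → ∃ C A : ℝ, 0 < C ∧ 0 < A ∧ ∀ p : ℕ, ∀ w ∈ T,
      ‖f w - ∑ n ∈ Finset.range p, PowerSeries.coeff n fhat * proj w ^ n‖ ≤
        C * A ^ p * M p * modulus w ^ p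

/-- `f` is continuous at the origin in `S`: for every bounded proper subsector `T` of `S`, `f` has
a limit as `z → 0` in `T`. -/
def ContinuousAtOrigin (S : Set LogSurface) (f : LogSurface → ℂ) : Prop :=
  ∀ T, IsBddProperSubsector T S →
    ∃ L : ℂ, Tendsto f (comap (fun w : LogSurface => w.re) atBot ⊓ 𝓟 T) (𝓝 L)

/-- `f ∈ O^M(S)`, for an unbounded sector `S`. -/
structure MemGrowth (M : ℕ → ℝ) (S : Set LogSurface) (f : LogSurface → ℂ) : Prop where
  holo : DifferentiableOn ℂ f S
  contOrigin : ContinuousAtOrigin S f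
  growth : ∀ T, IsUnbddProperSubsector T S → ∃ r c k : ℝ, 0 < r ∧ 0 < c ∧ 0 < k ∧
    ∀ w ∈ T, r ≤ modulus w → ‖f w‖ ≤ c / hFun M (k / modulus w)

/- ## Kernels -/

/-- The moment function `m_e(λ) = ∫_0^∞ t^(λ-1) e(t) dt`. -/
def moment (e : LogSurface → ℂ) (lam : ℂ) : ℂ :=
  ∫ t in Ioi (0 : ℝ), (t : ℂ) ^ (lam - 1) * e (pt (Real.log t) 0)

/-- The Borel kernel `E(z) = ∑ z^n / m_e(n)` of `e`, as a function on the plane. -/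
def borelKernel (e : LogSurface → ℂ) (z : ℂ) : ℂ := ∑' n : ℕ, z ^ n / moment e n

/-- `e` (with the Borel kernel `E` that it determines) is a strong kernel of `M`-summability. -/
structure IsStrongKernel (M : ℕ → ℝ) (e : LogSurface → ℂ) : Prop where
  /-- (i) -/
  holo : DifferentiableOn ℂ e (sector 0 (growthIndex M))
  /-- (ii.b) -/
  small : ∃ a : ℝ, 0 < a ∧ ∀ τ, 0 < τ → τ < growthIndex M → ∃ C ε : ℝ, 0 < C ∧ 0 < ε ∧
    ∀ w ∈ sector 0 τ, modulus w ≤ ε → ‖e w‖ ≤ C * modulus w ^ a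
  /-- (iii) -/
  decay : ∀ ε, 0 < ε → ∃ c k : ℝ, 0 < c ∧ 0 < k ∧
    ∀ w ∈ sector 0 (growthIndex M - ε), ‖e w‖ ≤ c * hFun M (k / modulus w)
  /-- (iv) -/
  pos : ∀ s : ℝ, ∃ y : ℝ, 0 < y ∧ e (pt s 0) = y
  /-- (v), `E` is entire -/
  entire : ∀ z : ℂ, Summable fun n : ℕ => z ^ n / moment e n
  /-- (v), growth of `E` -/
  growth : ∃ C K : ℝ, 0 < C ∧ 0 < K ∧
    ∀ z : ℂ, ‖borelKernel e z‖ ≤ C * Real.exp (omegaFun M (‖z‖ / K))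
  /-- (vi.b) -/
  smallBorel : ∃ b : ℝ, 0 < b ∧ ∀ τ, 0 < τ → τ < 2 - growthIndex M → ∃ K R : ℝ, 0 < K ∧ 0 < R ∧
    ∀ w ∈ sector Real.pi τ, R ≤ modulus w → ‖borelKernel e (proj w)‖ ≤ K / modulus w ^ b

/- ## Laplace and Borel transforms -/

/-- The integrand of the `e`-Laplace transform in direction `τ` at `z`, that is of
`∫_0^{∞(τ)} e(u/z) f(u) du/u`, with the ray parametrized by `u = exp s · e^{iτ}`, so that
`du/u = ds`. -/
def laplaceIntegrand (e f : LogSurface → ℂ) (τ : ℝ) (w : LogSurface) (s : ℝ) : ℂ :=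
  e (pt s τ - w) * f (pt s τ)

/-- `F`, on `G`, is the `e`-Laplace transform `T_e f` of a function `f` on `S(d, α)`, where `e` is
a kernel on `S_ω`: `G` is a sectorial region `G(d, α + ω)`, `F` is holomorphic in `G`, and for every
direction `τ` in `S(d, α)`, `F(z)` is the integral `∫_0^{∞(τ)} e(u/z) f(u) du/u` for
`|arg z - τ| < ω π / 2` and `|z|` small enough (uniformly in every narrower sector). -/
structure IsLaplaceTransform (ω : ℝ) (e : LogSurface → ℂ) (d α : ℝ) (f : LogSurface → ℂ)
    (G : Set LogSurface) (F : LogSurface → ℂ) : Prop where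
  region : IsSectorialRegion d (α + ω) G
  holo : DifferentiableOn ℂ F G
  eq_integral : ∀ τ, |τ - d| < α * Real.pi / 2 → ∀ β, 0 < β → β < ω →
    ∃ ρ, 0 < ρ ∧ bddSector τ β ρ ⊆ G ∧ ∀ w ∈ bddSector τ β ρ,
      MeasureTheory.Integrable (laplaceIntegrand e f τ w) ∧
        F w = ∫ s : ℝ, laplaceIntegrand e f τ w s

/-- The `e`-Borel transform `(-1 / 2πi) ∫_δ E(u/z) f(z) dz/z` in direction `τ` at the point `u`
with coordinate `w`. The path `δ` is the segment from the origin to the point of modulus `R`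
and argument `θ₊ = τ + ω (π + ε) / 2`, then the arc `|z| = R` clockwise to the argument
`θ₋ = τ - ω (π + ε) / 2`, then the segment back to the origin. On the segments `|z| = exp s`,
`dz/z = ds`, and on the arc `dz/z = i dφ`. -/
def borelIntegral (ω : ℝ) (E : ℂ → ℂ) (f : LogSurface → ℂ) (τ ε R : ℝ) (w : LogSurface) : ℂ :=
  let θp := τ + ω * (Real.pi + ε) / 2
  let θm := τ - ω * (Real.pi + ε) / 2
  let g : LogSurface → ℂ := fun v => E (proj (w - v)) * f v
  (-1 / (2 * Real.pi * Complex.I)) *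
    ((∫ s in Iic (Real.log R), g (pt s θp))
      + (∫ φ in θp..θm, Complex.I * g (pt (Real.log R) φ))
      - ∫ s in Iic (Real.log R), g (pt s θm))

/-- The opening parameter of the path that defines the acceleration kernel at an argument `ψ`, for
kernels on `S_{ω₁}` and `S_{ω₂}`. For `|ψ| < (ω₂ - ω₁) π / 2` it lies in `(0, π)`, and the path in
direction `-ψ` stays inside `S_{ω₂}`, since `|ψ| + ω₁ (π + ε) / 2 < ω₂ π / 2`. By Cauchy's theorem
the transform does not depend on this choice. -/
def accelEps (ω₁ ω₂ ψ : ℝ) : ℝ :=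
  min Real.pi (((ω₂ - ω₁) * Real.pi - 2 * |ψ|) / ω₁) / 2

/-- The acceleration kernel `(e₁ ◁ e₂)(z) = T⁻_{e₁}(e₂(1/u))(1/z)`. -/
def accelKernel (ω₁ ω₂ : ℝ) (e₁ e₂ : LogSurface → ℂ) (w : LogSurface) : ℂ :=
  borelIntegral ω₁ (borelKernel e₁) (fun v => e₂ (-v)) (argument (-w))
    (accelEps ω₁ ω₂ (argument w)) 1 (-w)

/-- `F`, on `G`, is the acceleration `A_{e₁,e₂} f` of a function `f` on `S(d, α)`, that is, the
Laplace transform of `f` with respect to the kernel `e₁ ◁ e₂` for the sequence `M₂ / M₁`. -/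
def IsAcceleration (M₁ M₂ : ℕ → ℝ) (e₁ e₂ : LogSurface → ℂ) (d α : ℝ) (f : LogSurface → ℂ)
    (G : Set LogSurface) (F : LogSurface → ℂ) : Prop :=
  IsLaplaceTransform (growthIndex (M₂ / M₁))
    (accelKernel (growthIndex M₁) (growthIndex M₂) e₁ e₂) d α f G F

/-- The formal acceleration operator `∑ a_p z^p ↦ ∑ a_p (m_{e₂}(p) / m_{e₁}(p)) z^p`. -/
def formalAcceleration (e₁ e₂ : LogSurface → ℂ) (fhat : PowerSeries ℂ) : PowerSeries ℂ :=
  PowerSeries.mk fun p => PowerSeries.coeff p fhat * moment e₂ p / moment e₁ p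

end Accel

end

open Accel

namespace Accel

open MeasureTheory

/-! ### Regular sequences -/

/-! In the coordinate `w = log z` sectors become horizontal strips, rays become horizontal lines,
`e(u/z)` depends on a difference, and a Laplace transform along a ray is a convolution. Two
estimates and one identity carry the proof.

The first estimate makes `e₁ ◁ e₂` a kernel for `M₂ / M₁` (`accelKernel_kernelBound`). The radius of
the arc in its Hankel path is free. The radius `1/|z|` gives `O(|z|^a)` at the origin. For the decay
at infinity each `p` gets its own radius, the one at which the bound of `E₁` on the arc is `exp
ω_{M₁}(m_p) = m_p^p / M_{1,p}`. Since `h_{M₂}(t) ≤ M_{2,p} t^p`, the powers of `m_p` cancel,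
`(M_{2,p}/M_{1,p}) (k/|z|)^p` remains, and the infimum over `p` is taken.

The second estimate weighs the decay of a kernel against the growth of a function. Moderate growth,
in the form `h(t) ≤ H h(Ht)^2`, splits the kernel bound into a factor that cancels the growth and a
factor that keeps the integral convergent for small `|z|` (`IsRegularSeq.growth_bound`). If the
function has growth `M₂ = (M₂/M₁) M₁`, the inequality `h_N h_L ≤ h_{NL}` lets the kernel cancel only
the part `M₂/M₁`; growth `M₁` in `z` remains, and `|z|` is unrestricted
(`IsRegularSeq.growth_bound_mul`). This is why the acceleration extends to the whole sector in (ii).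
Moderate growth of a sequence comes from its proximate order.

The identity is that `T_{e₁}` sends `u ↦ (e₁ ◁ e₂)(1/u)` to `z ↦ e₂(1/z)`
(`integral_mul_accelKernel`). Termwise integration shows that `T_{e₁}` turns `E₁(u/v)` into the
Cauchy kernel `1/(1 - z/v)`; Fubini and a residue do the rest. Read as a convolution, the identity
gives `m_{e₁ ◁ e₂}(p) m_{e₁}(p) = m_{e₂}(p)`. Inserted into the iterated Laplace integral on the
bisecting ray, it gives `T_{e₁} A f = T_{e₂} f` there, and the identity theorem extends this to a
sectorial region.

In (i) the sequence `M'` has no regularity beyond `M'_p ≥ B^p`, so coefficient bounds cannot be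
summed. Instead the partial sums are bounded on a small disc, and a Bernstein-Walsh inequality
carries the bound to large `|z|`. The remainder is then integrated against the kernel. -/

/-- Positive sequences of moderate growth whose `p`-th roots tend to infinity. -/
structure IsRegularSeq (N : ℕ → ℝ) : Prop where
  pos : ∀ p, 0 < N p
  zero : N 0 = 1
  lower : ∀ t : ℝ, 0 < t → ∃ c, 0 < c ∧ ∀ p, c ≤ N p * t ^ p
  mg : ∃ H : ℝ, 1 ≤ H ∧ ∀ p q, N (p + q) ≤ H * H ^ (p + q) * (N p * N q)

section hFun
variable {N : ℕ → ℝ}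

theorem bddBelow_hFun (hN : ∀ p, 0 < N p) {t : ℝ} (ht : 0 ≤ t) :
    BddBelow (range fun p : ℕ => N p * t ^ p) :=
  ⟨0, by rintro _ ⟨p, rfl⟩; exact mul_nonneg (hN p).le (pow_nonneg ht p)⟩

theorem hFun_le (hN : ∀ p, 0 < N p) {t : ℝ} (ht : 0 ≤ t) (p : ℕ) : hFun N t ≤ N p * t ^ p :=
  ciInf_le (bddBelow_hFun hN ht) p

theorem hFun_nonneg (hN : ∀ p, 0 < N p) {t : ℝ} (ht : 0 ≤ t) : 0 ≤ hFun N t :=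
  le_ciInf fun p => mul_nonneg (hN p).le (pow_nonneg ht p)

theorem hFun_mono (hN : ∀ p, 0 < N p) {s t : ℝ} (hs : 0 ≤ s) (hst : s ≤ t) :
    hFun N s ≤ hFun N t :=
  le_ciInf fun p => (hFun_le hN hs p).trans
    (mul_le_mul_of_nonneg_left (pow_le_pow_left₀ hs hst p) (hN p).le)

theorem IsRegularSeq.hFun_pos (h : IsRegularSeq N) {t : ℝ} (ht : 0 < t) : 0 < hFun N t := by
  obtain ⟨c, hc, hcp⟩ := h.lower t ht
  exact hc.trans_le (le_ciInf hcp)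

theorem IsRegularSeq.hFun_le_one (h : IsRegularSeq N) {t : ℝ} (ht : 0 ≤ t) : hFun N t ≤ 1 := by
  simpa [h.zero] using hFun_le h.pos ht 0

/-- Moderate growth bounds the term of index `p + q` by a product of a term in `p` and a term in
`q`, and the two infima are taken separately. One factor will absorb the growth of a function, the
other will keep an integral convergent. -/
theorem IsRegularSeq.hFun_le_sq (h : IsRegularSeq N) :
    ∃ H : ℝ, 1 ≤ H ∧ (∀ p q, N (p + q) ≤ H * H ^ (p + q) * (N p * N q)) ∧
      ∀ t, 0 < t → hFun N t ≤ H * (hFun N (H * t) * hFun N (H * t)) := by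
  obtain ⟨H, hH, hmg⟩ := h.mg
  have hH0 : 0 < H := by linarith
  refine ⟨H, hH, hmg, fun t ht => ?_⟩
  have hHt : 0 < H * t := by positivity
  have hpos := h.hFun_pos hHt
  have key : ∀ p q, hFun N t ≤ H * ((N p * (H * t) ^ p) * (N q * (H * t) ^ q)) := by
    intro p q
    calc hFun N t ≤ N (p + q) * t ^ (p + q) := hFun_le h.pos ht.le _
      _ ≤ H * H ^ (p + q) * (N p * N q) * t ^ (p + q) := by
          gcongr; exact hmg p q
      _ = _ := by rw [mul_pow, mul_pow, pow_add, pow_add]; ring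
  have key2 : ∀ q, hFun N t ≤ H * (hFun N (H * t) * (N q * (H * t) ^ q)) := by
    intro q
    have hq : 0 < N q * (H * t) ^ q := mul_pos (h.pos q) (by positivity)
    have : hFun N t / (H * (N q * (H * t) ^ q)) ≤ hFun N (H * t) := by
      refine le_ciInf fun p => ?_
      rw [div_le_iff₀ (by positivity)]
      calc _ ≤ _ := key p q
        _ = _ := by ring
    rw [div_le_iff₀ (by positivity)] at this
    calc _ ≤ _ := this
      _ = _ := by ring
  have : hFun N t / (H * hFun N (H * t)) ≤ hFun N (H * t) := by
    refine le_ciInf fun q => ?_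
    rw [div_le_iff₀ (by positivity)]
    calc _ ≤ _ := key2 q
      _ = _ := by ring
  rw [div_le_iff₀ (by positivity)] at this
  calc _ ≤ _ := this
    _ = _ := by ring

/-- If `M = N L` then `h_N(s) h_L(t) ≤ h_M(s t)`. -/
theorem hFun_mul_le {M L : ℕ → ℝ} (hN : ∀ p, 0 < N p) (hL : ∀ p, 0 < L p)
    (hM : ∀ p, M p = N p * L p) {s t : ℝ} (hs : 0 ≤ s) (ht : 0 ≤ t) :
    hFun N s * hFun L t ≤ hFun M (s * t) := by
  refine le_ciInf fun p => ?_
  calc _ ≤ (N p * s ^ p) * (L p * t ^ p) :=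
        mul_le_mul (hFun_le hN hs p) (hFun_le hL ht p) (hFun_nonneg hL ht)
          (mul_nonneg (hN p).le (pow_nonneg hs p))
    _ = _ := by rw [hM, mul_pow]; ring

end hFun

/-! ### Weight sequences -/

section Weight
variable {M : ℕ → ℝ}

theorem IsWeightSequence.quot_pos (h : IsWeightSequence M) (p : ℕ) : 0 < quot M p :=
  div_pos (h.pos _) (h.pos _)

theorem IsWeightSequence.quot_mono (h : IsWeightSequence M) : Monotone (quot M) := by
  refine monotone_nat_of_le_succ fun p => ?_
  unfold quot
  rw [div_le_div_iff₀ (h.pos _) (h.pos _)]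
  have := h.logConvex p
  nlinarith

theorem IsWeightSequence.succ_eq (h : IsWeightSequence M) (p : ℕ) : M (p + 1) = M p * quot M p := by
  unfold quot; field_simp [(h.pos p).ne']

theorem IsWeightSequence.mul_pow_le (h : IsWeightSequence M) (p k : ℕ) :
    M p * quot M p ^ k ≤ M (p + k) := by
  induction k with
  | zero => simp
  | succ k ih =>
    rw [← add_assoc, h.succ_eq, pow_succ, ← mul_assoc]
    exact mul_le_mul ih (h.quot_mono (by omega)) (h.quot_pos p).le (h.pos _).le

theorem IsWeightSequence.le_mul_pow (h : IsWeightSequence M) (p q k : ℕ) (hq : q + k ≤ p + 1) :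
    M (q + k) ≤ M q * quot M p ^ k := by
  induction k with
  | zero => simp
  | succ k ih =>
    rw [← add_assoc, h.succ_eq, pow_succ, ← mul_assoc]
    exact mul_le_mul (ih (by omega)) (h.quot_mono (by omega)) (h.quot_pos _).le
      (mul_nonneg (h.pos _).le (pow_nonneg (h.quot_pos p).le _))

/-- The consecutive ratios of `q ↦ t ^ q / M q` are `t / quot M q`, which pass through 1 at `q = p`
when `t = quot M p`. So the supremum in `omegaFun` is attained at the index `p`. -/
theorem IsWeightSequence.pow_div_le (h : IsWeightSequence M) (p q : ℕ) :
    quot M p ^ q / M q ≤ quot M p ^ p / M p := by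
  rw [div_le_div_iff₀ (h.pos _) (h.pos _)]
  have hm := h.quot_pos p
  rcases le_total p q with hpq | hpq
  · obtain ⟨k, rfl⟩ := Nat.exists_eq_add_of_le hpq
    calc quot M p ^ (p + k) * M p = quot M p ^ p * (M p * quot M p ^ k) := by rw [pow_add]; ring
      _ ≤ _ := by gcongr; exact h.mul_pow_le p k
  · obtain ⟨k, rfl⟩ := Nat.exists_eq_add_of_le hpq
    calc quot M (q + k) ^ q * M (q + k) ≤ quot M (q + k) ^ q * (M q * quot M (q + k) ^ k) := by
          gcongr; exact h.le_mul_pow _ _ _ (by omega)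
      _ = _ := by rw [pow_add]; ring

/-- Once the quotients exceed `1 / t`, the terms no longer decrease, so the infimum is a minimum of
finitely many positive numbers. Log-convexity is not assumed, because the lemma also serves `M₂ /
M₁`. -/
theorem lower_of_tendsto_quot {N : ℕ → ℝ} (hN : ∀ p, 0 < N p)
    (h : Tendsto (quot N) atTop atTop) (t : ℝ) (ht : 0 < t) :
    ∃ c, 0 < c ∧ ∀ p, c ≤ N p * t ^ p := by
  obtain ⟨P, hP⟩ := eventually_atTop.1 (h.eventually_ge_atTop (1 / t))
  have hpos : ∀ p, 0 < N p * t ^ p := fun p => mul_pos (hN p) (pow_pos ht p)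
  have hinc : ∀ k, N P * t ^ P ≤ N (P + k) * t ^ (P + k) := by
    intro k
    induction k with
    | zero => simp
    | succ k ih =>
      refine ih.trans ?_
      have h1 := hP (P + k) (by omega)
      unfold quot at h1
      rw [div_le_div_iff₀ ht (hN _)] at h1
      calc _ = (1 * N (P + k)) * t ^ (P + k) := by ring
        _ ≤ (N (P + k + 1) * t) * t ^ (P + k) := by gcongr
        _ = _ := by rw [← add_assoc, pow_succ]; ring
  obtain ⟨q, -, hq⟩ := Finset.exists_min_image (Finset.range (P + 1)) (fun p => N p * t ^ p)
    ⟨0, by simp⟩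
  refine ⟨N q * t ^ q, hpos q, fun p => ?_⟩
  rcases le_total p P with hp | hp
  · exact hq p (by simp; omega)
  · obtain ⟨k, rfl⟩ := Nat.exists_eq_add_of_le hp
    exact (hq P (by simp)).trans (hinc k)

theorem IsWeightSequence.bddAbove_omegaFun (h : IsWeightSequence M) {t : ℝ} (ht : 0 < t) :
    BddAbove (range fun p : ℕ => Real.log (t ^ p / M p)) := by
  obtain ⟨c, hc, hcp⟩ := lower_of_tendsto_quot h.pos h.tendsto t⁻¹ (by positivity)
  refine ⟨Real.log c⁻¹, ?_⟩
  rintro _ ⟨p, rfl⟩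
  refine Real.log_le_log (div_pos (by positivity) (h.pos p)) ?_
  rw [le_inv_comm₀ (div_pos (by positivity) (h.pos p)) hc]
  simpa [div_eq_mul_inv, mul_comm] using hcp p

theorem IsWeightSequence.le_omegaFun (h : IsWeightSequence M) {t : ℝ} (ht : 0 < t) (p : ℕ) :
    Real.log (t ^ p / M p) ≤ omegaFun M t :=
  le_ciSup (h.bddAbove_omegaFun ht) p

theorem IsWeightSequence.omegaFun_nonneg (h : IsWeightSequence M) {t : ℝ} (ht : 0 < t) :
    0 ≤ omegaFun M t := by
  simpa [h.zero] using h.le_omegaFun ht 0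

theorem IsWeightSequence.omegaFun_mono (h : IsWeightSequence M) {s t : ℝ} (hs : 0 < s)
    (hst : s ≤ t) : omegaFun M s ≤ omegaFun M t := by
  refine ciSup_le fun p => le_trans ?_ (h.le_omegaFun (hs.trans_le hst) p)
  exact Real.log_le_log (div_pos (by positivity) (h.pos p))
    (div_le_div_of_nonneg_right (pow_le_pow_left₀ hs.le hst p) (h.pos p).le)

theorem IsWeightSequence.omegaFun_quot (h : IsWeightSequence M) (p : ℕ) :
    omegaFun M (quot M p) = Real.log (quot M p ^ p / M p) := by
  refine le_antisymm (ciSup_le fun q => ?_) (h.le_omegaFun (h.quot_pos p) p)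
  exact Real.log_le_log (div_pos (pow_pos (h.quot_pos p) q) (h.pos q)) (h.pow_div_le p q)

theorem IsWeightSequence.exp_omegaFun_quot (h : IsWeightSequence M) (p : ℕ) :
    Real.exp (omegaFun M (quot M p)) = quot M p ^ p / M p := by
  rw [h.omegaFun_quot, Real.exp_log (div_pos (pow_pos (h.quot_pos p) p) (h.pos p))]

theorem IsWeightSequence.mul_le_add (h : IsWeightSequence M) (p q : ℕ) :
    M p * M q ≤ M (p + q) := by
  induction q with
  | zero => simp [h.zero]
  | succ q ih =>
    rw [← add_assoc, h.succ_eq q, h.succ_eq (p + q), ← mul_assoc]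
    exact mul_le_mul ih (h.quot_mono (by omega)) (h.quot_pos _).le (h.pos _).le

theorem IsWeightSequence.one_le_quot (h : IsWeightSequence M) (h1 : M 1 = 1) (p : ℕ) :
    1 ≤ quot M p := by
  have : quot M 0 = 1 := by simp [quot, h.zero, h1]
  exact this ▸ h.quot_mono (Nat.zero_le p)

theorem IsWeightSequence.one_le (h : IsWeightSequence M) (h1 : M 1 = 1) (p : ℕ) : 1 ≤ M p := by
  induction p with
  | zero => simp [h.zero]
  | succ p ih => rw [h.succ_eq]; exact one_le_mul_of_one_le_of_one_le ih (h.one_le_quot h1 p)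

theorem IsWeightSequence.le_quot_pow (h : IsWeightSequence M) (p : ℕ) :
    M p ≤ quot M p ^ p := by
  simpa [h.zero] using h.le_mul_pow p 0 p (by omega)

/-- Moderate growth follows from `2 ω_M(t) ≤ ω_M(H t) + C`. -/
theorem IsWeightSequence.mg_of_omegaFun (h : IsWeightSequence M) {H C : ℝ} (hH : 0 < H)
    (hom : ∀ t, 0 < t → 2 * omegaFun M t ≤ omegaFun M (H * t) + C) :
    ∃ H : ℝ, 1 ≤ H ∧ ∀ p q, M (p + q) ≤ H * H ^ (p + q) * (M p * M q) := by
  have key : ∀ p q, M (p + q) ≤ Real.exp C * H ^ (p + q) * (M p * M q) := by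
    intro p q
    -- At this `t` the supremum `ω_M(t)` is the term of index `p + q`, so `M (p + q)` enters
    -- exactly; the terms of index `p` and `q` bound `ω_M(t / H)` from below.
    set t := quot M (p + q) with ht
    have ht0 : 0 < t := h.quot_pos _
    have htH : 0 < t / H := by positivity
    have h1 := h.exp_omegaFun_quot (p + q)
    have h2 := hom (t / H) htH
    rw [mul_div_cancel₀ _ hH.ne'] at h2
    have h3 := h.le_omegaFun htH p
    have h4 := h.le_omegaFun htH q
    have h5 : (t / H) ^ p / M p * ((t / H) ^ q / M q) ≤ Real.exp (omegaFun M t + C) := by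
      have e1 : (t / H) ^ p / M p ≤ Real.exp (omegaFun M (t / H)) := by
        rwa [← Real.log_le_iff_le_exp (div_pos (by positivity) (h.pos p))]
      have e2 : (t / H) ^ q / M q ≤ Real.exp (omegaFun M (t / H)) := by
        rwa [← Real.log_le_iff_le_exp (div_pos (by positivity) (h.pos q))]
      calc _ ≤ Real.exp (omegaFun M (t / H)) * Real.exp (omegaFun M (t / H)) :=
            mul_le_mul e1 e2 (div_pos (by positivity) (h.pos q)).le (Real.exp_pos _).le
        _ = Real.exp (2 * omegaFun M (t / H)) := by rw [← Real.exp_add]; ring_nf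
        _ ≤ _ := Real.exp_le_exp.2 h2
    rw [Real.exp_add, h1, div_mul_div_comm, ← pow_add, div_pow, div_mul_eq_mul_div,
      div_div, div_le_div_iff₀ (mul_pos (by positivity) (mul_pos (h.pos p) (h.pos q))) (h.pos _)]
      at h5
    have h6 : 0 < t ^ (p + q) := by positivity
    refine le_of_mul_le_mul_left ?_ h6
    calc _ ≤ _ := h5
      _ = _ := by ring
  refine ⟨max 1 (max H (Real.exp C)), le_max_left _ _, fun p q => (key p q).trans ?_⟩
  have hp := h.pos p
  have hq := h.pos q
  gcongr
  · exact (le_max_right _ _).trans (le_max_right _ _)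
  · exact (le_max_left _ _).trans (le_max_right _ _)

end Weight

/-! ### Proximate orders -/

/-- Induction on the number of exceptional points: one that lies inside the interval splits it in
two. -/
theorem le_of_deriv_nonneg_off_finite {f : ℝ → ℝ} (n : ℕ) : ∀ (P : Set ℝ), P.Finite → P.ncard ≤ n →
    ∀ a b : ℝ, a ≤ b → ContinuousOn f (Icc a b) →
    (∀ x ∈ Ioo a b \ P, DifferentiableAt ℝ f x ∧ 0 ≤ deriv f x) → f a ≤ f b := by
  induction n with
  | zero =>
    intro P hP hn a b hab hc hd
    have hPe : P = ∅ := by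
      rwa [Nat.le_zero, Set.ncard_eq_zero hP] at hn
    subst hPe
    have hm : MonotoneOn f (Icc a b) := by
      refine monotoneOn_of_deriv_nonneg (convex_Icc a b) hc ?_ ?_
      · rw [interior_Icc]; intro x hx
        exact (hd x ⟨hx, by simp⟩).1.differentiableWithinAt
      · rw [interior_Icc]; intro x hx
        exact (hd x ⟨hx, by simp⟩).2
    exact hm (left_mem_Icc.2 hab) (right_mem_Icc.2 hab) hab
  | succ n ih =>
    intro P hP hn a b hab hc hd
    rcases P.eq_empty_or_nonempty with hPe | ⟨c, hcP⟩
    · exact ih P hP (by simp [hPe]) a b hab hc hd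
    have hcard : (P \ {c}).ncard ≤ n := by
      have := Set.ncard_sdiff_singleton_add_one hcP hP
      omega
    by_cases hcab : c ∈ Ioo a b
    · refine (ih (P \ {c}) hP.sdiff hcard a c hcab.1.le
        (hc.mono (Icc_subset_Icc_right hcab.2.le)) ?_).trans
        (ih (P \ {c}) hP.sdiff hcard c b hcab.2.le
        (hc.mono (Icc_subset_Icc_left hcab.1.le)) ?_)
      · rintro x ⟨hx, hxP⟩
        exact hd x ⟨⟨hx.1, hx.2.trans hcab.2⟩, fun h => hxP ⟨h, hx.2.ne⟩⟩
      · rintro x ⟨hx, hxP⟩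
        exact hd x ⟨⟨hcab.1.trans hx.1, hx.2⟩, fun h => hxP ⟨h, hx.1.ne'⟩⟩
    · refine ih (P \ {c}) hP.sdiff hcard a b hab hc ?_
      rintro x ⟨hx, hxP⟩
      exact hd x ⟨hx, fun h => hxP ⟨h, fun hxc => hcab (hxc ▸ hx)⟩⟩

/-- The derivative of `log r * ρ r` is `(ρ r + r ρ'(r) log r) / r`, and the bracket tends to `l`.
Hence `r ^ ρ(r)` eventually grows at least as fast as `r ^ (l / 2)`. -/
theorem IsProximateOrder.log_mul_le {ρ : ℝ → ℝ} {l : ℝ} (h : IsProximateOrder ρ l) (hl : 0 < l) :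
    ∃ R : ℝ, 1 < R ∧ ∀ s t, R ≤ s → s ≤ t →
      Real.log s * ρ s + l / 2 * (Real.log t - Real.log s) ≤ Real.log t * ρ t := by
  obtain ⟨c, hc0, hcont, -, hlim, P, hPc, hPfin, hdiff, -, hder⟩ := h
  have e1 : ∀ᶠ r in atTop, 3 * l / 4 < ρ r := hlim.eventually_const_lt (by linarith)
  have e2 : ∀ᶠ r in atTop ⊓ 𝓟 Pᶜ, -(l / 4) < r * deriv ρ r * Real.log r :=
    hder.eventually_const_lt (by linarith)
  rw [eventually_inf_principal] at e2
  obtain ⟨R₀, hR₀⟩ := eventually_atTop.1 (e1.and e2)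
  refine ⟨max (max R₀ 2) (c + 1), by
    exact lt_of_lt_of_le (by norm_num) ((le_max_right R₀ 2).trans (le_max_left _ _)), ?_⟩
  intro s t hs hst
  have hs1 : R₀ ≤ s := (le_max_left _ _).trans ((le_max_left _ _).trans hs)
  have hs2 : 2 ≤ s := (le_max_right _ _).trans ((le_max_left _ _).trans hs)
  have hs3 : c < s := by linarith [(le_max_right (max R₀ 2) (c + 1)).trans hs]
  have key := le_of_deriv_nonneg_off_finite (f := fun r => Real.log r * ρ r - l / 2 * Real.log r)
    _ (P ∩ Iic t) (hPfin t) le_rfl s t hst ?_ ?_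
  · linarith
  · have hlog : ContinuousOn Real.log (Icc s t) :=
      Real.continuousOn_log.mono fun x hx => by
        have := hx.1
        simp only [mem_compl_iff, mem_singleton_iff]; linarith
    exact (hlog.mul (hcont.mono fun x hx => hs3.trans_le hx.1)).sub (continuousOn_const.mul hlog)
  · rintro r ⟨hr, hrP⟩
    have hrP' : r ∉ P := fun h => hrP ⟨h, hr.2.le⟩
    have hr0 : 0 < r := by linarith [hr.1]
    have hd : HasDerivAt ρ (deriv ρ r) r := (hdiff r ⟨hs3.trans hr.1, hrP'⟩).hasDerivAt
    have hlog := Real.hasDerivAt_log hr0.ne'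
    have hD : HasDerivAt (fun r => Real.log r * ρ r - l / 2 * Real.log r)
        (r⁻¹ * ρ r + Real.log r * deriv ρ r - l / 2 * r⁻¹) r :=
      (hlog.mul hd).sub (hlog.const_mul (l / 2))
    refine ⟨hD.differentiableAt, ?_⟩
    rw [hD.deriv]
    obtain ⟨a1, a2⟩ := hR₀ r (hs1.trans hr.1.le)
    have a2 := a2 hrP'
    have : r⁻¹ * ρ r + Real.log r * deriv ρ r - l / 2 * r⁻¹ =
        r⁻¹ * (ρ r - l / 2 + r * deriv ρ r * Real.log r) := by field_simp; ring
    rw [this]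
    exact mul_nonneg (inv_nonneg.2 hr0.le) (by linarith)

section
variable {M : ℕ → ℝ}

theorem IsWeightSequence.omegaFun_pos (h : IsWeightSequence M) (h1 : M 1 = 1) {t : ℝ}
    (ht : 1 < t) : 0 < omegaFun M t := by
  refine (Real.log_pos ht).trans_le ?_
  simpa [h1] using h.le_omegaFun (by linarith : 0 < t) 1

/-- Up to a bounded term `log ω_M(t)` is `ρ(t) log t`, so a fixed dilation at least doubles `ω_M`
for large `t`; for small `t` monotonicity gives a constant. Moderate growth follows by
`mg_of_omegaFun`. -/
theorem IsWeightSequence.isRegularSeq (h : IsWeightSequence M) (h1 : M 1 = 1)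
    (hpo : AdmitsNonzeroProximateOrder M) : IsRegularSeq M := by
  refine ⟨h.pos, h.zero, lower_of_tendsto_quot h.pos h.tendsto, ?_⟩
  obtain ⟨ρ, l, C, D, hl, hρ, hCD⟩ := hpo
  obtain ⟨R₁, hR₁, hlog⟩ := hρ.log_mul_le hl
  obtain ⟨R₂, hR₂⟩ := eventually_atTop.1 hCD
  set R := max R₁ R₂ with hR
  have hR1 : 1 < R := hR₁.trans_le (le_max_left _ _)
  -- Chosen so that the gain `l / 2 * log L` pays for the fluctuation `D - C` and still leaves `log
  -- 2`.
  set L := Real.exp (2 / l * (|D - C| + Real.log 2)) with hL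
  have hlog2 : 0 < Real.log 2 := Real.log_pos (by norm_num)
  have hL1 : 1 ≤ L := by
    rw [hL]; exact Real.one_le_exp (by positivity)
  have hlogL : l / 2 * Real.log L = |D - C| + Real.log 2 := by
    rw [hL, Real.log_exp]; field_simp
  have hform : ∀ t, 1 < t → Real.log t * (ρ t - dFun M t) =
      Real.log t * ρ t - Real.log (omegaFun M t) := by
    intro t ht
    have := Real.log_pos ht
    unfold dFun; field_simp
  have hbig : ∀ t, R ≤ t → 2 * omegaFun M t ≤ omegaFun M (L * t) := by
    intro t ht
    have ht1 : 1 < t := hR1.trans_le ht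
    have hLt : t ≤ L * t := le_mul_of_one_le_left (by linarith) hL1
    have a1 := hR₂ t ((le_max_right _ _).trans ht)
    have a2 := hR₂ (L * t) ((le_max_right _ _).trans (ht.trans hLt))
    have a3 := hlog t (L * t) ((le_max_left _ _).trans ht) hLt
    rw [hform t ht1] at a1
    rw [hform _ (ht1.trans_le hLt)] at a2
    rw [Real.log_mul (by linarith) (by linarith)] at a2 a3
    have p1 := h.omegaFun_pos h1 ht1
    have p2 := h.omegaFun_pos h1 (ht1.trans_le hLt)
    have : Real.log (2 * omegaFun M t) ≤ Real.log (omegaFun M (L * t)) := by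
      rw [Real.log_mul (by norm_num) p1.ne']
      have := le_abs_self (D - C)
      linarith [a1.1, a2.2]
    exact (Real.log_le_log_iff (by linarith) p2).1 this
  refine h.mg_of_omegaFun (H := L) (C := 2 * omegaFun M R) (by linarith) fun t ht => ?_
  have hLt : 0 < L * t := by positivity
  rcases le_total R t with hRt | hRt
  · linarith [hbig t hRt, h.omegaFun_nonneg (by linarith : 0 < R)]
  · linarith [h.omegaFun_mono ht hRt, h.omegaFun_nonneg hLt]

/-- The term of index `p + 1` suffices: `quot M p ^ (p + 1)` dominates `M (p + 1)`, and the dilation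
by `e` contributes `exp (p + 1)`. -/
theorem IsWeightSequence.succ_le_omegaFun (h : IsWeightSequence M) (p : ℕ) :
    (p : ℝ) + 1 ≤ omegaFun M (Real.exp 1 * quot M p) := by
  have hq := h.quot_pos p
  have := h.le_omegaFun (t := Real.exp 1 * quot M p) (by positivity) (p + 1)
  refine le_trans ?_ this
  rw [Real.le_log_iff_exp_le (div_pos (by positivity) (h.pos _)), le_div_iff₀ (h.pos _), mul_pow,
    ← Real.exp_nat_mul]
  push_cast
  rw [mul_one]
  gcongr
  simpa [h.zero] using h.le_mul_pow p 0 (p + 1) (by omega)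

theorem IsWeightSequence.omegaFun_quot_le (h : IsWeightSequence M) (h1 : M 1 = 1) (p : ℕ) :
    omegaFun M (quot M p) ≤ p * Real.log (quot M p) := by
  rw [h.omegaFun_quot, ← Real.log_pow]
  refine Real.log_le_log (div_pos (pow_pos (h.quot_pos p) p) (h.pos p)) ?_
  exact div_le_self (pow_pos (h.quot_pos p) p).le (h.one_le h1 p)

theorem AdmitsNonzeroProximateOrder.tendsto_dFun (hpo : AdmitsNonzeroProximateOrder M) :
    ∃ l, 0 < l ∧ Tendsto (dFun M) atTop (𝓝 l) := by
  obtain ⟨ρ, l, C, D, hl, hρ, hCD⟩ := hpo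
  refine ⟨l, hl, ?_⟩
  obtain ⟨c, -, -, -, hlim, -⟩ := hρ
  have h0 : Tendsto (fun t => ρ t - dFun M t) atTop (𝓝 0) := by
    have l1 : Tendsto (fun t => C / Real.log t) atTop (𝓝 0) :=
      Tendsto.const_div_atTop Real.tendsto_log_atTop C
    have l2 : Tendsto (fun t => D / Real.log t) atTop (𝓝 0) :=
      Tendsto.const_div_atTop Real.tendsto_log_atTop D
    refine tendsto_of_tendsto_of_tendsto_of_le_of_le' l1 l2 ?_ ?_
    · filter_upwards [hCD, eventually_gt_atTop 1] with t ht ht1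
      rw [div_le_iff₀ (Real.log_pos ht1)]; linarith [ht.1]
    · filter_upwards [hCD, eventually_gt_atTop 1] with t ht ht1
      rw [le_div_iff₀ (Real.log_pos ht1)]; linarith [ht.2]
  simpa using hlim.sub h0

/-- The inequalities `ω_M(m_p) ≤ p log m_p` and `p + 1 ≤ ω_M(e m_p)` trap `log p / log m_p` between
two quantities with the limit of `dFun M`. The liminf in `growthIndex` is therefore a limit, and
this is what lets growth indices be subtracted. -/
theorem IsWeightSequence.tendsto_log_quot (h : IsWeightSequence M) (h1 : M 1 = 1)
    (hpo : AdmitsNonzeroProximateOrder M) :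
    ∃ w, 0 < w ∧ Tendsto (fun p : ℕ => Real.log (quot M p) / Real.log p) atTop (𝓝 w) := by
  obtain ⟨l, hl, hd⟩ := hpo.tendsto_dFun
  refine ⟨l⁻¹, inv_pos.2 hl, ?_⟩
  have hlogm : Tendsto (fun p => Real.log (quot M p)) atTop atTop :=
    Real.tendsto_log_atTop.comp h.tendsto
  have t1 : Tendsto (fun p => dFun M (quot M p) -
      Real.log (Real.log (quot M p)) / Real.log (quot M p)) atTop (𝓝 l) := by
    have : Tendsto (fun x : ℝ => Real.log x / x) atTop (𝓝 0) := by
      simpa using Real.tendsto_pow_log_div_mul_add_atTop 1 0 1 one_ne_zero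
    simpa using (hd.comp h.tendsto).sub (this.comp hlogm)
  have t2 : Tendsto (fun p => dFun M (Real.exp 1 * quot M p) *
      (1 + 1 / Real.log (quot M p))) atTop (𝓝 l) := by
    have a1 : Tendsto (fun p => Real.exp 1 * quot M p) atTop atTop :=
      h.tendsto.const_mul_atTop (Real.exp_pos 1)
    have a2 : Tendsto (fun p => 1 + 1 / Real.log (quot M p)) atTop (𝓝 (1 + 0)) :=
      tendsto_const_nhds.add (Tendsto.const_div_atTop hlogm 1)
    simpa using (hd.comp a1).mul a2
  have key : Tendsto (fun p : ℕ => Real.log p / Real.log (quot M p)) atTop (𝓝 l) := by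
    refine tendsto_of_tendsto_of_tendsto_of_le_of_le' t1 t2 ?_ ?_
    · filter_upwards [hlogm.eventually_gt_atTop 0, h.tendsto.eventually_gt_atTop 1,
        eventually_gt_atTop 0] with p hp hq hp0
      have hpp : (0 : ℝ) < p := by exact_mod_cast hp0
      unfold dFun
      rw [← sub_div, div_le_div_iff_of_pos_right hp, sub_le_iff_le_add, ← Real.log_mul hpp.ne' hp.ne']
      exact Real.log_le_log (h.omegaFun_pos h1 hq) (h.omegaFun_quot_le h1 p)
    · filter_upwards [hlogm.eventually_gt_atTop 0, h.tendsto.eventually_gt_atTop 1,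
        eventually_gt_atTop 0] with p hp hq hp0
      have hpp : (0 : ℝ) < p := by exact_mod_cast hp0
      have hle : Real.log p ≤ Real.log (omegaFun M (Real.exp 1 * quot M p)) :=
        Real.log_le_log hpp (by linarith [h.succ_le_omegaFun p])
      have hlm : Real.log (Real.exp 1 * quot M p) = 1 + Real.log (quot M p) := by
        rw [Real.log_mul (Real.exp_pos 1).ne' (by linarith), Real.log_exp]
      unfold dFun
      rw [hlm, div_le_iff₀ hp]
      refine hle.trans (le_of_eq ?_)
      field_simp
      ring
  have := key.inv₀ hl.ne'
  simpa using this

theorem growthIndex_eq {w : ℝ}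
    (h : Tendsto (fun p : ℕ => Real.log (quot M p) / Real.log p) atTop (𝓝 w)) :
    growthIndex M = w := h.liminf_eq

end

/-! ### The quotient of two weight sequences -/

section Quotient
variable {M₁ M₂ : ℕ → ℝ}

theorem quot_div (h₁ : ∀ p, 0 < M₁ p) (h₂ : ∀ p, 0 < M₂ p) (p : ℕ) :
    quot (M₂ / M₁) p = quot M₂ p / quot M₁ p := by
  have := h₁ p; have := h₁ (p + 1); have := h₂ p
  simp only [quot, Pi.div_apply]
  field_simp

theorem growthIndex_pos (h : IsWeightSequence M₁) (h1 : M₁ 1 = 1)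
    (hpo : AdmitsNonzeroProximateOrder M₁) : 0 < growthIndex M₁ := by
  obtain ⟨w, hw, ht⟩ := h.tendsto_log_quot h1 hpo
  rwa [growthIndex_eq ht]

theorem tendsto_log_quot_div (h₁ : IsWeightSequence M₁) (h₂ : IsWeightSequence M₂)
    (hn₁ : M₁ 1 = 1) (hn₂ : M₂ 1 = 1)
    (hpo₁ : AdmitsNonzeroProximateOrder M₁) (hpo₂ : AdmitsNonzeroProximateOrder M₂) :
    Tendsto (fun p : ℕ => Real.log (quot (M₂ / M₁) p) / Real.log p) atTop
      (𝓝 (growthIndex M₂ - growthIndex M₁)) := by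
  obtain ⟨w₁, -, ht₁⟩ := h₁.tendsto_log_quot hn₁ hpo₁
  obtain ⟨w₂, -, ht₂⟩ := h₂.tendsto_log_quot hn₂ hpo₂
  rw [growthIndex_eq ht₁, growthIndex_eq ht₂]
  refine (ht₂.sub ht₁).congr fun p => ?_
  rw [quot_div h₁.pos h₂.pos, Real.log_div (h₂.quot_pos p).ne' (h₁.quot_pos p).ne', sub_div]

theorem growthIndex_div (h₁ : IsWeightSequence M₁) (h₂ : IsWeightSequence M₂)
    (hn₁ : M₁ 1 = 1) (hn₂ : M₂ 1 = 1)
    (hpo₁ : AdmitsNonzeroProximateOrder M₁) (hpo₂ : AdmitsNonzeroProximateOrder M₂) :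
    growthIndex (M₂ / M₁) = growthIndex M₂ - growthIndex M₁ :=
  growthIndex_eq (tendsto_log_quot_div h₁ h₂ hn₁ hn₂ hpo₁ hpo₂)

/-- The quotient need not be logarithmically convex. Moderate growth passes from `M₂` because `M₁`
is supermultiplicative (`mul_le_add`), and the quotients tend to infinity because they behave like a
positive power of `p` on the logarithmic scale. -/
theorem isRegularSeq_div (h₁ : IsWeightSequence M₁) (h₂ : IsWeightSequence M₂)
    (hn₁ : M₁ 1 = 1) (hn₂ : M₂ 1 = 1)
    (hpo₁ : AdmitsNonzeroProximateOrder M₁) (hpo₂ : AdmitsNonzeroProximateOrder M₂)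
    (hlt : growthIndex M₁ < growthIndex M₂) : IsRegularSeq (M₂ / M₁) := by
  have hpos : ∀ p, 0 < (M₂ / M₁) p := fun p => div_pos (h₂.pos p) (h₁.pos p)
  refine ⟨hpos, by simp [h₁.zero, h₂.zero], lower_of_tendsto_quot hpos ?_, ?_⟩
  · have ht := tendsto_log_quot_div h₁ h₂ hn₁ hn₂ hpo₁ hpo₂
    have hlogp : Tendsto (fun p : ℕ => Real.log p) atTop atTop :=
      Real.tendsto_log_atTop.comp tendsto_natCast_atTop_atTop
    have h3 := Real.tendsto_exp_atTop.comp (ht.pos_mul_atTop (sub_pos.2 hlt) hlogp)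
    refine h3.congr' ?_
    filter_upwards [hlogp.eventually_gt_atTop 0] with p hp
    simp only [Function.comp]
    rw [div_mul_cancel₀ _ hp.ne', Real.exp_log]
    exact div_pos (hpos _) (hpos _)
  · obtain ⟨H, hH, hmg⟩ := (h₂.isRegularSeq hn₂ hpo₂).mg
    refine ⟨H, hH, fun p q => ?_⟩
    simp only [Pi.div_apply]
    rw [div_mul_div_comm, mul_div_assoc']
    have := h₁.mul_le_add p q
    exact div_le_div₀ ((h₂.pos _).le.trans (hmg p q)) (hmg p q)
      (mul_pos (h₁.pos p) (h₁.pos q)) this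

end Quotient

/-! ### Holomorphic parameter integrals -/

/-- Cauchy's estimate on smaller discs turns the bound of the integrand into a bound of its
derivative in the parameter. -/
theorem differentiableAt_integral_param {μ : Measure ℝ} {F : ℂ → ℝ → ℂ} {w₀ : ℂ} {r : ℝ}
    {bound : ℝ → ℝ} (hr : 0 < r)
    (hmeas : ∀ w ∈ Metric.ball w₀ r, AEStronglyMeasurable (F w) μ)
    (hb : ∀ᵐ s ∂μ, ∀ w ∈ Metric.ball w₀ r, ‖F w s‖ ≤ bound s) (hbi : Integrable bound μ)
    (hd : ∀ᵐ s ∂μ, ∀ w ∈ Metric.ball w₀ r, DifferentiableAt ℂ (fun w => F w s) w) :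
    DifferentiableAt ℂ (fun w => ∫ s, F w s ∂μ) w₀ := by
  have hw₀ : w₀ ∈ Metric.ball w₀ r := Metric.mem_ball_self hr
  have hr2 : 0 < r / 2 := by positivity
  have hball : ∀ w ∈ Metric.ball w₀ (r / 2), ∀ z ∈ Metric.closedBall w (r / 4),
      z ∈ Metric.ball w₀ r := by
    intro w hw z hz
    rw [Metric.mem_ball] at hw ⊢
    rw [Metric.mem_closedBall] at hz
    linarith [dist_triangle z w w₀]
  refine (hasDerivAt_integral_of_dominated_loc_of_deriv_le (F := F)
    (F' := fun w s => deriv (fun w => F w s) w) (bound := fun s => bound s / (r / 4))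
    (Metric.ball_mem_nhds w₀ hr2) ?_ ?_ ?_ ?_ (hbi.div_const _) ?_).2.differentiableAt
  · filter_upwards [Metric.ball_mem_nhds w₀ hr] with w hw using hmeas w hw
  · exact hbi.mono' (hmeas w₀ hw₀) (hb.mono fun s hs => hs w₀ hw₀)
  -- The derivative is measurable in `s` as a limit of difference quotients along a fixed null
  -- sequence.
  · set h : ℕ → ℂ := fun n => ((r / 2 / ((n : ℝ) + 1) : ℝ) : ℂ) with hh
    have hpos : ∀ n : ℕ, 0 < r / 2 / ((n : ℝ) + 1) := fun n => by positivity
    have hmem : ∀ n, w₀ + h n ∈ Metric.ball w₀ r := by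
      intro n
      rw [Metric.mem_ball, dist_eq_norm, add_sub_cancel_left, hh, Complex.norm_real, Real.norm_eq_abs,
        abs_of_pos (hpos n)]
      have : r / 2 / ((n : ℝ) + 1) ≤ r / 2 := div_le_self hr2.le (by linarith [n.cast_nonneg (α := ℝ)])
      linarith
    have hlim : Tendsto h atTop (𝓝[≠] 0) := by
      refine tendsto_nhdsWithin_iff.2 ⟨?_, Eventually.of_forall fun n => ?_⟩
      · have h1 : Tendsto (fun n : ℕ => r / 2 / ((n : ℝ) + 1)) atTop (𝓝 0) := by
          have := (tendsto_one_div_add_atTop_nhds_zero_nat (𝕜 := ℝ)).const_mul (r / 2)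
          simpa [div_eq_mul_inv] using this
        have h2 := (Complex.continuous_ofReal.tendsto 0).comp h1
        rw [Complex.ofReal_zero] at h2
        exact h2
      · simp only [mem_compl_iff, mem_singleton_iff, hh]
        exact_mod_cast (hpos n).ne'
    refine aestronglyMeasurable_of_tendsto_ae atTop
      (f := fun n s => (h n)⁻¹ • (F (w₀ + h n) s - F w₀ s)) (fun n => ?_) ?_
    · exact ((hmeas _ (hmem n)).sub (hmeas _ hw₀)).const_smul (h n)⁻¹
    · filter_upwards [hd] with s hs
      exact ((hasDerivAt_iff_tendsto_slope_zero.1 (hs w₀ hw₀).hasDerivAt)).comp hlim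
  · filter_upwards [hb, hd] with s hs hds w hw
    refine Complex.norm_deriv_le_of_forall_mem_sphere_norm_le (by positivity) ?_ ?_
    · refine DifferentiableOn.diffContOnCl fun z hz => ?_
      rw [closure_ball _ (by positivity)] at hz
      exact (hds z (hball w hw z hz)).differentiableWithinAt
    · intro z hz
      exact hs z (hball w hw z (Metric.sphere_subset_closedBall hz))
  · filter_upwards [hd] with s hs w hw
    exact (hs w (Metric.ball_subset_ball (by linarith) hw)).hasDerivAt

/-! ### Points, exponential bounds -/

@[simp] theorem pt_re (s τ : ℝ) : (pt s τ).re = s := by simp [pt]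
@[simp] theorem pt_im (s τ : ℝ) : (pt s τ).im = τ := by simp [pt]

theorem pt_re_im (w : ℂ) : pt w.re w.im = w := by simp [pt]

theorem continuous_pt_left (τ : ℝ) : Continuous fun s : ℝ => pt s τ := by
  unfold pt; fun_prop

theorem continuous_pt_right (s : ℝ) : Continuous fun τ : ℝ => pt s τ := by
  unfold pt; fun_prop

theorem integrable_exp_neg_mul_abs {a : ℝ} (ha : 0 < a) (y : ℝ) :
    Integrable fun s : ℝ => Real.exp (-a * |s - y|) := by
  have h0 : Integrable fun s : ℝ => Real.exp (-a * |s|) := by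
    rw [← integrableOn_univ, ← Iic_union_Ioi (a := (0 : ℝ)), integrableOn_union]
    constructor
    · refine (integrableOn_exp_mul_Iic ha 0).congr_fun (fun s hs => ?_) measurableSet_Iic
      simp only [mem_Iic] at hs
      simp only [abs_of_nonpos hs]; ring_nf
    · refine (exp_neg_integrableOn_Ioi 0 ha).congr_fun (fun s hs => ?_) measurableSet_Ioi
      simp only [mem_Ioi] at hs
      simp only [abs_of_pos hs]
  exact h0.comp_sub_right y

theorem continuousOn_comp_pt {g : ℂ → ℂ} {θ : ℝ} {s : Set ℝ}
    (hg : ∀ x ∈ s, ContinuousAt g (pt x θ)) : ContinuousOn (fun x => g (pt x θ)) s :=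
  fun x hx => ((hg x hx).comp (f := fun x : ℝ => pt x θ)
    (continuous_pt_left θ).continuousAt).continuousWithinAt

/-! ### Rectangles, half-strips and strips -/

/-- The integral over the half-line at height `θ` that ends at abscissa `x`. -/
noncomputable def horiz (g : ℂ → ℂ) (x θ : ℝ) : ℂ := ∫ s in Iic x, g (pt s θ)

/-- The integral over a vertical segment at abscissa `x`. -/
noncomputable def vert (g : ℂ → ℂ) (x θ θ' : ℝ) : ℂ := ∫ φ in θ..θ', Complex.I * g (pt x φ)

/-- The integral over a Hankel path that comes from `-∞` at height `θ`, and returns to it at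
height `θ'`. -/
noncomputable def hankel (g : ℂ → ℂ) (x θ θ' : ℝ) : ℂ := horiz g x θ + vert g x θ θ' - horiz g x θ'

theorem rect_integral_eq_zero {g : ℂ → ℂ} {x₁ x₀ θ θ' : ℝ}
    (hd : ∀ v : ℂ, v.re ∈ uIcc x₁ x₀ → v.im ∈ uIcc θ θ' → DifferentiableAt ℂ g v) :
    (∫ s in x₁..x₀, g (pt s θ)) - (∫ s in x₁..x₀, g (pt s θ')) + vert g x₀ θ θ'
      - vert g x₁ θ θ' = 0 := by
  have := Complex.integral_boundary_rect_eq_zero_of_differentiableOn g (pt x₁ θ) (pt x₀ θ')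
    (fun v hv => (hd v (by simpa using hv.1) (by simpa using hv.2)).differentiableWithinAt)
  simp only [pt_re, pt_im, smul_eq_mul] at this
  unfold vert
  rw [intervalIntegral.integral_const_mul, intervalIntegral.integral_const_mul]
  exact this

theorem integrableOn_of_exp_bound {g : ℂ → ℂ} {x θ C a : ℝ} (ha : 0 < a)
    (hc : ∀ s ≤ x, ContinuousAt g (pt s θ)) (hb : ∀ s ≤ x, ‖g (pt s θ)‖ ≤ C * Real.exp (a * s)) :
    IntegrableOn (fun s => g (pt s θ)) (Iic x) := by
  refine Integrable.mono' ((integrableOn_exp_mul_Iic ha x).const_mul C)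
    ((continuousOn_comp_pt hc).aestronglyMeasurable measurableSet_Iic) ?_
  filter_upwards [ae_restrict_mem measurableSet_Iic] with s hs using hb s hs

theorem norm_horiz_le {g : ℂ → ℂ} {x θ X b : ℝ} (hb : 0 < b)
    (h : ∀ s ≤ x, ‖g (pt s θ)‖ ≤ X * Real.exp (b * (s - x))) : ‖horiz g x θ‖ ≤ X / b := by
  have h1 : ∀ s, X * Real.exp (b * (s - x)) = X * Real.exp (-(b * x)) * Real.exp (b * s) := by
    intro s; rw [mul_assoc, ← Real.exp_add]; ring_nf
  calc ‖horiz g x θ‖ ≤ ∫ s in Iic x, X * Real.exp (-(b * x)) * Real.exp (b * s) := by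
        refine norm_integral_le_of_norm_le ((integrableOn_exp_mul_Iic hb x).const_mul _) ?_
        filter_upwards [ae_restrict_mem measurableSet_Iic] with s hs
        rw [← h1]; exact h s hs
    _ = X / b := by
        rw [integral_const_mul, integral_exp_mul_Iic hb, mul_assoc, mul_div_assoc', ← Real.exp_add]
        simp [div_eq_mul_inv]

theorem norm_vert_le {g : ℂ → ℂ} {x θ θ' X : ℝ}
    (h : ∀ φ ∈ uIcc θ θ', ‖g (pt x φ)‖ ≤ X) : ‖vert g x θ θ'‖ ≤ X * |θ' - θ| := by
  refine intervalIntegral.norm_integral_le_of_norm_le_const fun φ hφ => ?_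
  simpa using h φ (uIoc_subset_uIcc hφ)

theorem norm_hankel_le {g : ℂ → ℂ} {x θ θ' X b : ℝ} (hb : 0 < b)
    (h : ∀ s ≤ x, ‖g (pt s θ)‖ ≤ X * Real.exp (b * (s - x)))
    (h' : ∀ s ≤ x, ‖g (pt s θ')‖ ≤ X * Real.exp (b * (s - x)))
    (hv : ∀ φ ∈ uIcc θ θ', ‖g (pt x φ)‖ ≤ X) :
    ‖hankel g x θ θ'‖ ≤ X * (2 / b + |θ' - θ|) := by
  unfold hankel
  calc _ ≤ X / b + X * |θ' - θ| + X / b :=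
        (norm_sub_le _ _).trans (add_le_add ((norm_add_le _ _).trans
          (add_le_add (norm_horiz_le hb h) (norm_vert_le hv))) (norm_horiz_le hb h'))
    _ = _ := by ring

theorem intervalIntegrable_vert {g : ℂ → ℂ} {x θ θ' : ℝ}
    (h : ∀ φ ∈ uIcc θ θ', ContinuousAt g (pt x φ)) :
    IntervalIntegrable (fun φ => Complex.I * g (pt x φ)) volume θ θ' := by
  refine ContinuousOn.intervalIntegrable fun φ hφ => ?_
  exact (continuousAt_const.mul ((h φ hφ).comp (f := fun φ : ℝ => pt x φ)
    (continuous_pt_right x).continuousAt)).continuousWithinAt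

theorem vert_tendsto_zero {g : ℂ → ℂ} {x θ θ' C a : ℝ} (ha : 0 < a)
    (hb : ∀ v : ℂ, v.re ≤ x → v.im ∈ uIcc θ θ' → ‖g v‖ ≤ C * Real.exp (a * v.re)) :
    Tendsto (fun y => vert g y θ θ') atBot (𝓝 0) := by
  have h1 : Tendsto (fun y : ℝ => C * Real.exp (a * y) * |θ' - θ|) atBot (𝓝 0) := by
    have := (Real.tendsto_exp_atBot.comp (tendsto_id.const_mul_atBot ha)).const_mul C |>.mul_const
      |θ' - θ|
    simpa using this
  refine squeeze_zero_norm' ?_ h1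
  filter_upwards [eventually_le_atBot x] with y hy
  refine norm_vert_le fun φ hφ => ?_
  simpa using hb (pt y φ) (by simpa using hy) (by simpa using hφ)

/-- Cauchy's theorem on rectangles whose far side recedes to `-∞` and vanishes by the exponential
bound. -/
theorem horiz_add_vert {g : ℂ → ℂ} {x θ θ' C a : ℝ} (ha : 0 < a)
    (hd : ∀ v : ℂ, v.re ≤ x → v.im ∈ uIcc θ θ' → DifferentiableAt ℂ g v)
    (hb : ∀ v : ℂ, v.re ≤ x → v.im ∈ uIcc θ θ' → ‖g v‖ ≤ C * Real.exp (a * v.re)) :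
    horiz g x θ + vert g x θ θ' = horiz g x θ' := by
  have hi : ∀ φ ∈ uIcc θ θ', IntegrableOn (fun s => g (pt s φ)) (Iic x) := by
    intro φ hφ
    refine integrableOn_of_exp_bound ha (C := C) (fun s hs => ?_) fun s hs => ?_
    · exact (hd _ (by simpa using hs) (by simpa using hφ)).continuousAt
    · simpa using hb (pt s φ) (by simpa using hs) (by simpa using hφ)
  have l1 := intervalIntegral_tendsto_integral_Iic x (hi θ left_mem_uIcc) tendsto_id
  have l2 := intervalIntegral_tendsto_integral_Iic x (hi θ' right_mem_uIcc) tendsto_id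
  have l3 := vert_tendsto_zero ha hb
  have l4 := ((l1.sub l2).add_const (vert g x θ θ')).sub l3
  have l5 : Tendsto (fun _ : ℝ => (0 : ℂ)) atBot (𝓝 0) := tendsto_const_nhds
  have := tendsto_nhds_unique (l4.congr' ?_) l5
  · unfold horiz
    rw [sub_zero] at this
    linear_combination this
  · filter_upwards [eventually_le_atBot x] with y hy
    refine rect_integral_eq_zero fun v hv hv' => hd v ?_ hv'
    rw [id, uIcc_of_le hy] at hv
    exact hv.2

/-- Turning the incoming ray sweeps a half-strip in which the integrand is holomorphic and decays.
`hankel_right_eq` treats the outgoing ray. -/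
theorem hankel_left_eq {g : ℂ → ℂ} {x θ₁ θ₂ θ' C a : ℝ} (ha : 0 < a)
    (hd : ∀ v : ℂ, v.re ≤ x → v.im ∈ uIcc θ₁ θ₂ → DifferentiableAt ℂ g v)
    (hb : ∀ v : ℂ, v.re ≤ x → v.im ∈ uIcc θ₁ θ₂ → ‖g v‖ ≤ C * Real.exp (a * v.re))
    (hc : ∀ φ ∈ uIcc θ₁ θ', ContinuousAt g (pt x φ)) :
    hankel g x θ₂ θ' = hankel g x θ₁ θ' := by
  have h1 := horiz_add_vert ha hd hb
  have hi1 : IntervalIntegrable (fun φ => Complex.I * g (pt x φ)) volume θ₁ θ₂ :=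
    intervalIntegrable_vert fun φ hφ => (hd _ (by simp) (by simpa using hφ)).continuousAt
  have h2 := intervalIntegral.integral_add_adjacent_intervals hi1
    (hi1.symm.trans (intervalIntegrable_vert hc))
  unfold hankel
  unfold vert at *
  linear_combination h2 - h1

theorem hankel_right_eq {g : ℂ → ℂ} {x θ θ₁ θ₂ C a : ℝ} (ha : 0 < a)
    (hd : ∀ v : ℂ, v.re ≤ x → v.im ∈ uIcc θ₁ θ₂ → DifferentiableAt ℂ g v)
    (hb : ∀ v : ℂ, v.re ≤ x → v.im ∈ uIcc θ₁ θ₂ → ‖g v‖ ≤ C * Real.exp (a * v.re))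
    (hc : ∀ φ ∈ uIcc θ θ₁, ContinuousAt g (pt x φ)) :
    hankel g x θ θ₂ = hankel g x θ θ₁ := by
  have h1 := horiz_add_vert ha hd hb
  have hi1 : IntervalIntegrable (fun φ => Complex.I * g (pt x φ)) volume θ₁ θ₂ :=
    intervalIntegrable_vert fun φ hφ => (hd _ (by simp) (by simpa using hφ)).continuousAt
  have h2 := intervalIntegral.integral_add_adjacent_intervals (intervalIntegrable_vert hc) hi1
  unfold hankel
  unfold vert at *
  linear_combination h1 - h2

theorem hankel_shift {g : ℂ → ℂ} {x₁ x₀ θ θ' : ℝ} (hx : x₁ ≤ x₀)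
    (hd : ∀ v : ℂ, x₁ ≤ v.re → v.re ≤ x₀ → v.im ∈ uIcc θ θ' → DifferentiableAt ℂ g v)
    (hi : IntegrableOn (fun s => g (pt s θ)) (Iic x₀))
    (hi' : IntegrableOn (fun s => g (pt s θ')) (Iic x₀)) :
    hankel g x₀ θ θ' = hankel g x₁ θ θ' := by
  have h1 := rect_integral_eq_zero (g := g) (x₁ := x₁) (x₀ := x₀) (θ := θ) (θ' := θ')
    (fun v hv hv' => by rw [uIcc_of_le hx] at hv; exact hd v hv.1 hv.2 hv')
  rw [← intervalIntegral.integral_Iic_sub_Iic (hi.mono_set (Iic_subset_Iic.2 hx)) hi,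
    ← intervalIntegral.integral_Iic_sub_Iic (hi'.mono_set (Iic_subset_Iic.2 hx)) hi'] at h1
  unfold hankel horiz
  linear_combination h1

theorem hankel_eq_zero {g : ℂ → ℂ} {x θ θ' C a : ℝ} (ha : 0 < a)
    (hd : ∀ v : ℂ, v.re ≤ x → v.im ∈ uIcc θ θ' → DifferentiableAt ℂ g v)
    (hb : ∀ v : ℂ, v.re ≤ x → v.im ∈ uIcc θ θ' → ‖g v‖ ≤ C * Real.exp (a * v.re)) :
    hankel g x θ θ' = 0 := by
  have := horiz_add_vert ha hd hb
  unfold hankel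
  rw [this, sub_self]

/-- Rotation of the direction of integration. -/
theorem integral_pt_eq {g : ℂ → ℂ} {θ θ' C a y : ℝ} (ha : 0 < a)
    (hd : ∀ v : ℂ, v.im ∈ uIcc θ θ' → DifferentiableAt ℂ g v)
    (hb : ∀ v : ℂ, v.im ∈ uIcc θ θ' → ‖g v‖ ≤ C * Real.exp (-a * |v.re - y|)) :
    ∫ s, g (pt s θ) = ∫ s, g (pt s θ') := by
  have hi : ∀ φ ∈ uIcc θ θ', Integrable (fun s => g (pt s φ)) := by
    intro φ hφ
    refine Integrable.mono' ((integrable_exp_neg_mul_abs ha y).const_mul C)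
      (Continuous.aestronglyMeasurable ?_) (Eventually.of_forall fun s => ?_)
    · rw [← continuousOn_univ]
      exact continuousOn_comp_pt fun s _ => (hd _ (by simpa using hφ)).continuousAt
    · simpa using hb (pt s φ) (by simpa using hφ)
  have l1 := intervalIntegral_tendsto_integral (hi θ left_mem_uIcc) tendsto_neg_atTop_atBot
    tendsto_id
  have l2 := intervalIntegral_tendsto_integral (hi θ' right_mem_uIcc) tendsto_neg_atTop_atBot
    tendsto_id
  have hz : ∀ f : ℝ → ℝ, Tendsto (fun x => |f x - y|) atTop atTop →
      Tendsto (fun x => vert g (f x) θ θ') atTop (𝓝 0) := by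
    intro f hf
    have h1 : Tendsto (fun x : ℝ => C * Real.exp (-a * |f x - y|) * |θ' - θ|) atTop (𝓝 0) := by
      have := (Real.tendsto_exp_atBot.comp (hf.const_mul_atTop_of_neg
        (neg_lt_zero.2 ha))).const_mul C |>.mul_const |θ' - θ|
      simpa using this
    refine squeeze_zero_norm (fun x => norm_vert_le fun φ hφ => ?_) h1
    simpa using hb (pt (f x) φ) (by simpa using hφ)
  have l3 := hz id (tendsto_abs_atTop_atTop.comp (tendsto_atTop_add_const_right _ (-y) tendsto_id))
  have l4 := hz (fun x => -x) (tendsto_abs_atBot_atTop.comp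
    (tendsto_atBot_add_const_right _ (-y) tendsto_neg_atTop_atBot))
  have l5 := ((l1.sub l2).add l3).sub l4
  have l6 : Tendsto (fun _ : ℝ => (0 : ℂ)) atTop (𝓝 0) := tendsto_const_nhds
  have := tendsto_nhds_unique (l5.congr fun x => rect_integral_eq_zero fun v _ hv' => hd v hv') l6
  linear_combination this

/-! ### Growth of kernels -/

/-- Kernels on `S_ω` that are `O(|z|^a)` at the origin and have `N`-exponential decay at infinity. -/
structure KernelBound (N : ℕ → ℝ) (ω : ℝ) (e : ℂ → ℂ) : Prop where
  holo : DifferentiableOn ℂ e (sector 0 ω)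
  bound : ∃ a : ℝ, 0 < a ∧ ∀ θ, θ < ω * Real.pi / 2 → ∃ C k : ℝ, 0 < C ∧ 0 < k ∧
    ∀ w : ℂ, |w.im| ≤ θ → ‖e w‖ ≤ C * Real.exp (a * w.re) ∧
      ‖e w‖ ≤ C * hFun N (k * Real.exp (-w.re))

theorem isOpen_sector (d γ : ℝ) : IsOpen (sector d γ) := by
  unfold sector argument
  exact isOpen_lt (by fun_prop) continuous_const

theorem isOpen_bddSector (d γ r : ℝ) : IsOpen (bddSector d γ r) := by
  change IsOpen ({w : ℂ | |w.im - d| < γ * Real.pi / 2} ∩ {w : ℂ | Real.exp w.re < r})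
  exact (isOpen_lt (by fun_prop) continuous_const).inter (isOpen_lt (by fun_prop) continuous_const)

theorem differentiableAt_of_sector {f : ℂ → ℂ} {d γ : ℝ} (h : DifferentiableOn ℂ f (sector d γ))
    {w : ℂ} (hw : |w.im - d| < γ * Real.pi / 2) : DifferentiableAt ℂ f w :=
  h.differentiableAt ((isOpen_sector d γ).mem_nhds hw)

theorem KernelBound.differentiableAt {N : ℕ → ℝ} {ω : ℝ} {e : ℂ → ℂ} (h : KernelBound N ω e)
    {w : ℂ} (hw : |w.im| < ω * Real.pi / 2) : DifferentiableAt ℂ e w :=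
  differentiableAt_of_sector h.holo (by simpa using hw)

/-- Away from the origin `|z|^a` is bounded below while `h_M ≤ 1` keeps `e` bounded. So the bound at
the origin and the bound at infinity both hold on the whole subsector, with one exponent `a` for all
openings. -/
theorem IsStrongKernel.kernelBound {M : ℕ → ℝ} {e : ℂ → ℂ} (hM : IsRegularSeq M)
    (hω : 0 < growthIndex M) (h : IsStrongKernel M e) : KernelBound M (growthIndex M) e := by
  have hπ := Real.pi_pos
  refine ⟨h.holo, ?_⟩
  obtain ⟨a, ha, hsm⟩ := h.small
  refine ⟨a, ha, fun θ hθ => ?_⟩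
  set ω := growthIndex M
  have hθ1 : 2 * θ / Real.pi < ω := by rw [div_lt_iff₀ hπ]; linarith
  obtain ⟨τ, hτ1, hτ2⟩ := exists_between (max_lt hω hθ1)
  have hτ0 : 0 < τ := (le_max_left _ _).trans_lt hτ1
  have hτθ : θ < τ * Real.pi / 2 := by
    have := (le_max_right _ _).trans_lt hτ1
    rw [div_lt_iff₀ hπ] at this; linarith
  obtain ⟨C₁, ε, hC₁, hε, hb⟩ := hsm τ hτ0 hτ2
  obtain ⟨C₂, k, hC₂, hk, hb'⟩ := h.decay (ω - τ) (by linarith)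
  have hεa : 0 < ε ^ a := Real.rpow_pos_of_pos hε a
  refine ⟨max C₁ (max C₂ (C₂ / ε ^ a)), k, lt_max_of_lt_left hC₁, hk, fun w hw => ?_⟩
  have hdec := hb' w (by
    simp only [sector, argument, mem_ofPred_eq, sub_zero]; linarith)
  have hmod : k / modulus w = k * Real.exp (-w.re) := by
    rw [modulus, Real.exp_neg, div_eq_mul_inv]
  rw [hmod] at hdec
  have hpos : 0 < k * Real.exp (-w.re) := by positivity
  have hh := hM.hFun_pos hpos
  constructor
  · have hexp : modulus w ^ a = Real.exp (a * w.re) := by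
      rw [modulus, ← Real.exp_mul]; ring_nf
    rcases le_total (modulus w) ε with hmw | hmw
    · have := hb w (by simp only [sector, argument, mem_ofPred_eq, sub_zero]; linarith) hmw
      rw [hexp] at this
      refine this.trans ?_
      gcongr
      exact le_max_left _ _
    · have h1 : ε ^ a ≤ Real.exp (a * w.re) := by
        rw [← hexp]; exact Real.rpow_le_rpow hε.le hmw ha.le
      calc ‖e w‖ ≤ C₂ * 1 := hdec.trans (by gcongr; exact hM.hFun_le_one hpos.le)
        _ = C₂ / ε ^ a * ε ^ a := by field_simp
        _ ≤ C₂ / ε ^ a * Real.exp (a * w.re) := by gcongr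
        _ ≤ _ := by
            gcongr
            exact (le_max_right _ _).trans (le_max_right _ _)
  · refine hdec.trans ?_
    gcongr
    exact (le_max_left _ _).trans (le_max_right _ _)

/-! ### The decay of a kernel against the growth of a function -/

section bounds
variable {N : ℕ → ℝ}

/-- Here `x` stands for `log |u/z|`, `y` for `log |z|`, `X` for `|e(u/z)|`, and the divisor for the
reciprocal growth of `f` at `u`. If `x ≥ 0`, one of the two factors from `hFun_le_sq` cancels the
divisor, provided that `|z| < ρ`. If `x ≤ 0`, the divisor is bounded below and `exp (a x)` gives the
decay. -/
theorem IsRegularSeq.growth_bound (hN : IsRegularSeq N) {a C k k' : ℝ} (ha : 0 < a) (hC : 0 < C)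
    (hk : 0 < k) (hk' : 0 < k') :
    ∃ ρ D A b : ℝ, 0 < ρ ∧ 0 < D ∧ 0 < A ∧ 0 < b ∧ ∀ x y X : ℝ, 0 ≤ X → Real.exp y < ρ →
      X ≤ C * Real.exp (a * x) → X ≤ C * hFun N (k * Real.exp (-x)) → ∀ p : ℕ,
        X / hFun N (k' * Real.exp (-(x + y))) * Real.exp (p * x) ≤
          D * A ^ p * N p * Real.exp (-b * |x|) := by
  obtain ⟨H, hH, hmg, hsq⟩ := hN.hFun_le_sq
  obtain ⟨c, hc, hcp⟩ := hN.lower 1 one_pos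
  have hH0 : 0 < H := by linarith
  have hhk' := hN.hFun_pos hk'
  have hN1 := hN.pos 1
  set b := min a 1
  have hb : 0 < b := lt_min ha one_pos
  set D₁ := C / hFun N k' / c
  set D₂ := C * H * (H * H * N 1 * (H * k))
  set A := max 1 (H * (H * k))
  have hD₁ : 0 < D₁ := by positivity
  have hD₂ : 0 < D₂ := by positivity
  have hA1 : 1 ≤ A := le_max_left _ _
  refine ⟨min 1 (k' / (H * k)), max D₁ D₂, A, b, by positivity, lt_max_of_lt_left hD₁,
    by linarith, hb, fun x y X hX hy h1 h2 p => ?_⟩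
  have hy1 : Real.exp y < 1 := hy.trans_le (min_le_left _ _)
  have hy0 : y < 0 := by simpa using hy1
  have hy2 : Real.exp y * (H * k) ≤ k' := by
    rw [← le_div_iff₀ (by positivity)]; exact hy.le.trans (min_le_right _ _)
  have hNp := hN.pos p
  have hden := hN.hFun_pos (t := k' * Real.exp (-(x + y))) (by positivity)
  rcases le_total x 0 with hx | hx
  · have e1 : hFun N k' ≤ hFun N (k' * Real.exp (-(x + y))) :=
      hFun_mono hN.pos hk'.le (le_mul_of_one_le_right hk'.le (Real.one_le_exp (by linarith)))
    have e2 : Real.exp (p * x) ≤ 1 :=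
      Real.exp_le_one_iff.2 (mul_nonpos_of_nonneg_of_nonpos p.cast_nonneg hx)
    have e3 : c ≤ N p := by simpa using hcp p
    have e4 : Real.exp (a * x) ≤ Real.exp (-b * |x|) := by
      rw [abs_of_nonpos hx]
      refine Real.exp_le_exp.2 ?_
      have : b ≤ a := min_le_left _ _
      nlinarith
    calc _ ≤ C * Real.exp (a * x) / hFun N k' * 1 := by gcongr
      _ = D₁ * 1 * c * Real.exp (a * x) := by simp only [D₁]; field_simp
      _ ≤ max D₁ D₂ * A ^ p * N p * Real.exp (-b * |x|) := by
          gcongr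
          · exact le_max_left _ _
          · exact one_le_pow₀ hA1
  · have e1 := hsq (k * Real.exp (-x)) (by positivity)
    have e2 : hFun N (H * (k * Real.exp (-x))) ≤ hFun N (k' * Real.exp (-(x + y))) := by
      refine hFun_mono hN.pos (by positivity) ?_
      have : Real.exp (-x) = Real.exp y * Real.exp (-(x + y)) := by
        rw [← Real.exp_add]; ring_nf
      rw [this]
      calc _ = Real.exp y * (H * k) * Real.exp (-(x + y)) := by ring
        _ ≤ _ := by gcongr
    -- Index `p + 1` instead of `p`: the extra power leaves the factor `exp (-x)` that makes the
    -- bound integrable.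
    have e3 := hFun_le hN.pos (t := H * (k * Real.exp (-x))) (by positivity) (p + 1)
    have e4 : Real.exp (-x) ≤ Real.exp (-b * |x|) := by
      rw [abs_of_nonneg hx]
      refine Real.exp_le_exp.2 ?_
      have : b ≤ 1 := min_le_right _ _
      nlinarith
    have hpos := hN.hFun_pos (t := H * (k * Real.exp (-x))) (by positivity)
    have e5 : X / hFun N (k' * Real.exp (-(x + y))) ≤ C * H * hFun N (H * (k * Real.exp (-x))) := by
      rw [div_le_iff₀ hden]
      calc X ≤ C * (H * (hFun N (H * (k * Real.exp (-x))) * hFun N (H * (k * Real.exp (-x))))) :=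
            h2.trans (by gcongr)
        _ ≤ C * (H * (hFun N (H * (k * Real.exp (-x))) * hFun N (k' * Real.exp (-(x + y))))) := by
            gcongr
        _ = _ := by ring
    have e6 : Real.exp (-x) ^ (p + 1) * Real.exp (p * x) = Real.exp (-x) := by
      rw [← Real.exp_nat_mul, ← Real.exp_add]; push_cast; ring_nf
    calc _ ≤ C * H * (N (p + 1) * (H * (k * Real.exp (-x))) ^ (p + 1)) * Real.exp (p * x) := by
          gcongr; exact e5.trans (by gcongr)
      _ ≤ C * H * (H * H ^ (p + 1) * (N p * N 1) * (H * (k * Real.exp (-x))) ^ (p + 1))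
            * Real.exp (p * x) := by gcongr; exact hmg p 1
      _ = D₂ * (H * (H * k)) ^ p * N p * (Real.exp (-x) ^ (p + 1) * Real.exp (p * x)) := by
          simp only [D₂, mul_pow, pow_succ]; ring
      _ ≤ max D₁ D₂ * A ^ p * N p * Real.exp (-b * |x|) := by
          rw [e6]; gcongr
          · exact le_max_right _ _
          · exact le_max_right _ _

/-- As in `growth_bound`, but the divisor belongs to `M = N L` and is at least `h_N h_L` by
`hFun_mul_le`. The kernel cancels `h_N` at `u/z`, and `h_L` at `z` survives as growth. Shrinking
`k''` replaces the smallness of `|z|`. -/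
theorem IsRegularSeq.growth_bound_mul {M L : ℕ → ℝ} (hN : IsRegularSeq N) (hL : IsRegularSeq L)
    (hM : ∀ p, M p = N p * L p) {a C k k' : ℝ} (ha : 0 < a) (hC : 0 < C)
    (hk : 0 < k) (hk' : 0 < k') :
    ∃ D b k'' : ℝ, 0 < D ∧ 0 < b ∧ 0 < k'' ∧ ∀ x y X : ℝ, 0 ≤ X →
      X ≤ C * Real.exp (a * x) → X ≤ C * hFun N (k * Real.exp (-x)) →
        X / hFun M (k' * Real.exp (-(x + y))) ≤
          D * Real.exp (-b * |x|) / hFun L (k'' * Real.exp (-y)) := by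
  obtain ⟨H, hH, hmg, hsq⟩ := hN.hFun_le_sq
  have hH0 : 0 < H := by linarith
  have hN1 := hN.pos 1
  have hMpos : ∀ p, 0 < M p := fun p => by rw [hM]; exact mul_pos (hN.pos p) (hL.pos p)
  have hh1 := hN.hFun_pos one_pos
  set b := min a 1
  have hb : 0 < b := lt_min ha one_pos
  set D₁ := C / hFun N 1
  set D₂ := C * H * (N 1 * (H * k))
  have hD₁ : 0 < D₁ := by positivity
  have hD₂ : 0 < D₂ := by positivity
  set k'' := min k' (k' / (H * k))
  have hk'' : 0 < k'' := by positivity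
  refine ⟨max D₁ D₂, b, k'', lt_max_of_lt_left hD₁, hb, hk'', fun x y X hX h1 h2 => ?_⟩
  have hden := hL.hFun_pos (t := k'' * Real.exp (-y)) (by positivity)
  rcases le_total x 0 with hx | hx
  · have e1 : hFun N 1 * hFun L (k'' * Real.exp (-y)) ≤ hFun M (k' * Real.exp (-(x + y))) := by
      refine (hFun_mul_le hN.pos hL.pos hM zero_le_one (by positivity)).trans ?_
      refine hFun_mono hMpos (by positivity) ?_
      rw [one_mul]
      have : Real.exp (-y) ≤ Real.exp (-(x + y)) := Real.exp_le_exp.2 (by linarith)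
      have : k'' ≤ k' := min_le_left _ _
      gcongr
    have e4 : Real.exp (a * x) ≤ Real.exp (-b * |x|) := by
      rw [abs_of_nonpos hx]
      refine Real.exp_le_exp.2 ?_
      have : b ≤ a := min_le_left _ _
      nlinarith
    calc _ ≤ C * Real.exp (a * x) / (hFun N 1 * hFun L (k'' * Real.exp (-y))) := by gcongr
      _ = D₁ * Real.exp (a * x) / hFun L (k'' * Real.exp (-y)) := by simp only [D₁]; field_simp
      _ ≤ _ := by
          gcongr
          exact le_max_left _ _
  · have e1 := hsq (k * Real.exp (-x)) (by positivity)
    have hpos := hN.hFun_pos (t := H * (k * Real.exp (-x))) (by positivity)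
    have e2 : hFun N (H * (k * Real.exp (-x))) * hFun L (k'' * Real.exp (-y)) ≤
        hFun M (k' * Real.exp (-(x + y))) := by
      refine (hFun_mul_le hN.pos hL.pos hM (by positivity) (by positivity)).trans ?_
      refine hFun_mono hMpos (by positivity) ?_
      have e : Real.exp (-(x + y)) = Real.exp (-x) * Real.exp (-y) := by
        rw [← Real.exp_add]; ring_nf
      have hk2 : k'' * (H * k) ≤ k' := by
        rw [← le_div_iff₀ (by positivity)]; exact min_le_right _ _
      rw [e]
      calc _ = k'' * (H * k) * (Real.exp (-x) * Real.exp (-y)) := by ring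
        _ ≤ _ := by gcongr
    have e3 := hFun_le hN.pos (t := H * (k * Real.exp (-x))) (by positivity) 1
    have e4 : Real.exp (-x) ≤ Real.exp (-b * |x|) := by
      rw [abs_of_nonneg hx]
      refine Real.exp_le_exp.2 ?_
      have : b ≤ 1 := min_le_right _ _
      nlinarith
    have hX2 : X ≤ C * (H * (hFun N (H * (k * Real.exp (-x))) * (N 1 * (H * (k * Real.exp (-x)))))) := by
      refine (h2.trans (by gcongr)).trans (?_ : C * (H * (hFun N (H * (k * Real.exp (-x))) *
        hFun N (H * (k * Real.exp (-x))))) ≤ _)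
      gcongr
      simpa using e3
    generalize hFun N (H * (k * Real.exp (-x))) = h₀ at hpos e2 hX2
    calc _ ≤ C * (H * (h₀ * (N 1 * (H * (k * Real.exp (-x)))))) /
            (h₀ * hFun L (k'' * Real.exp (-y))) := by gcongr
      _ = D₂ * Real.exp (-x) / hFun L (k'' * Real.exp (-y)) := by simp only [D₂]; field_simp
      _ ≤ _ := by
          gcongr
          exact le_max_right _ _

theorem KernelBound.exp_bound {ω : ℝ} {e : ℂ → ℂ} (hN : IsRegularSeq N) (h : KernelBound N ω e)
    {θ : ℝ} (hθ : θ < ω * Real.pi / 2) :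
    ∃ D A b : ℝ, 0 < D ∧ 0 < A ∧ 0 < b ∧ ∀ (p : ℕ) (w : ℂ), |w.im| ≤ θ →
      ‖e w‖ * Real.exp (p * w.re) ≤ D * A ^ p * N p * Real.exp (-b * |w.re|) := by
  obtain ⟨a, ha, hb⟩ := h.bound
  obtain ⟨C, k, hC, hk, hbd⟩ := hb θ hθ
  obtain ⟨ρ, D, A, b, hρ, hD, hA, hb0, key⟩ := hN.growth_bound ha hC hk one_pos
  refine ⟨D, A, b, hD, hA, hb0, fun p w hw => ?_⟩
  obtain ⟨h1, h2⟩ := hbd w hw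
  -- Any `y < log ρ` would do: only the divisor depends on `y`, and it is discarded because it is at
  -- most 1.
  refine le_trans ?_ (key w.re (Real.log ρ - 1) ‖e w‖ (norm_nonneg _) ?_ h1 h2 p)
  · gcongr
    have hpos : 0 < 1 * Real.exp (-(w.re + (Real.log ρ - 1))) := by positivity
    rw [le_div_iff₀ (hN.hFun_pos hpos)]
    exact mul_le_of_le_one_right (norm_nonneg _) (hN.hFun_le_one hpos.le)
  · rw [Real.exp_sub, Real.exp_log hρ]
    exact div_lt_self hρ (Real.one_lt_exp_iff.2 one_pos)

end bounds

/-! ### Moments -/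

theorem moment_nat_eq (e : ℂ → ℂ) (n : ℕ) :
    moment e n = ∫ s : ℝ, Complex.exp (n * pt s 0) * e (pt s 0) := by
  unfold moment
  have := integral_image_eq_integral_abs_deriv_smul (s := univ) MeasurableSet.univ
    (fun x _ => (Real.hasDerivAt_exp x).hasDerivWithinAt) Real.exp_injective.injOn
    (fun t : ℝ => (t : ℂ) ^ ((n : ℂ) - 1) * e (pt (Real.log t) 0))
  rw [image_univ, Real.range_exp, setIntegral_univ] at this
  rw [this]
  congr 1
  ext s
  have h0 : (Real.exp s : ℂ) ≠ 0 := by exact_mod_cast (Real.exp_pos s).ne'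
  rw [Real.log_exp, abs_of_pos (Real.exp_pos s), Complex.cpow_def_of_ne_zero h0,
    ← Complex.ofReal_log (Real.exp_pos s).le, Real.log_exp, Complex.real_smul, ← mul_assoc,
    Complex.ofReal_exp, ← Complex.exp_add]
  congr 2
  simp [pt]; ring

section moments
variable {N : ℕ → ℝ} {ω : ℝ} {e : ℂ → ℂ}

theorem KernelBound.norm_exp_mul_le (hN : IsRegularSeq N) (h : KernelBound N ω e) {θ : ℝ}
    (hθ : θ < ω * Real.pi / 2) (p : ℕ) :
    ∃ C b : ℝ, 0 < b ∧ ∀ w : ℂ, |w.im| ≤ θ →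
      ‖Complex.exp (p * w) * e w‖ ≤ C * Real.exp (-b * |w.re|) := by
  obtain ⟨D, A, b, -, -, hb, key⟩ := h.exp_bound hN hθ
  refine ⟨D * A ^ p * N p, b, hb, fun w hw => ?_⟩
  rw [norm_mul, Complex.norm_exp, mul_comm]
  simpa using key p w hw

theorem KernelBound.continuous_pt (h : KernelBound N ω e) {θ : ℝ} (hθ : |θ| < ω * Real.pi / 2) :
    Continuous fun s => e (pt s θ) := by
  rw [← continuousOn_univ]
  exact continuousOn_comp_pt fun s _ => (h.differentiableAt (by simpa using hθ)).continuousAt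

theorem KernelBound.integrable_exp_mul (hN : IsRegularSeq N) (h : KernelBound N ω e) {θ : ℝ}
    (hθ : |θ| < ω * Real.pi / 2) (p : ℕ) :
    Integrable fun s => Complex.exp (p * pt s θ) * e (pt s θ) := by
  obtain ⟨C, b, hb, key⟩ := h.norm_exp_mul_le hN hθ p
  refine Integrable.mono' ((integrable_exp_neg_mul_abs hb 0).const_mul C) ?_
    (Eventually.of_forall fun s => by simpa using key (pt s θ) (by simp))
  refine Continuous.aestronglyMeasurable (Continuous.mul ?_ (h.continuous_pt hθ))
  have := continuous_pt_left θ
  fun_prop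

/-- The integrand decays at both ends of every ray in the sector, so the positive axis can be
turned. -/
theorem KernelBound.moment_eq (hN : IsRegularSeq N) (h : KernelBound N ω e) {θ : ℝ}
    (hθ : |θ| < ω * Real.pi / 2) (p : ℕ) :
    ∫ s : ℝ, Complex.exp (p * pt s θ) * e (pt s θ) = moment e p := by
  rw [moment_nat_eq]
  obtain ⟨C, b, hb, key⟩ := h.norm_exp_mul_le hN hθ p
  have hle : ∀ v : ℂ, v.im ∈ uIcc θ 0 → |v.im| ≤ |θ| := by
    intro v hv
    have := abs_sub_left_of_mem_uIcc (uIcc_comm θ 0 ▸ hv)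
    simpa using this
  refine integral_pt_eq (g := fun v => Complex.exp (p * v) * e v) (C := C) (y := 0) hb (fun v hv => ?_)
    fun v hv => ?_
  · have := h.differentiableAt ((hle v hv).trans_lt hθ)
    fun_prop
  · simpa using key v (hle v hv)

end moments

/-! ### Functions of growth `N` -/

theorem closure_sector_subset (d β : ℝ) :
    closure (sector d β) ⊆ {w : ℂ | |w.im - d| ≤ β * Real.pi / 2} := by
  refine closure_minimal (fun w hw => (show |w.im - d| < β * Real.pi / 2 from hw).le) ?_
  exact isClosed_le (by fun_prop) continuous_const

theorem bddSector_subset_sector (d β r : ℝ) : bddSector d β r ⊆ sector d β := fun _ hw => hw.1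

theorem isBddProperSubsector_of_lt {d β α r : ℝ} (hβ : 0 < β) (hr : 0 < r) (hβα : β < α) :
    IsBddProperSubsector (bddSector d β r) (sector d α) := by
  refine ⟨⟨d, β, r, hβ, hr, rfl⟩, fun w hw => ?_⟩
  have := closure_sector_subset d β (closure_mono (bddSector_subset_sector d β r) hw)
  have hπ := Real.pi_pos
  simp only [mem_ofPred_eq] at this
  simp only [sector, argument, mem_ofPred_eq]
  nlinarith

theorem isUnbddProperSubsector_of_lt {d β α : ℝ} (hβ : 0 < β) (hβα : β < α) :
    IsUnbddProperSubsector (sector d β) (sector d α) := by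
  refine ⟨⟨d, β, hβ, rfl⟩, fun w hw => ?_⟩
  have := closure_sector_subset d β hw
  have hπ := Real.pi_pos
  simp only [mem_ofPred_eq] at this
  simp only [sector, argument, mem_ofPred_eq]
  nlinarith

theorem exists_opening_between {α θ : ℝ} (hα : 0 < α) (hθ : θ < α * Real.pi / 2) :
    ∃ β, 0 < β ∧ β < α ∧ θ < β * Real.pi / 2 := by
  have hπ := Real.pi_pos
  have hθ1 : 2 * θ / Real.pi < α := by rw [div_lt_iff₀ hπ]; linarith
  obtain ⟨τ, hτ1, hτ2⟩ := exists_between (max_lt hα hθ1)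
  refine ⟨τ, (le_max_left _ _).trans_lt hτ1, hτ2, ?_⟩
  have := (le_max_right _ _).trans_lt hτ1
  rw [div_lt_iff₀ hπ] at this; linarith

/-- There are three zones: near the origin `f` has a limit, on a compact rectangle it is continuous,
and beyond that the growth condition applies. Since `h_N ≤ 1`, the constants of the first two zones
also fit the form `c / h_N`. -/
theorem MemGrowth.bound {N : ℕ → ℝ} {d α : ℝ} {f : ℂ → ℂ} (hN : IsRegularSeq N) (hα : 0 < α)
    (hf : MemGrowth N (sector d α) f) {θ : ℝ} (hθ : θ < α * Real.pi / 2) :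
    ∃ c k : ℝ, 0 < c ∧ 0 < k ∧ ∀ w : ℂ, |w.im - d| ≤ θ →
      ‖f w‖ ≤ c / hFun N (k * Real.exp (-w.re)) := by
  obtain ⟨β, hβ, hβα, hθβ⟩ := exists_opening_between hα hθ
  obtain ⟨L, hL⟩ := hf.contOrigin _ (isBddProperSubsector_of_lt (d := d) hβ one_pos hβα)
  obtain ⟨r, c, k, hr, hc, hk, hg⟩ := hf.growth _ (isUnbddProperSubsector_of_lt (d := d) hβ hβα)
  have h1 : ∀ᶠ w in comap (fun w : ℂ => w.re) atBot ⊓ 𝓟 (bddSector d β 1), ‖f w‖ ≤ ‖L‖ + 1 :=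
    hL.norm.eventually_le_const (by linarith)
  rw [eventually_inf_principal, eventually_comap] at h1
  obtain ⟨x₀, hx₀⟩ := eventually_atBot.1 h1
  set x₁ := min x₀ (-1) with hx₁
  have hcomp : IsCompact (Icc x₁ (Real.log r) ×ℂ Icc (d - θ) (d + θ)) :=
    isCompact_Icc.reProdIm isCompact_Icc
  obtain ⟨B, hB⟩ := hcomp.exists_bound_of_continuousOn (f := f) (fun w hw => by
    have := hw.2
    refine (differentiableAt_of_sector hf.holo ?_).continuousAt.continuousWithinAt
    refine lt_of_le_of_lt ?_ hθ
    rw [abs_le]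
    constructor <;> linarith [this.1, this.2])
  set c' := max c (max (‖L‖ + 1) B)
  have hc' : 0 < c' := lt_max_of_lt_left hc
  refine ⟨c', k, hc', hk, fun w hw => ?_⟩
  have hpos : 0 < k * Real.exp (-w.re) := by positivity
  have hh := hN.hFun_pos hpos
  have hbd : ∀ x, x ≤ c' → x ≤ c' / hFun N (k * Real.exp (-w.re)) := by
    intro x hx
    refine hx.trans ?_
    rw [le_div_iff₀ hh]
    exact mul_le_of_le_one_right hc'.le (hN.hFun_le_one hpos.le)
  by_cases hw1 : w.re ≤ x₁
  · refine hbd _ ((hx₀ w.re (hw1.trans (min_le_left _ _)) w rfl ⟨?_, ?_⟩).trans ?_)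
    · exact hw.trans_lt hθβ
    · have : w.re ≤ -1 := hw1.trans (min_le_right _ _)
      simp only [modulus]
      exact Real.exp_lt_one_iff.2 (by linarith)
    · exact (le_max_left _ _).trans (le_max_right _ _)
  by_cases hw2 : w.re ≤ Real.log r
  · refine hbd _ ((hB w ⟨⟨(not_le.1 hw1).le, hw2⟩, ?_⟩).trans
      ((le_max_right _ _).trans (le_max_right _ _)))
    rw [abs_le] at hw
    constructor <;> linarith [hw.1, hw.2]
  · have hm : r ≤ modulus w := by
      rw [modulus, ← Real.log_le_iff_le_exp hr]; exact (not_le.1 hw2).le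
    have := hg w (hw.trans_lt hθβ) hm
    rw [show k / modulus w = k * Real.exp (-w.re) by
      rw [modulus, Real.exp_neg, div_eq_mul_inv]] at this
    refine this.trans ?_
    gcongr
    exact le_max_left _ _

/-! ### Sectorial regions -/

/-- A sequence in `(0, 1)` that increases to `1`. -/
noncomputable def lvl (n : ℕ) : ℝ := 1 - 1 / ((n : ℝ) + 2)

theorem lvl_pos (n : ℕ) : 0 < lvl n := by
  have : (0 : ℝ) ≤ n := n.cast_nonneg
  unfold lvl
  rw [sub_pos, div_lt_one (by linarith)]; linarith

theorem lvl_lt_one (n : ℕ) : lvl n < 1 := by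
  have : (0 : ℝ) ≤ n := n.cast_nonneg
  unfold lvl
  have : 0 < 1 / ((n : ℝ) + 2) := by positivity
  linarith

theorem tendsto_lvl : Tendsto lvl atTop (𝓝 1) := by
  have : Tendsto (fun n : ℕ => 1 / ((n : ℝ) + 2)) atTop (𝓝 0) :=
    (tendsto_atTop_add_const_right _ 2 tendsto_natCast_atTop_atTop).const_div_atTop 1
  have h := (tendsto_const_nhds (x := (1 : ℝ))).sub this
  rwa [sub_zero] at h

theorem eventually_le_lvl_mul {x X : ℝ} (hX : 0 < X) (hx : x < X) :
    ∀ᶠ n in atTop, x < lvl n * X := by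
  filter_upwards [tendsto_lvl.eventually_const_lt ((div_lt_one hX).2 hx)] with n hn
  rwa [div_lt_iff₀ hX] at hn

/-- The region swept out by bounded sectors of openings increasing to `γ`. -/
def levelRegion (d γ : ℝ) (R : ℕ → ℝ) : Set ℂ := ⋃ n, bddSector d (γ * lvl n) (R n)

theorem convex_bddSector (d γ : ℝ) {r : ℝ} (hr : 0 < r) : Convex ℝ (bddSector d γ r) := by
  have : bddSector d γ r = Iio (Real.log r) ×ℂ Ioo (d - γ * Real.pi / 2) (d + γ * Real.pi / 2) := by
    ext w
    simp only [bddSector, argument, modulus, Complex.mem_reProdIm, mem_ofPred_eq, mem_Iio, mem_Ioo,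
      abs_lt, Real.lt_log_iff_exp_lt hr]
    constructor
    · rintro ⟨⟨h1, h2⟩, h3⟩; exact ⟨h3, by linarith, by linarith⟩
    · rintro ⟨h3, h1, h2⟩; exact ⟨⟨by linarith, by linarith⟩, h3⟩
  rw [this]
  exact ((convex_Iio _).linear_preimage Complex.reLm).inter
    ((convex_Ioo _ _).linear_preimage Complex.imLm)

theorem mem_bddSector_pt {d γ r s : ℝ} (hγ : 0 < γ) (hs : Real.exp s < r) :
    pt s d ∈ bddSector d γ r := by
  have := Real.pi_pos
  refine ⟨?_, by simpa [modulus] using hs⟩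
  simp only [argument, pt_im, sub_self, abs_zero]; positivity

theorem isSectorialRegion_levelRegion {d γ : ℝ} (hγ : 0 < γ) {R : ℕ → ℝ} (hR : ∀ n, 0 < R n) :
    IsSectorialRegion d γ (levelRegion d γ R) := by
  have hπ := Real.pi_pos
  have hg : ∀ n, 0 < γ * lvl n := fun n => mul_pos hγ (lvl_pos n)
  have hne : ∀ r, 0 < r → ∀ n, ∃ s : ℝ, Real.exp s < r ∧ Real.exp s < R n := fun r hr n =>
    ⟨Real.log (min r (R n)) - 1, by
      rw [← lt_min_iff, Real.exp_sub, Real.exp_log (lt_min hr (hR n))]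
      exact div_lt_self (lt_min hr (hR n)) (Real.one_lt_exp_iff.2 one_pos)⟩
  refine ⟨isOpen_iUnion fun n => isOpen_bddSector _ _ _, ⟨?_, ?_⟩, ?_, ?_⟩
  · obtain ⟨s, hs, -⟩ := hne (R 0) (hR 0) 0
    exact ⟨pt s d, mem_iUnion.2 ⟨0, mem_bddSector_pt (hg 0) hs⟩⟩
  · refine IsPreconnected.iUnion_of_chain (fun n => (convex_bddSector d _ (hR n)).isPreconnected)
      fun n => ?_
    obtain ⟨s, hs, hs'⟩ := hne (R n) (hR n) (Order.succ n)
    exact ⟨pt s d, mem_bddSector_pt (hg n) hs, mem_bddSector_pt (hg _) hs'⟩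
  · refine iUnion_subset fun n w hw => ?_
    have h1 : |argument w - d| < γ * lvl n * Real.pi / 2 := hw.1
    have h2 := lvl_lt_one n
    simp only [sector, mem_ofPred_eq]
    have : γ * lvl n * Real.pi / 2 ≤ γ * Real.pi / 2 := by
      have : γ * lvl n ≤ γ := mul_le_of_le_one_right hγ.le h2.le
      gcongr
    linarith
  · intro β hβ hβγ
    obtain ⟨n, hn⟩ := (eventually_le_lvl_mul hγ hβγ).exists
    refine ⟨R n, hR n, fun w hw => mem_iUnion.2 ⟨n, ?_, hw.2⟩⟩
    have := hw.1
    have h3 : β * Real.pi / 2 ≤ γ * lvl n * Real.pi / 2 := by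
      rw [mul_comm γ]; gcongr
    exact this.trans_le h3

/-- The intersection itself may fail to be connected; the level region with the smaller radii lies
in both. -/
theorem IsSectorialRegion.exists_inter {d γ : ℝ} (hγ : 0 < γ) {G₁ G₂ : Set ℂ}
    (h₁ : IsSectorialRegion d γ G₁) (h₂ : IsSectorialRegion d γ G₂) :
    ∃ G, IsSectorialRegion d γ G ∧ G ⊆ G₁ ∧ G ⊆ G₂ := by
  have hlt : ∀ n, γ * lvl n < γ := fun n => mul_lt_of_lt_one_right hγ (lvl_lt_one n)
  have hg : ∀ n, 0 < γ * lvl n := fun n => mul_pos hγ (lvl_pos n)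
  choose r₁ hr₁ hs₁ using fun n => h₁.exists_subset _ (hg n) (hlt n)
  choose r₂ hr₂ hs₂ using fun n => h₂.exists_subset _ (hg n) (hlt n)
  refine ⟨levelRegion d γ (fun n => min (r₁ n) (r₂ n)),
    isSectorialRegion_levelRegion hγ fun n => lt_min (hr₁ n) (hr₂ n),
    iUnion_subset fun n w hw => hs₁ n ⟨hw.1, ?_⟩, iUnion_subset fun n w hw => hs₂ n ⟨hw.1, ?_⟩⟩
  · exact hw.2.trans_le (min_le_left _ _)
  · exact hw.2.trans_le (min_le_right _ _)

theorem IsSectorialRegion.exists_bddSector_subset {d α ω : ℝ} {G : Set ℂ}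
    (h : IsSectorialRegion d (α + ω) G) {τ β : ℝ} (hτ : |τ - d| < α * Real.pi / 2) (hβ : 0 < β)
    (hβω : β < ω) : ∃ ρ, 0 < ρ ∧ bddSector τ β ρ ⊆ G := by
  have hπ := Real.pi_pos
  have h1 : 2 * |τ - d| / Real.pi < α := by rw [div_lt_iff₀ hπ]; linarith
  obtain ⟨ρ, hρ, hs⟩ := h.exists_subset (β + 2 * |τ - d| / Real.pi) (by positivity) (by linarith)
  refine ⟨ρ, hρ, fun w hw => hs ⟨?_, hw.2⟩⟩
  have h2 : |argument w - τ| < β * Real.pi / 2 := hw.1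
  have h3 : (β + 2 * |τ - d| / Real.pi) * Real.pi / 2 = β * Real.pi / 2 + |τ - d| := by
    field_simp
  rw [h3]
  calc |argument w - d| = |(argument w - τ) + (τ - d)| := by ring_nf
    _ ≤ _ := abs_add_le _ _
    _ < _ := by linarith

theorem bddSector_mono_right {d γ r r' : ℝ} (h : r ≤ r') : bddSector d γ r ⊆ bddSector d γ r' :=
  fun _ hw => ⟨hw.1, hw.2.trans_le h⟩

theorem IsLaplaceTransform.restrict {ω d α : ℝ} {e f F : ℂ → ℂ} {G G' : Set ℂ}
    (h : IsLaplaceTransform ω e d α f G F) (hG' : IsSectorialRegion d (α + ω) G') (hs : G' ⊆ G) :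
    IsLaplaceTransform ω e d α f G' F := by
  refine ⟨hG', h.holo.mono hs, fun τ hτ β hβ hβω => ?_⟩
  obtain ⟨ρ, hρ, -, hw⟩ := h.eq_integral τ hτ β hβ hβω
  obtain ⟨ρ', hρ', hs'⟩ := hG'.exists_bddSector_subset hτ hβ hβω
  refine ⟨min ρ ρ', lt_min hρ hρ', (bddSector_mono_right (min_le_right _ _)).trans hs',
    fun w hw' => hw w (bddSector_mono_right (min_le_left _ _) hw')⟩

theorem IsLaplaceTransform.congr {ω d α : ℝ} {e f F F' : ℂ → ℂ} {G : Set ℂ}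
    (h : IsLaplaceTransform ω e d α f G F) (hF : EqOn F' F G) :
    IsLaplaceTransform ω e d α f G F' := by
  refine ⟨h.region, h.holo.congr hF, fun τ hτ β hβ hβω => ?_⟩
  obtain ⟨ρ, hρ, hs, hw⟩ := h.eq_integral τ hτ β hβ hβω
  exact ⟨ρ, hρ, hs, fun w hw' => ⟨(hw w hw').1, (hF (hs hw')).trans (hw w hw').2⟩⟩

/-- Proper subsectors are defined by closures, so the corners of the outer edge may be tested for
membership in a region. -/
theorem closure_bddSector_extreme {d β r θ : ℝ} (hβ : 0 < β) (hr : 0 < r)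
    (hθ : |θ - d| ≤ β * Real.pi / 2) : pt (Real.log r) θ ∈ closure (bddSector d β r) := by
  have hπ := Real.pi_pos
  have : Iio (Real.log r) ×ℂ Ioo (d - β * Real.pi / 2) (d + β * Real.pi / 2) ⊆ bddSector d β r := by
    intro w hw
    refine ⟨?_, ?_⟩
    · rw [abs_lt]; simp only [argument]; constructor <;> linarith [hw.2.1, hw.2.2]
    · simp only [modulus]; rw [← Real.lt_log_iff_exp_lt hr]; exact hw.1
  refine closure_mono this ?_
  have hpos : 0 < β * Real.pi / 2 := by positivity
  rw [Complex.closure_reProdIm, closure_Iio, closure_Ioo (by linarith)]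
  rw [abs_le] at hθ
  refine ⟨by simp, ?_⟩
  simp only [mem_preimage, pt_im, mem_Icc]
  constructor <;> linarith

/-- A bounded proper subsector of a level region lies in one of the levels. -/
theorem IsBddProperSubsector.subset_level {d γ : ℝ} {R : ℕ → ℝ} {T : Set ℂ}
    (hT : IsBddProperSubsector T (levelRegion d γ R)) :
    ∃ n, T ⊆ bddSector d (γ * lvl n) (R n) := by
  obtain ⟨⟨d', β, r, hβ, hr, rfl⟩, hcl⟩ := hT
  have hπ := Real.pi_pos
  have hpos : 0 < β * Real.pi / 2 := by positivity
  have main : ∀ θ, |θ - d'| ≤ β * Real.pi / 2 →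
      (∀ w ∈ bddSector d' β r, |w.im - d| ≤ |θ - d|) →
      ∃ n, bddSector d' β r ⊆ bddSector d (γ * lvl n) (R n) := by
    intro θ hθ hw
    -- One corner decides: its modulus is the largest and its argument the farthest from `d`, so the
    -- level that contains it contains the whole subsector, although the closure is not compact.
    obtain ⟨n, hn⟩ := mem_iUnion.1 (hcl (closure_bddSector_extreme hβ hr hθ))
    refine ⟨n, fun w hwT => ⟨(hw w hwT).trans_lt (by simpa [argument] using hn.1), hwT.2.trans ?_⟩⟩
    have := hn.2
    rwa [modulus, pt_re, Real.exp_log hr] at this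
  rcases le_total d d' with h | h
  · refine main (d' + β * Real.pi / 2) (by simp [abs_of_pos hpos]) fun w hw => ?_
    have := abs_lt.1 hw.1
    simp only [argument] at this
    rw [abs_of_nonneg (by linarith : 0 ≤ d' + β * Real.pi / 2 - d), abs_le]
    constructor <;> linarith [this.1, this.2]
  · refine main (d' - β * Real.pi / 2) (by
      rw [sub_sub_cancel_left, abs_neg, abs_of_pos hpos]) fun w hw => ?_
    have := abs_lt.1 hw.1
    simp only [argument] at this
    rw [abs_of_nonpos (by linarith : d' - β * Real.pi / 2 - d ≤ 0), abs_le]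
    constructor <;> linarith [this.1, this.2]

/-! ### Construction of Laplace transforms -/

/-- The direction of integration `τ` is admissible for the point `w` at level `n`. -/
def Admissible (ω d α : ℝ) (n : ℕ) (τ : ℝ) (w : ℂ) : Prop :=
  |τ - d| ≤ lvl n * (α * Real.pi / 2) ∧ |w.im - τ| ≤ lvl n * (ω * Real.pi / 2)

/-- The canonical direction of integration for a point of argument `θ`. -/
noncomputable def canonDir (ω d α θ : ℝ) : ℝ := d + α / (α + ω) * (θ - d)

/-- The Laplace integral in the canonical direction. -/
noncomputable def laplaceVal (ω : ℝ) (e : ℂ → ℂ) (d α : ℝ) (f : ℂ → ℂ) (w : ℂ) : ℂ :=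
  ∫ s : ℝ, laplaceIntegrand e f (canonDir ω d α w.im) w s

/-- Uniform bounds on the integrand that make the Laplace transform converge on a level region. -/
def LaplaceBound (ω : ℝ) (e : ℂ → ℂ) (d α : ℝ) (f : ℂ → ℂ) (R : ℕ → ℝ) : Prop :=
  ∀ n, ∃ C a : ℝ, 0 < a ∧ ∀ τ w s, Admissible ω d α n τ w → Real.exp w.re < R n →
    ‖laplaceIntegrand e f τ w s‖ ≤ C * Real.exp (-a * |s - w.re|)

section
variable {ω d α : ℝ} {e f : ℂ → ℂ} {R : ℕ → ℝ}

/-- The offset `θ - d` is shared between the direction of integration and the argument of the kernel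
in the ratio `α : ω`, so both keep the same relative distance from their limits. -/
theorem canonDir_sub_lt (hα : 0 < α) (hω : 0 < ω) {x θ : ℝ}
    (h : |θ - d| < (α + ω) * x * Real.pi / 2) :
    |canonDir ω d α θ - d| < x * (α * Real.pi / 2) ∧ |θ - canonDir ω d α θ| < x * (ω * Real.pi / 2) := by
  have hs : 0 < α + ω := by linarith
  have h1 : canonDir ω d α θ - d = α / (α + ω) * (θ - d) := by unfold canonDir; ring
  have h2 : θ - canonDir ω d α θ = ω / (α + ω) * (θ - d) := by
    unfold canonDir; field_simp; ring
  rw [h1, h2, abs_mul, abs_mul, abs_of_pos (div_pos hα hs), abs_of_pos (div_pos hω hs)]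
  constructor
  · calc _ < α / (α + ω) * ((α + ω) * x * Real.pi / 2) := by gcongr
      _ = _ := by field_simp
  · calc _ < ω / (α + ω) * ((α + ω) * x * Real.pi / 2) := by gcongr
      _ = _ := by field_simp

theorem admissible_canonDir (hα : 0 < α) (hω : 0 < ω) {n : ℕ} {r : ℝ} {w : ℂ}
    (h : w ∈ bddSector d ((α + ω) * lvl n) r) : Admissible ω d α n (canonDir ω d α w.im) w :=
  have := canonDir_sub_lt hα hω h.1
  ⟨this.1.le, this.2.le⟩

theorem Admissible.dir_lt (hα : 0 < α) {n : ℕ} {τ : ℝ} {w : ℂ} (h : Admissible ω d α n τ w) :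
    |τ - d| < α * Real.pi / 2 := by
  have := Real.pi_pos
  exact h.1.trans_lt (mul_lt_of_lt_one_left (by positivity) (lvl_lt_one n))

theorem Admissible.arg_lt (hω : 0 < ω) {n : ℕ} {τ : ℝ} {w : ℂ} (h : Admissible ω d α n τ w) :
    |w.im - τ| < ω * Real.pi / 2 := by
  have := Real.pi_pos
  exact h.2.trans_lt (mul_lt_of_lt_one_left (by positivity) (lvl_lt_one n))

theorem abs_sub_le_of_mem_uIcc {x y z c B : ℝ} (hz : z ∈ uIcc x y) (hx : |x - c| ≤ B)
    (hy : |y - c| ≤ B) : |z - c| ≤ B := by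
  rw [abs_le] at *
  rcases le_total x y with h | h
  · rw [uIcc_of_le h] at hz
    constructor <;> linarith [hz.1, hz.2]
  · rw [uIcc_of_ge h] at hz
    constructor <;> linarith [hz.1, hz.2]

theorem Admissible.of_mem_uIcc {n : ℕ} {τ τ' σ : ℝ} {w : ℂ} (h : Admissible ω d α n τ w)
    (h' : Admissible ω d α n τ' w) (hσ : σ ∈ uIcc τ τ') : Admissible ω d α n σ w :=
  ⟨abs_sub_le_of_mem_uIcc hσ h.1 h'.1, by
    rw [abs_sub_comm]
    exact abs_sub_le_of_mem_uIcc hσ (by rw [abs_sub_comm]; exact h.2)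
      (by rw [abs_sub_comm]; exact h'.2)⟩

theorem differentiableAt_integrand (he : DifferentiableOn ℂ e (sector 0 ω))
    (hf : DifferentiableOn ℂ f (sector d α)) {w v : ℂ} (hv : |v.im - d| < α * Real.pi / 2)
    (hw : |w.im - v.im| < ω * Real.pi / 2) : DifferentiableAt ℂ (fun v => e (v - w) * f v) v := by
  have h1 : DifferentiableAt ℂ e (v - w) :=
    differentiableAt_of_sector he (by rw [abs_sub_comm] at hw; simpa using hw)
  have h2 : DifferentiableAt ℂ (fun v => e (v - w)) v :=
    h1.comp v (by fun_prop : DifferentiableAt ℂ (fun v : ℂ => v - w) v)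
  exact h2.mul (differentiableAt_of_sector hf hv)

theorem continuous_laplaceIntegrand (he : DifferentiableOn ℂ e (sector 0 ω))
    (hf : DifferentiableOn ℂ f (sector d α)) {τ : ℝ} {w : ℂ} (hτ : |τ - d| < α * Real.pi / 2)
    (hw : |w.im - τ| < ω * Real.pi / 2) : Continuous (laplaceIntegrand e f τ w) := by
  rw [← continuousOn_univ]
  exact continuousOn_comp_pt (g := fun v => e (v - w) * f v) fun s _ =>
    (differentiableAt_integrand he hf (by simpa using hτ) (by simpa using hw)).continuousAt

theorem LaplaceBound.integrable (hα : 0 < α) (hω : 0 < ω)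
    (he : DifferentiableOn ℂ e (sector 0 ω)) (hf : DifferentiableOn ℂ f (sector d α))
    (hb : LaplaceBound ω e d α f R) {n : ℕ} {τ : ℝ} {w : ℂ} (hτ : Admissible ω d α n τ w)
    (hw : Real.exp w.re < R n) : Integrable (laplaceIntegrand e f τ w) := by
  obtain ⟨C, a, ha, key⟩ := hb n
  exact Integrable.mono' ((integrable_exp_neg_mul_abs ha w.re).const_mul C)
    (continuous_laplaceIntegrand he hf (hτ.dir_lt hα) (hτ.arg_lt hω)).aestronglyMeasurable
    (Eventually.of_forall fun s => key τ w s hτ hw)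

theorem LaplaceBound.integral_eq (hα : 0 < α) (hω : 0 < ω)
    (he : DifferentiableOn ℂ e (sector 0 ω)) (hf : DifferentiableOn ℂ f (sector d α))
    (hb : LaplaceBound ω e d α f R) {n : ℕ} {τ τ' : ℝ} {w : ℂ} (hτ : Admissible ω d α n τ w)
    (hτ' : Admissible ω d α n τ' w) (hw : Real.exp w.re < R n) :
    ∫ s, laplaceIntegrand e f τ w s = ∫ s, laplaceIntegrand e f τ' w s := by
  obtain ⟨C, a, ha, key⟩ := hb n
  refine integral_pt_eq (g := fun v => e (v - w) * f v) (C := C) (y := w.re) ha (fun v hv => ?_)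
    fun v hv => ?_
  · have := hτ.of_mem_uIcc hτ' hv
    exact differentiableAt_integrand he hf (this.dir_lt hα) (this.arg_lt hω)
  · have := key v.im w v.re (hτ.of_mem_uIcc hτ' hv) hw
    rwa [laplaceIntegrand, pt_re_im] at this

theorem LaplaceBound.laplaceVal_eq (hα : 0 < α) (hω : 0 < ω)
    (he : DifferentiableOn ℂ e (sector 0 ω)) (hf : DifferentiableOn ℂ f (sector d α))
    (hb : LaplaceBound ω e d α f R) {n : ℕ} {τ : ℝ} {w : ℂ}
    (hw : w ∈ bddSector d ((α + ω) * lvl n) (R n)) (hτ : Admissible ω d α n τ w) :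
    laplaceVal ω e d α f w = ∫ s, laplaceIntegrand e f τ w s :=
  hb.integral_eq hα hω he hf (admissible_canonDir hα hω hw) hτ hw.2

/-- The canonical direction depends on `im w`, which is not holomorphic. Freezing it at its value
for `w₀` does not change the integral nearby, by `integral_eq`, and the frozen integral is a
holomorphic parameter integral. -/
theorem LaplaceBound.differentiableAt (hα : 0 < α) (hω : 0 < ω)
    (he : DifferentiableOn ℂ e (sector 0 ω)) (hf : DifferentiableOn ℂ f (sector d α))
    (hb : LaplaceBound ω e d α f R) {n : ℕ} {w₀ : ℂ}
    (hw₀ : w₀ ∈ bddSector d ((α + ω) * lvl n) (R n)) :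
    DifferentiableAt ℂ (laplaceVal ω e d α f) w₀ := by
  set τ := canonDir ω d α w₀.im with hτ
  obtain ⟨h1, h2⟩ := canonDir_sub_lt hα hω hw₀.1
  have hopen : IsOpen (bddSector d ((α + ω) * lvl n) (R n) ∩
      {w : ℂ | |w.im - τ| < lvl n * (ω * Real.pi / 2)}) :=
    (isOpen_bddSector _ _ _).inter (isOpen_lt (by fun_prop) continuous_const)
  obtain ⟨r, hr, hball⟩ := Metric.isOpen_iff.1 hopen w₀ ⟨hw₀, h2⟩
  have hadm : ∀ w ∈ Metric.ball w₀ r, Admissible ω d α n τ w := fun w hw =>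
    ⟨h1.le, (le_of_lt (hball hw).2)⟩
  obtain ⟨C, a, ha, key⟩ := hb n
  have hC : 0 ≤ C := by
    have := key τ w₀ w₀.re (hadm w₀ (Metric.mem_ball_self hr)) hw₀.2
    simp only [sub_self, abs_zero, mul_zero, Real.exp_zero, mul_one] at this
    exact (norm_nonneg _).trans this
  have hd := differentiableAt_integral_param (μ := volume) (F := laplaceIntegrand e f τ) (w₀ := w₀)
    (bound := fun s => C * (Real.exp (a * r) * Real.exp (-a * |s - w₀.re|))) hr ?_ ?_ ?_ ?_
  · refine hd.congr_of_eventuallyEq ?_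
    filter_upwards [Metric.ball_mem_nhds w₀ hr] with w hw
    exact hb.laplaceVal_eq hα hω he hf (hball hw).1 (hadm w hw)
  · exact fun w hw => (continuous_laplaceIntegrand he hf ((hadm w hw).dir_lt hα)
      ((hadm w hw).arg_lt hω)).aestronglyMeasurable
  · refine Eventually.of_forall fun s w hw => (key τ w s (hadm w hw) (hball hw).1.2).trans ?_
    rw [← Real.exp_add]
    gcongr
    have h3 : |w.re - w₀.re| ≤ r := by
      have := Complex.abs_re_le_norm (w - w₀)
      rw [Complex.sub_re] at this
      exact this.trans (mem_ball_iff_norm.1 hw).le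
    have h4 : |s - w₀.re| ≤ |s - w.re| + |w.re - w₀.re| := abs_sub_le _ _ _
    nlinarith
  · exact ((integrable_exp_neg_mul_abs ha w₀.re).const_mul _).const_mul _
  · refine Eventually.of_forall fun s w hw => ?_
    have h3 : DifferentiableAt ℂ e (pt s τ - w) := by
      refine differentiableAt_of_sector he ?_
      have := (hadm w hw).arg_lt hω
      rw [abs_sub_comm] at this; simpa using this
    have h4 : DifferentiableAt ℂ (fun w => e (pt s τ - w)) w :=
      h3.comp w (by fun_prop : DifferentiableAt ℂ (fun w : ℂ => pt s τ - w) w)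
    exact h4.mul_const _

theorem LaplaceBound.isLaplaceTransform (hα : 0 < α) (hω : 0 < ω) (hR : ∀ n, 0 < R n)
    (he : DifferentiableOn ℂ e (sector 0 ω)) (hf : DifferentiableOn ℂ f (sector d α))
    (hb : LaplaceBound ω e d α f R) :
    IsLaplaceTransform ω e d α f (levelRegion d (α + ω) R) (laplaceVal ω e d α f) := by
  have hπ := Real.pi_pos
  refine ⟨isSectorialRegion_levelRegion (by linarith) hR, fun w hw => ?_, fun τ hτ β hβ hβω => ?_⟩
  · obtain ⟨n, hn⟩ := mem_iUnion.1 hw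
    exact (hb.differentiableAt hα hω he hf hn).differentiableWithinAt
  · obtain ⟨n, hn1, hn2⟩ := ((eventually_le_lvl_mul (by positivity) hτ).and
      (eventually_le_lvl_mul hω hβω)).exists
    have hadm : ∀ w ∈ bddSector τ β (R n), Admissible ω d α n τ w := by
      intro w hw
      refine ⟨hn1.le, le_of_lt (hw.1.trans ?_)⟩
      calc β * Real.pi / 2 < lvl n * ω * Real.pi / 2 := by gcongr
        _ = _ := by ring
    have hmem : ∀ w ∈ bddSector τ β (R n), w ∈ bddSector d ((α + ω) * lvl n) (R n) := by
      intro w hw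
      refine ⟨?_, hw.2⟩
      have h1 := (hadm w hw).2
      calc |argument w - d| = |(w.im - τ) + (τ - d)| := by simp [argument]
        _ ≤ |w.im - τ| + |τ - d| := abs_add_le _ _
        _ < lvl n * (ω * Real.pi / 2) + lvl n * (α * Real.pi / 2) := add_lt_add_of_le_of_lt h1 hn1
        _ = _ := by ring
    exact ⟨R n, hR n, fun w hw => mem_iUnion.2 ⟨n, hmem w hw⟩, fun w hw =>
      ⟨hb.integrable hα hω he hf (hadm w hw) hw.2,
        hb.laplaceVal_eq hα hω he hf (hmem w hw) (hadm w hw)⟩⟩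

end

/-- Functions of growth `N` have a Laplace transform for a kernel of the same growth. -/
theorem KernelBound.exists_laplaceBound {N : ℕ → ℝ} {ω d α : ℝ} {e f : ℂ → ℂ}
    (hN : IsRegularSeq N) (hα : 0 < α) (hω : 0 < ω) (he : KernelBound N ω e)
    (hf : MemGrowth N (sector d α) f) :
    ∃ R : ℕ → ℝ, (∀ n, 0 < R n) ∧ LaplaceBound ω e d α f R := by
  have hπ := Real.pi_pos
  obtain ⟨a, ha, hbd⟩ := he.bound
  have hlt : ∀ n x, 0 < x → lvl n * (x * Real.pi / 2) < x * Real.pi / 2 := fun n x hx =>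
    mul_lt_of_lt_one_left (by positivity) (lvl_lt_one n)
  have key : ∀ n, ∃ R, 0 < R ∧ ∃ C a : ℝ, 0 < a ∧ ∀ τ w s, Admissible ω d α n τ w →
      Real.exp w.re < R → ‖laplaceIntegrand e f τ w s‖ ≤ C * Real.exp (-a * |s - w.re|) := by
    intro n
    obtain ⟨C, k, hC, hk, hkb⟩ := hbd _ (hlt n ω hω)
    obtain ⟨c, k', hc, hk', hfb⟩ := hf.bound hN hα (hlt n α hα)
    obtain ⟨ρ, D, A, b, hρ, hD, hA, hb, hg⟩ := hN.growth_bound ha hC hk hk'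
    refine ⟨ρ, hρ, D * c, b, hb, fun τ w s hadm hw => ?_⟩
    obtain ⟨h1, h2⟩ := hkb (pt s τ - w) (by
      rw [Complex.sub_im, pt_im, abs_sub_comm]; exact hadm.2)
    have h3 := hfb (pt s τ) (by rw [pt_im]; exact hadm.1)
    rw [Complex.sub_re, pt_re] at h1 h2
    rw [pt_re] at h3
    have h4 := hg (s - w.re) w.re _ (norm_nonneg _) hw h1 h2 0
    simp only [pow_zero, mul_one, hN.zero, Nat.cast_zero, zero_mul, Real.exp_zero,
      sub_add_cancel] at h4
    rw [laplaceIntegrand, norm_mul]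
    calc _ ≤ ‖e (pt s τ - w)‖ * (c / hFun N (k' * Real.exp (-s))) := by gcongr
      _ = ‖e (pt s τ - w)‖ / hFun N (k' * Real.exp (-s)) * c := by ring
      _ ≤ D * Real.exp (-b * |s - w.re|) * c := by gcongr
      _ = _ := by ring
  choose R hR hb using key
  exact ⟨R, hR, hb⟩

/-! ### Borel kernels -/

/-- Entire functions that are `O(|z|^(-b))` in the sectors complementary to `S_ω`. -/
structure BorelBound (ω : ℝ) (E : ℂ → ℂ) : Prop where
  diff : Differentiable ℂ E
  bound : ∃ b, 0 < b ∧ ∀ θ, ω * Real.pi / 2 < θ → ∃ C, 0 < C ∧ ∀ b', 0 ≤ b' → b' ≤ b → ∀ v : ℂ,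
    θ ≤ |v.im| → |v.im| ≤ 2 * Real.pi - θ → ‖E (Complex.exp v)‖ ≤ C * Real.exp (-b' * v.re)

theorem differentiable_borelKernel {e : ℂ → ℂ}
    (h : ∀ z : ℂ, Summable fun n : ℕ => z ^ n / moment e n) :
    Differentiable ℂ (borelKernel e) := by
  intro z
  have hs := (h (‖z‖ + 1 : ℝ)).norm
  refine (Complex.differentiableOn_tsum_of_summable_norm (U := Metric.ball 0 (‖z‖ + 1)) hs
    (fun n => ?_) Metric.isOpen_ball fun n w hw => ?_).differentiableAt
    (Metric.isOpen_ball.mem_nhds (by simp))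
  · exact ((differentiable_id.pow n).div_const _).differentiableOn
  · have h1 : ‖w‖ ≤ ‖z‖ + 1 := by simpa using (mem_ball_zero_iff.1 hw).le
    rw [norm_div, norm_div, norm_pow, norm_pow, Complex.norm_real, Real.norm_eq_abs,
      abs_of_pos (by positivity)]
    gcongr

theorem Differentiable.exists_bound_closedBall {E : ℂ → ℂ} (h : Differentiable ℂ E) (R : ℝ) :
    ∃ B, 0 < B ∧ ∀ z, ‖z‖ ≤ R → ‖E z‖ ≤ B := by
  obtain ⟨B, hB⟩ := (isCompact_closedBall (0 : ℂ) R).exists_bound_of_continuousOn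
    h.continuous.continuousOn
  exact ⟨max B 1, lt_max_of_lt_right one_pos, fun z hz =>
    (hB z (by simpa using hz)).trans (le_max_left _ _)⟩

/-- On a disc `E` is bounded by compactness, so its decay at infinity extends to all moduli.
Negative arguments are reduced to positive ones by the period `2πi` of `exp`. The exponent stays
free because `b' = 0` serves for plain boundedness on rays, and `b' = b` for the estimates of the
acceleration kernel. -/
theorem IsStrongKernel.borelBound {M : ℕ → ℝ} {e : ℂ → ℂ} (hω2 : growthIndex M < 2)
    (h : IsStrongKernel M e) : BorelBound (growthIndex M) (borelKernel e) := by
  have hπ := Real.pi_pos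
  have hdiff := differentiable_borelKernel h.entire
  refine ⟨hdiff, ?_⟩
  obtain ⟨b, hb, hsm⟩ := h.smallBorel
  refine ⟨b, hb, fun θ hθ => ?_⟩
  obtain ⟨τ, hτ, hτ2, hτθ⟩ := exists_opening_between (α := 2 - growthIndex M) (θ := Real.pi - θ)
    (by linarith) (by linarith)
  obtain ⟨K, R, hK, hR, hKR⟩ := hsm τ hτ hτ2
  obtain ⟨B, hB, hBb⟩ := Differentiable.exists_bound_closedBall hdiff (max R 1)
  set L := Real.log (max R 1) with hL
  have hL0 : 0 ≤ L := Real.log_nonneg (le_max_right _ _)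
  have key : ∀ b', 0 ≤ b' → b' ≤ b → ∀ v : ℂ, |v.im - Real.pi| ≤ Real.pi - θ →
      ‖borelKernel e (Complex.exp v)‖ ≤ max K (B * Real.exp (b * L)) * Real.exp (-b' * v.re) := by
    intro b' hb' hb'b v hv
    rcases le_total v.re L with hvL | hvL
    · have h1 : ‖borelKernel e (Complex.exp v)‖ ≤ B := hBb _ (by
        rw [Complex.norm_exp]
        rwa [hL, Real.le_log_iff_exp_le (lt_max_of_lt_right one_pos)] at hvL)
      calc _ ≤ B := h1
        _ ≤ B * (Real.exp (b * L) * Real.exp (-b' * v.re)) := by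
            refine le_mul_of_one_le_right hB.le ?_
            rw [← Real.exp_add]
            refine Real.one_le_exp ?_
            nlinarith [mul_le_mul_of_nonneg_left hvL hb', mul_le_mul_of_nonneg_right hb'b hL0]
        _ = B * Real.exp (b * L) * Real.exp (-b' * v.re) := by ring
        _ ≤ _ := by gcongr; exact le_max_right _ _
    · have h1 := hKR v (hv.trans_lt hτθ) (by
        rw [modulus, ← Real.log_le_iff_le_exp hR]
        exact (Real.log_le_log hR (le_max_left _ _)).trans hvL)
      rw [proj, modulus, ← Real.exp_mul, div_eq_mul_inv, ← Real.exp_neg] at h1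
      refine h1.trans ?_
      gcongr
      · exact le_max_left _ _
      · nlinarith [mul_le_mul_of_nonneg_right hb'b (hL0.trans hvL)]
  refine ⟨max K (B * Real.exp (b * L)), lt_max_of_lt_left hK, fun b' hb' hb'b v h1 h2 => ?_⟩
  rcases le_total 0 v.im with h0 | h0
  · rw [abs_of_nonneg h0] at h1 h2
    exact key b' hb' hb'b v (by rw [abs_le]; constructor <;> linarith)
  · rw [abs_of_nonpos h0] at h1 h2
    have := key b' hb' hb'b (v + 2 * Real.pi * Complex.I) (by
      simp only [Complex.add_im, Complex.mul_im, Complex.mul_re, Complex.re_ofNat, Complex.ofReal_re,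
        Complex.im_ofNat, Complex.ofReal_im, Complex.I_re, Complex.I_im]
      rw [abs_le]; constructor <;> linarith)
    rw [Complex.exp_periodic] at this
    simpa using this

/-! ### The acceleration kernel -/

/-- The half-opening of the path that defines the acceleration kernel. -/
noncomputable def accelEta (ω₁ ω₂ ψ : ℝ) : ℝ := ω₁ * (Real.pi + accelEps ω₁ ω₂ ψ) / 2

/-- The integrand of the acceleration kernel. -/
noncomputable def accelIntegrand (E e₂ : ℂ → ℂ) (w v : ℂ) : ℂ := E (Complex.exp (-w - v)) * e₂ (-v)

theorem accelKernel_eq (ω₁ ω₂ : ℝ) (e₁ e₂ : ℂ → ℂ) (w : ℂ) :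
    accelKernel ω₁ ω₂ e₁ e₂ w = (-1 / (2 * Real.pi * Complex.I)) *
      hankel (accelIntegrand (borelKernel e₁) e₂ w) 0 (-w.im + accelEta ω₁ ω₂ w.im)
        (-w.im - accelEta ω₁ ω₂ w.im) := by
  simp only [accelKernel, borelIntegral, hankel, horiz, vert, accelIntegrand, accelEta, argument,
    proj, Real.log_one, Complex.neg_im]

/-- `η` and `η'` are bounds for the half-opening of a path at the argument `ψ`. -/
theorem exists_accelEta_bounds {ω₁ ω₂ ϑ : ℝ} (hω₁ : 0 < ω₁) (hlt : ω₁ < ω₂) (hω₂ : ω₂ < 2)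
    (hϑ : ϑ < (ω₂ - ω₁) * Real.pi / 2) (hϑ0 : 0 ≤ ϑ) :
    ∃ η θ₂, ω₁ * Real.pi / 2 < η ∧ θ₂ < ω₂ * Real.pi / 2 ∧ ∀ ψ, |ψ| ≤ ϑ →
      η ≤ accelEta ω₁ ω₂ ψ ∧ accelEta ω₁ ω₂ ψ ≤ 2 * Real.pi - η ∧
        |ψ| + accelEta ω₁ ω₂ ψ ≤ θ₂ := by
  have hπ := Real.pi_pos
  have hub : ∀ ψ, ω₁ * accelEps ω₁ ω₂ ψ / 2 ≤ ((ω₂ - ω₁) * Real.pi - 2 * |ψ|) / 4 := by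
    intro ψ
    have h1 : accelEps ω₁ ω₂ ψ ≤ (((ω₂ - ω₁) * Real.pi - 2 * |ψ|) / ω₁) / 2 := by
      unfold accelEps
      have := min_le_right Real.pi (((ω₂ - ω₁) * Real.pi - 2 * |ψ|) / ω₁)
      linarith
    calc ω₁ * accelEps ω₁ ω₂ ψ / 2 ≤ ω₁ * ((((ω₂ - ω₁) * Real.pi - 2 * |ψ|) / ω₁) / 2) / 2 := by
          gcongr
      _ = _ := by field_simp; ring
  have hpos : 0 < accelEps ω₁ ω₂ ϑ := by
    unfold accelEps
    rw [abs_of_nonneg hϑ0]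
    have : 0 < ((ω₂ - ω₁) * Real.pi - 2 * ϑ) / ω₁ := div_pos (by linarith) hω₁
    positivity
  -- `accelEta` does not increase with `|ψ|`, so its value at `ϑ` is the lower bound. The second
  -- witness comes from `hub`, which bounds `|ψ| + accelEta` by an expression increasing in `|ψ|`.
  refine ⟨accelEta ω₁ ω₂ ϑ, ω₁ * Real.pi / 2 + (ω₂ - ω₁) * Real.pi / 4 + ϑ / 2, ?_, ?_,
    fun ψ hψ => ⟨?_, ?_, ?_⟩⟩
  · unfold accelEta
    have := mul_pos hω₁ hpos
    linarith
  · linarith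
  · unfold accelEta accelEps
    have h := hψ.trans (le_abs_self ϑ)
    generalize |ψ| = x at h ⊢
    generalize |ϑ| = y at h ⊢
    gcongr
  · have h1 := hub ψ
    have h2 := hub ϑ
    rw [abs_of_nonneg hϑ0] at h2
    have h3 := abs_nonneg ψ
    unfold accelEta
    nlinarith
  · have h1 := hub ψ
    unfold accelEta
    linarith

section
variable {M₂ : ℕ → ℝ} {ω₁ ω₂ : ℝ} {E e₁ e₂ : ℂ → ℂ}

theorem differentiableAt_accelIntegrand (hE : Differentiable ℂ E) (h₂ : KernelBound M₂ ω₂ e₂)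
    {w v : ℂ} (hv : |v.im| < ω₂ * Real.pi / 2) : DifferentiableAt ℂ (accelIntegrand E e₂ w) v := by
  have h1 : DifferentiableAt ℂ (fun v => e₂ (-v)) v :=
    (h₂.differentiableAt (w := -v) (by simpa using hv)).comp v differentiableAt_id.neg
  have h3 : DifferentiableAt ℂ (fun v => E (Complex.exp (-w - v))) v :=
    (hE _).comp v (f := fun v => Complex.exp (-w - v)) (by fun_prop)
  exact h3.mul h1

/-- Here `E` only needs to be bounded; the decay at both ends comes from `e₂`. -/
theorem norm_accelIntegrand_le (hM₂ : IsRegularSeq M₂) (hE : BorelBound ω₁ E)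
    (h₂ : KernelBound M₂ ω₂ e₂) {η θ₂ : ℝ} (hη : ω₁ * Real.pi / 2 < η)
    (hθ₂ : θ₂ < ω₂ * Real.pi / 2) :
    ∃ C a, 0 < C ∧ 0 < a ∧ ∀ w v : ℂ, η ≤ |w.im + v.im| → |w.im + v.im| ≤ 2 * Real.pi - η →
      |v.im| ≤ θ₂ → ‖accelIntegrand E e₂ w v‖ ≤ C * Real.exp (-a * |v.re|) := by
  obtain ⟨b, hb, hEb⟩ := hE.bound
  obtain ⟨C, hC, hCb⟩ := hEb η hη
  obtain ⟨D, A, a, hD, hA, ha, hDb⟩ := h₂.exp_bound hM₂ hθ₂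
  refine ⟨C * D, a, by positivity, ha, fun w v h1 h2 h3 => ?_⟩
  have him : |(-w - v).im| = |w.im + v.im| := by
    rw [Complex.sub_im, Complex.neg_im, ← abs_neg]; ring_nf
  have h4 := hCb 0 le_rfl hb.le (-w - v) (him ▸ h1) (him ▸ h2)
  have h5 := hDb 0 (-v) (by simpa using h3)
  simp only [Nat.cast_zero, zero_mul, Real.exp_zero, mul_one, pow_zero, hM₂.zero, Complex.neg_re,
    abs_neg, neg_zero] at h4 h5
  rw [accelIntegrand, norm_mul]
  calc _ ≤ C * (D * Real.exp (-a * |v.re|)) := by gcongr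
    _ = _ := by ring

theorem exp_neg_mul_abs_le {a : ℝ} (ha : 0 < a) (x : ℝ) : Real.exp (-a * |x|) ≤ Real.exp (a * x) := by
  refine Real.exp_le_exp.2 ?_
  nlinarith [neg_abs_le x]

theorem abs_im_le_of_mem_path {ψ η φ : ℝ} (h : φ ∈ uIcc (-ψ + η) (-ψ - η)) (hη : 0 ≤ η) :
    |φ| ≤ |ψ| + η := by
  rw [uIcc_of_ge (by linarith)] at h
  rw [abs_le]
  constructor <;> linarith [h.1, h.2, neg_abs_le ψ, le_abs_self ψ]

/-- The path of the acceleration kernel may be moved horizontally. -/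
theorem hankel_accelIntegrand_eq (hM₂ : IsRegularSeq M₂) (hE : BorelBound ω₁ E)
    (h₂ : KernelBound M₂ ω₂ e₂) {w : ℂ} {η : ℝ} (hη0 : 0 ≤ η) (hη : ω₁ * Real.pi / 2 < η)
    (hη' : η < 2 * Real.pi - ω₁ * Real.pi / 2) (hη₂ : |w.im| + η < ω₂ * Real.pi / 2) (x y : ℝ) :
    hankel (accelIntegrand E e₂ w) x (-w.im + η) (-w.im - η) =
      hankel (accelIntegrand E e₂ w) y (-w.im + η) (-w.im - η) := by
  wlog hxy : y ≤ x generalizing x y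
  · exact (this y x (le_of_not_ge hxy)).symm
  obtain ⟨η₁, h1, h2⟩ := exists_between (lt_min hη (by linarith : ω₁ * Real.pi / 2 < 2 * Real.pi - η))
  obtain ⟨C, a, hC, ha, hb⟩ := norm_accelIntegrand_le hM₂ hE h₂ h1 hη₂
  have habs : ∀ φ, φ ∈ uIcc (-w.im + η) (-w.im - η) → |φ| ≤ |w.im| + η :=
    fun φ hφ => abs_im_le_of_mem_path hφ hη0
  have hd : ∀ v : ℂ, v.im ∈ uIcc (-w.im + η) (-w.im - η) →
      DifferentiableAt ℂ (accelIntegrand E e₂ w) v := fun v hv =>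
    differentiableAt_accelIntegrand hE.diff h₂ ((habs _ hv).trans_lt hη₂)
  have hle1 : η₁ ≤ η := (h2.trans_le (min_le_left _ _)).le
  have hle2 : η ≤ 2 * Real.pi - η₁ := by linarith [h2.trans_le (min_le_right _ _)]
  refine hankel_shift hxy (fun v _ _ hv => hd v hv) ?_ ?_
  · refine integrableOn_of_exp_bound ha (C := C)
      (fun s _ => (hd _ (by simp)).continuousAt) fun s _ => ?_
    refine (hb w _ ?_ ?_ ?_).trans (mul_le_mul_of_nonneg_left (by
      rw [pt_re]; exact exp_neg_mul_abs_le ha s) hC.le)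
    · rw [pt_im, add_neg_cancel_left, abs_of_nonneg hη0]; exact hle1
    · rw [pt_im, add_neg_cancel_left, abs_of_nonneg hη0]; exact hle2
    · rw [pt_im]; exact habs _ left_mem_uIcc
  · refine integrableOn_of_exp_bound ha (C := C)
      (fun s _ => (hd _ (by simp)).continuousAt) fun s _ => ?_
    have e1 : w.im + (-w.im - η) = -η := by ring
    refine (hb w _ ?_ ?_ ?_).trans (mul_le_mul_of_nonneg_left (by
      rw [pt_re]; exact exp_neg_mul_abs_le ha s) hC.le)
    · rw [pt_im, e1, abs_neg, abs_of_nonneg hη0]; exact hle1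
    · rw [pt_im, e1, abs_neg, abs_of_nonneg hη0]; exact hle2
    · rw [pt_im]; exact habs _ right_mem_uIcc

theorem accelKernel_eq_hankel (hω₁ : 0 < ω₁) (hlt : ω₁ < ω₂) (hω₂ : ω₂ < 2)
    (hM₂ : IsRegularSeq M₂) (hE : BorelBound ω₁ (borelKernel e₁)) (h₂ : KernelBound M₂ ω₂ e₂)
    {w : ℂ} (hw : |w.im| < (ω₂ - ω₁) * Real.pi / 2) (x : ℝ) :
    accelKernel ω₁ ω₂ e₁ e₂ w = (-1 / (2 * Real.pi * Complex.I)) *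
      hankel (accelIntegrand (borelKernel e₁) e₂ w) x (-w.im + accelEta ω₁ ω₂ w.im)
        (-w.im - accelEta ω₁ ω₂ w.im) := by
  obtain ⟨η, θ₂, hη, hθ₂, hb⟩ := exists_accelEta_bounds hω₁ hlt hω₂ hw (abs_nonneg _)
  obtain ⟨h1, h2, h3⟩ := hb w.im le_rfl
  have hπ := Real.pi_pos
  have h0 : 0 < ω₁ * Real.pi / 2 := by positivity
  rw [accelKernel_eq, hankel_accelIntegrand_eq hM₂ hE h₂ (by linarith) (hη.trans_le h1)
    (by linarith) (h3.trans_lt hθ₂) 0 x]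

theorem norm_neg_one_div_two_pi_I : ‖(-1 / (2 * Real.pi * Complex.I) : ℂ)‖ ≤ 1 := by
  have hπ := Real.pi_gt_three
  simp only [norm_div, norm_neg, norm_one, norm_mul, Complex.norm_ofNat, Complex.norm_real,
    Complex.norm_I, Real.norm_eq_abs, abs_of_pos Real.pi_pos, mul_one]
  rw [div_le_one (by linarith)]
  linarith

/-- The abscissa `x` of the arc is free and may depend on `w`; the behaviour of the kernel at the
origin and at infinity results from two choices of it. -/
theorem norm_accelKernel_le_of_path (hω₁ : 0 < ω₁) (hlt : ω₁ < ω₂) (hω₂ : ω₂ < 2)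
    (hM₂ : IsRegularSeq M₂) (hE : BorelBound ω₁ (borelKernel e₁)) (h₂ : KernelBound M₂ ω₂ e₂)
    {w : ℂ} (hw : |w.im| < (ω₂ - ω₁) * Real.pi / 2) {η θ₂ X b x : ℝ} (hb : 0 < b) (hX : 0 ≤ X)
    (hη : ω₁ * Real.pi / 2 < η) (h1 : η ≤ accelEta ω₁ ω₂ w.im)
    (h2 : accelEta ω₁ ω₂ w.im ≤ 2 * Real.pi - η) (h3 : |w.im| + accelEta ω₁ ω₂ w.im ≤ θ₂)
    (hray : ∀ v : ℂ, v.re ≤ x → η ≤ |(-w - v).im| → |(-w - v).im| ≤ 2 * Real.pi - η → |v.im| ≤ θ₂ →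
      ‖accelIntegrand (borelKernel e₁) e₂ w v‖ ≤ X * Real.exp (b * (v.re - x)))
    (harc : ∀ v : ℂ, v.re = x → |v.im| ≤ θ₂ →
      ‖accelIntegrand (borelKernel e₁) e₂ w v‖ ≤ X) :
    ‖accelKernel ω₁ ω₂ e₁ e₂ w‖ ≤ X * (2 / b + 4 * Real.pi) := by
  have hπ := Real.pi_pos
  have h0 : 0 < ω₁ * Real.pi / 2 := by positivity
  have hη0 : 0 ≤ accelEta ω₁ ω₂ w.im := by linarith
  rw [accelKernel_eq_hankel hω₁ hlt hω₂ hM₂ hE h₂ hw x, norm_mul]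
  refine (mul_le_of_le_one_left (norm_nonneg _) norm_neg_one_div_two_pi_I).trans ?_
  have hin : ∀ φ ∈ uIcc (-w.im + accelEta ω₁ ω₂ w.im) (-w.im - accelEta ω₁ ω₂ w.im), |φ| ≤ θ₂ :=
    fun φ hφ => (abs_im_le_of_mem_path hφ hη0).trans h3
  refine (norm_hankel_le (X := X) hb (fun s hs => ?_) (fun s hs => ?_) fun φ hφ => ?_).trans ?_
  · have e1 : |(-w - pt s (-w.im + accelEta ω₁ ω₂ w.im)).im| = accelEta ω₁ ω₂ w.im := by
      rw [Complex.sub_im, Complex.neg_im, pt_im, sub_add_cancel_left, abs_neg, abs_of_nonneg hη0]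
    simpa using hray (pt s _) (by simpa using hs) (by rw [e1]; exact h1) (by rw [e1]; exact h2)
      (by rw [pt_im]; exact hin _ left_mem_uIcc)
  · have e1 : |(-w - pt s (-w.im - accelEta ω₁ ω₂ w.im)).im| = accelEta ω₁ ω₂ w.im := by
      rw [Complex.sub_im, Complex.neg_im, pt_im, sub_sub_cancel, abs_of_nonneg hη0]
    simpa using hray (pt s _) (by simpa using hs) (by rw [e1]; exact h1) (by rw [e1]; exact h2)
      (by rw [pt_im]; exact hin _ right_mem_uIcc)
  · exact harc _ (by simp) (by rw [pt_im]; exact hin φ hφ)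
  · have e2 : |(-w.im - accelEta ω₁ ω₂ w.im) - (-w.im + accelEta ω₁ ω₂ w.im)| ≤ 4 * Real.pi := by
      rw [abs_le]; constructor <;> linarith
    gcongr

/-- Behaviour of the acceleration kernel at the origin. -/
theorem exists_norm_accelKernel_le_exp (hω₁ : 0 < ω₁) (hlt : ω₁ < ω₂) (hω₂ : ω₂ < 2)
    (hM₂ : IsRegularSeq M₂) (hE : BorelBound ω₁ (borelKernel e₁)) (h₂ : KernelBound M₂ ω₂ e₂) :
    ∃ a, 0 < a ∧ ∀ ϑ, 0 ≤ ϑ → ϑ < (ω₂ - ω₁) * Real.pi / 2 → ∃ C, 0 < C ∧ ∀ w : ℂ, |w.im| ≤ ϑ →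
      ‖accelKernel ω₁ ω₂ e₁ e₂ w‖ ≤ C * Real.exp (a * w.re) := by
  have hπ := Real.pi_pos
  obtain ⟨b, hb, hEb⟩ := hE.bound
  obtain ⟨a₂, ha₂, h₂b⟩ := h₂.bound
  -- Since `a < b`, the decay of `E` on the rays outweighs the growth `exp (-a v.re)` allowed for
  -- `e₂ (-v)`.
  set a := min a₂ (b / 2)
  have ha : 0 < a := by positivity
  have hab : 0 < b - a := by
    have : a ≤ b / 2 := min_le_right _ _
    linarith
  refine ⟨a, ha, fun ϑ hϑ0 hϑ => ?_⟩
  obtain ⟨η, θ₂, hη, hθ₂, hbd⟩ := exists_accelEta_bounds hω₁ hlt hω₂ hϑ hϑ0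
  obtain ⟨C₁, hC₁, hC₁b⟩ := hEb η hη
  obtain ⟨C₂, k, hC₂, hk, hC₂b⟩ := h₂b θ₂ hθ₂
  obtain ⟨B, hB, hBb⟩ := Differentiable.exists_bound_closedBall hE.diff 1
  have he₂ : ∀ v : ℂ, |v.im| ≤ θ₂ → ‖e₂ (-v)‖ ≤ C₂ * Real.exp (-a * v.re) := by
    intro v hv
    obtain ⟨h1, h2⟩ := hC₂b (-v) (by simpa using hv)
    rcases le_total v.re 0 with h | h
    · refine h2.trans ?_
      gcongr
      refine (hM₂.hFun_le_one (by positivity)).trans (Real.one_le_exp ?_)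
      nlinarith
    · refine h1.trans (mul_le_mul_of_nonneg_left (Real.exp_le_exp.2 ?_) hC₂.le)
      have : a ≤ a₂ := min_le_left _ _
      rw [Complex.neg_re]; nlinarith
  set C := max C₁ B * C₂ with hCdef
  have hC : 0 < C := mul_pos (lt_max_of_lt_left hC₁) hC₂
  refine ⟨C * (2 / (b - a) + 4 * Real.pi), by positivity, fun w hw => ?_⟩
  obtain ⟨h1, h2, h3⟩ := hbd w.im hw
  -- With `x = -w.re` the arc evaluates `E` on the unit circle.
  refine (norm_accelKernel_le_of_path (X := C * Real.exp (a * w.re)) (x := -w.re) hω₁ hlt hω₂ hM₂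
    hE h₂ (hw.trans_lt hϑ) hab (by positivity) hη h1 h2 h3 ?_ ?_).trans (le_of_eq (by ring))
  · intro v _ hv1 hv2 hv3
    have h4 := hC₁b b hb.le le_rfl _ hv1 hv2
    have h5 := he₂ v hv3
    rw [accelIntegrand, norm_mul]
    calc _ ≤ (C₁ * Real.exp (-b * (-w - v).re)) * (C₂ * Real.exp (-a * v.re)) := by gcongr
      _ = C₁ * C₂ * (Real.exp (a * w.re) * Real.exp ((b - a) * (v.re - -w.re))) := by
          rw [← Real.exp_add, mul_mul_mul_comm, ← Real.exp_add, Complex.sub_re, Complex.neg_re]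
          ring_nf
      _ ≤ C * (Real.exp (a * w.re) * Real.exp ((b - a) * (v.re - -w.re))) := by
          rw [hCdef]
          gcongr
          exact le_max_left _ _
      _ = _ := by ring
  · intro v hv hv3
    have h4 := hBb (Complex.exp (-w - v)) (by
      rw [Complex.norm_exp, Complex.sub_re, Complex.neg_re, hv]; simp)
    have h5 := he₂ v hv3
    rw [accelIntegrand, norm_mul]
    calc _ ≤ B * (C₂ * Real.exp (-a * v.re)) := by gcongr
      _ = B * C₂ * Real.exp (a * w.re) := by rw [hv]; ring_nf
      _ ≤ _ := by
          rw [hCdef]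
          gcongr
          exact le_max_right _ _

/-- Decay of the acceleration kernel at infinity. -/
theorem exists_norm_accelKernel_le_hFun {M₁ : ℕ → ℝ} (hω₁ : 0 < ω₁) (hlt : ω₁ < ω₂) (hω₂ : ω₂ < 2)
    (hM₁ : IsWeightSequence M₁) (hn₁ : M₁ 1 = 1) (hg : ∃ C K : ℝ, 0 < C ∧ 0 < K ∧
      ∀ z : ℂ, ‖borelKernel e₁ z‖ ≤ C * Real.exp (omegaFun M₁ (‖z‖ / K)))
    (hM₂ : IsRegularSeq M₂) (hE : BorelBound ω₁ (borelKernel e₁)) (h₂ : KernelBound M₂ ω₂ e₂)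
    {ϑ : ℝ} (hϑ0 : 0 ≤ ϑ) (hϑ : ϑ < (ω₂ - ω₁) * Real.pi / 2) :
    ∃ C k, 0 < C ∧ 0 < k ∧ ∀ w : ℂ, |w.im| ≤ ϑ →
      ‖accelKernel ω₁ ω₂ e₁ e₂ w‖ ≤ C * hFun (M₂ / M₁) (k * Real.exp (-w.re)) := by
  have hπ := Real.pi_pos
  obtain ⟨b, hb, hEb⟩ := hE.bound
  obtain ⟨a₂, ha₂, h₂b⟩ := h₂.bound
  obtain ⟨C₀, K, hC₀, hK, hg⟩ := hg
  obtain ⟨η, θ₂, hη, hθ₂, hbd⟩ := exists_accelEta_bounds hω₁ hlt hω₂ hϑ hϑ0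
  obtain ⟨C₁, hC₁, hC₁b⟩ := hEb η hη
  obtain ⟨C₂, k, hC₂, hk, hC₂b⟩ := h₂b θ₂ hθ₂
  set C := max (C₁ * Real.exp (-b * Real.log K)) C₀ * C₂ with hCdef
  have hC : 0 < C := mul_pos (lt_max_of_lt_right hC₀) hC₂
  have hpos : 0 < C * (2 / b + 4 * Real.pi) := by positivity
  refine ⟨C * (2 / b + 4 * Real.pi), k / K, hpos, by positivity, fun w hw => ?_⟩
  rw [← div_le_iff₀' hpos]
  -- From here `p` is fixed, and the arc is chosen for this `p`.
  refine le_ciInf fun p => ?_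
  rw [div_le_iff₀' hpos]
  obtain ⟨h1, h2, h3⟩ := hbd w.im hw
  set m := quot M₁ p with hm
  have hm0 : 0 < m := hM₁.quot_pos p
  have hm1 : 1 ≤ m := hM₁.one_le_quot hn₁ p
  have hM1p := hM₁.pos p
  have hM2p := hM₂.pos p
  -- On this arc `|exp (-w - v)| / K = m`, where `exp ω_{M₁}` equals `m ^ p / M₁ p`. The power `m ^
  -- p` cancels against `(exp x) ^ p` in `Y`.
  set x := -w.re - Real.log K - Real.log m with hx
  have hexpx : Real.exp x = Real.exp (-w.re) / K / m := by
    rw [hx, Real.exp_sub, Real.exp_sub, Real.exp_log hK, Real.exp_log hm0]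
  set Y := M₂ p * (k * Real.exp x) ^ p with hY
  have hY0 : 0 ≤ Y := by positivity
  have hXeq : m ^ p / M₁ p * Y = (M₂ / M₁) p * (k / K * Real.exp (-w.re)) ^ p := by
    simp only [hY, hexpx, Pi.div_apply]
    have : (k * (Real.exp (-w.re) / K / m)) = (k / K * Real.exp (-w.re)) / m := by field_simp
    rw [this, div_pow]
    field_simp
  have he₂ : ∀ v : ℂ, v.re ≤ x → |v.im| ≤ θ₂ → ‖e₂ (-v)‖ ≤ C₂ * Y := by
    intro v hvx hv
    obtain ⟨-, h2⟩ := hC₂b (-v) (by simpa using hv)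
    refine h2.trans ?_
    gcongr
    refine (hFun_le hM₂.pos (by positivity) p).trans ?_
    rw [Complex.neg_re, neg_neg, hY]
    gcongr
  -- Lets the rays, where `E` decays and no such factor arises, share the bound of the arc.
  have hone : 1 ≤ m ^ p / M₁ p := by
    rw [one_le_div hM1p]; exact hM₁.le_quot_pow p
  refine (norm_accelKernel_le_of_path (X := C * (m ^ p / M₁ p * Y)) (x := x) hω₁ hlt hω₂ hM₂
    hE h₂ (hw.trans_lt hϑ) hb (by positivity) hη h1 h2 h3 ?_ ?_).trans
      (le_of_eq (by rw [hXeq]; ring))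
  · intro v hvx hv1 hv2 hv3
    have h4 := hC₁b b hb.le le_rfl _ hv1 hv2
    have h5 := he₂ v hvx hv3
    have h6 : Real.exp (-b * (-w - v).re) ≤ Real.exp (-b * Real.log K) * Real.exp (b * (v.re - x)) := by
      rw [← Real.exp_add]
      refine Real.exp_le_exp.2 ?_
      have := mul_nonneg hb.le (Real.log_nonneg hm1)
      rw [hx, Complex.sub_re, Complex.neg_re]
      nlinarith
    rw [accelIntegrand, norm_mul]
    calc _ ≤ (C₁ * Real.exp (-b * (-w - v).re)) * (C₂ * Y) := by gcongr
      _ ≤ (C₁ * (Real.exp (-b * Real.log K) * Real.exp (b * (v.re - x)))) * (C₂ * Y) := by gcongr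
      _ = C₁ * Real.exp (-b * Real.log K) * C₂ * (1 * Y) * Real.exp (b * (v.re - x)) := by ring
      _ ≤ C * (m ^ p / M₁ p * Y) * Real.exp (b * (v.re - x)) := by
          rw [hCdef]
          gcongr
          exact le_max_left _ _
  · intro v hvx hv3
    have h4 := hg (Complex.exp (-w - v))
    have h5 := he₂ v hvx.le hv3
    have h6 : ‖Complex.exp (-w - v)‖ / K = m := by
      rw [Complex.norm_exp, Complex.sub_re, Complex.neg_re, hvx, hx]
      have : -w.re - (-w.re - Real.log K - Real.log m) = Real.log K + Real.log m := by ring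
      rw [this, Real.exp_add, Real.exp_log hK, Real.exp_log hm0]
      field_simp
    rw [h6, hm, hM₁.exp_omegaFun_quot, ← hm] at h4
    rw [accelIntegrand, norm_mul]
    calc _ ≤ (C₀ * (m ^ p / M₁ p)) * (C₂ * Y) := by gcongr
      _ = C₀ * C₂ * (m ^ p / M₁ p * Y) := by ring
      _ ≤ _ := by
          rw [hCdef]
          gcongr
          exact le_max_right _ _

end

/-! ### Holomorphy of the acceleration kernel -/

theorem differentiableAt_hankel {F : ℂ → ℂ → ℂ} {w₀ : ℂ} {r x θ θ' C a B : ℝ} (hr : 0 < r)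
    (ha : 0 < a)
    (hc : ∀ w ∈ Metric.ball w₀ r, ∀ v : ℂ, v.im ∈ uIcc θ θ' → ContinuousAt (F w) v)
    (hd : ∀ v : ℂ, v.im ∈ uIcc θ θ' → ∀ w ∈ Metric.ball w₀ r, DifferentiableAt ℂ (fun w => F w v) w)
    (hray : ∀ w ∈ Metric.ball w₀ r, ∀ s ≤ x, ‖F w (pt s θ)‖ ≤ C * Real.exp (a * s))
    (hray' : ∀ w ∈ Metric.ball w₀ r, ∀ s ≤ x, ‖F w (pt s θ')‖ ≤ C * Real.exp (a * s))
    (harc : ∀ w ∈ Metric.ball w₀ r, ∀ φ ∈ uIcc θ θ', ‖F w (pt x φ)‖ ≤ B) :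
    DifferentiableAt ℂ (fun w => hankel (F w) x θ θ') w₀ := by
  have key : ∀ φ ∈ uIcc θ θ', (∀ w ∈ Metric.ball w₀ r, ∀ s ≤ x,
      ‖F w (pt s φ)‖ ≤ C * Real.exp (a * s)) →
      DifferentiableAt ℂ (fun w => horiz (F w) x φ) w₀ := by
    intro φ hφ hb
    refine differentiableAt_integral_param (μ := volume.restrict (Iic x))
      (F := fun w s => F w (pt s φ)) hr (fun w hw => ?_) ?_
      ((integrableOn_exp_mul_Iic ha x).const_mul C) ?_
    · exact (continuousOn_comp_pt fun s _ => hc w hw _ (by simpa using hφ)).aestronglyMeasurable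
        measurableSet_Iic
    · filter_upwards [ae_restrict_mem measurableSet_Iic] with s hs w hw using hb w hw s hs
    · exact Eventually.of_forall fun s w hw => hd _ (by simpa using hφ) w hw
  have hvert : DifferentiableAt ℂ (fun w => vert (F w) x θ θ') w₀ := by
    unfold vert
    simp_rw [intervalIntegral.intervalIntegral_eq_integral_uIoc]
    refine DifferentiableAt.const_smul ?_ _
    refine differentiableAt_integral_param (μ := volume.restrict (uIoc θ θ'))
      (F := fun w φ => Complex.I * F w (pt x φ)) (bound := fun _ => B) hr (fun w hw => ?_) ?_
      ?_ ?_
    · refine ContinuousOn.aestronglyMeasurable (fun φ hφ => ?_) measurableSet_uIoc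
      exact (continuousAt_const.mul ((hc w hw _ (by simpa using uIoc_subset_uIcc hφ)).comp
        (f := fun φ : ℝ => pt x φ) (continuous_pt_right x).continuousAt)).continuousWithinAt
    · filter_upwards [ae_restrict_mem measurableSet_uIoc] with φ hφ w hw
      simpa using harc w hw φ (uIoc_subset_uIcc hφ)
    · exact (continuous_const (y := B)).integrableOn_uIoc
    · filter_upwards [ae_restrict_mem measurableSet_uIoc] with φ hφ w hw
      exact (hd _ (by simpa using uIoc_subset_uIcc hφ) w hw).const_mul _
  exact ((key θ left_mem_uIcc hray).add hvert).sub (key θ' right_mem_uIcc hray')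

section
variable {M₂ : ℕ → ℝ} {ω₁ ω₂ : ℝ} {e₁ e₂ : ℂ → ℂ}

/-- The direction and the opening of the path vary with `arg z`. For `w` near `w₀` both rays can be
turned onto those of `w₀`, through arguments where `E` is bounded and `e₂` decays. The path is then
fixed and only the integrand depends on `w`. -/
theorem differentiableAt_accelKernel (hω₁ : 0 < ω₁) (hlt : ω₁ < ω₂) (hω₂ : ω₂ < 2)
    (hM₂ : IsRegularSeq M₂) (hE : BorelBound ω₁ (borelKernel e₁)) (h₂ : KernelBound M₂ ω₂ e₂)
    {w₀ : ℂ} (hw₀ : |w₀.im| < (ω₂ - ω₁) * Real.pi / 2) :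
    DifferentiableAt ℂ (accelKernel ω₁ ω₂ e₁ e₂) w₀ := by
  have hπ := Real.pi_pos
  have h0 : 0 < ω₁ * Real.pi / 2 := by positivity
  obtain ⟨ϑ, hϑ1, hϑ2⟩ := exists_between hw₀
  have hϑ0 : 0 ≤ ϑ := (abs_nonneg _).trans hϑ1.le
  obtain ⟨η, θ₂, hη, hθ₂, hbd⟩ := exists_accelEta_bounds hω₁ hlt hω₂ hϑ2 hϑ0
  -- The gap `η - η'` is the room in which `w` moves while the path of `w₀` stays admissible.
  obtain ⟨η', hη'1, hη'2⟩ := exists_between hη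
  obtain ⟨C, a, hC, ha, hb⟩ := norm_accelIntegrand_le hM₂ hE h₂ hη'1 hθ₂
  set r := min (η - η') (ϑ - |w₀.im|) with hr
  have hr0 : 0 < r := lt_min (by linarith) (by linarith)
  have him : ∀ w ∈ Metric.ball w₀ r, |w.im - w₀.im| < η - η' ∧ |w.im| ≤ ϑ := by
    intro w hw
    have h1 : |w.im - w₀.im| < r := by
      have := Complex.abs_im_le_norm (w - w₀)
      rw [Complex.sub_im] at this
      exact this.trans_lt (mem_ball_iff_norm.1 hw)
    refine ⟨h1.trans_le (min_le_left _ _), ?_⟩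
    have h2 := h1.trans_le (min_le_right _ _)
    calc |w.im| = |w.im - w₀.im + w₀.im| := by ring_nf
      _ ≤ |w.im - w₀.im| + |w₀.im| := abs_add_le _ _
      _ ≤ _ := by linarith
  obtain ⟨g1, g2, g3⟩ := hbd w₀.im hϑ1.le
  set η₀ := accelEta ω₁ ω₂ w₀.im with hη₀
  set G := accelIntegrand (borelKernel e₁) e₂ with hG
  have hin0 : ∀ φ ∈ uIcc (-w₀.im + η₀) (-w₀.im - η₀), |φ| ≤ θ₂ := fun φ hφ =>
    (abs_im_le_of_mem_path hφ (by linarith)).trans g3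
  have hcont : ∀ w v : ℂ, |v.im| ≤ θ₂ → DifferentiableAt ℂ (G w) v := fun w v hv =>
    differentiableAt_accelIntegrand hE.diff h₂ (hv.trans_lt hθ₂)
  have hexp : ∀ w v : ℂ, η' ≤ |w.im + v.im| → |w.im + v.im| ≤ 2 * Real.pi - η' →
      |v.im| ≤ θ₂ → ‖G w v‖ ≤ C * Real.exp (a * v.re) := fun w v h1 h2 h3 =>
    (hb w v h1 h2 h3).trans (mul_le_mul_of_nonneg_left (exp_neg_mul_abs_le ha _) hC.le)
  have hfix : ∀ w ∈ Metric.ball w₀ r, accelKernel ω₁ ω₂ e₁ e₂ w =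
      (-1 / (2 * Real.pi * Complex.I)) * hankel (G w) 0 (-w₀.im + η₀) (-w₀.im - η₀) := by
    intro w hw
    obtain ⟨hw1, hw2⟩ := him w hw
    obtain ⟨k1, k2, k3⟩ := hbd w.im hw2
    rw [accelKernel_eq]
    set ηw := accelEta ω₁ ω₂ w.im
    have hinw : ∀ φ ∈ uIcc (-w.im + ηw) (-w.im - ηw), |φ| ≤ θ₂ := fun φ hφ =>
      (abs_im_le_of_mem_path hφ (by linarith)).trans k3
    rw [abs_lt] at hw1
    have hL : ∀ φ ∈ uIcc (-w₀.im + η₀) (-w.im + ηw),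
        η' ≤ |w.im + φ| ∧ |w.im + φ| ≤ 2 * Real.pi - η' ∧ |φ| ≤ θ₂ := by
      intro φ hφ
      have hsub : uIcc (-w₀.im + η₀) (-w.im + ηw) ⊆ Icc (-w.im + η') (-w.im + (2 * Real.pi - η')) :=
        uIcc_subset_Icc ⟨by linarith, by linarith⟩ ⟨by linarith, by linarith⟩
      have := hsub hφ
      rw [abs_of_nonneg (by linarith [this.1] : 0 ≤ w.im + φ)]
      refine ⟨by linarith [this.1], by linarith [this.2], ?_⟩
      have hsub2 : uIcc (-w₀.im + η₀) (-w.im + ηw) ⊆ Icc (-θ₂) θ₂ :=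
        uIcc_subset_Icc (abs_le.1 (hin0 _ left_mem_uIcc)) (abs_le.1 (hinw _ left_mem_uIcc))
      exact abs_le.2 (hsub2 hφ)
    have hR : ∀ φ ∈ uIcc (-w₀.im - η₀) (-w.im - ηw),
        η' ≤ |w.im + φ| ∧ |w.im + φ| ≤ 2 * Real.pi - η' ∧ |φ| ≤ θ₂ := by
      intro φ hφ
      have hsub : uIcc (-w₀.im - η₀) (-w.im - ηw) ⊆ Icc (-w.im - (2 * Real.pi - η')) (-w.im - η') :=
        uIcc_subset_Icc ⟨by linarith, by linarith⟩ ⟨by linarith, by linarith⟩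
      have := hsub hφ
      rw [abs_of_nonpos (by linarith [this.2] : w.im + φ ≤ 0)]
      refine ⟨by linarith [this.2], by linarith [this.1], ?_⟩
      have hsub2 : uIcc (-w₀.im - η₀) (-w.im - ηw) ⊆ Icc (-θ₂) θ₂ :=
        uIcc_subset_Icc (abs_le.1 (hin0 _ right_mem_uIcc)) (abs_le.1 (hinw _ right_mem_uIcc))
      exact abs_le.2 (hsub2 hφ)
    have s1 : hankel (G w) 0 (-w.im + ηw) (-w.im - ηw) =
        hankel (G w) 0 (-w₀.im + η₀) (-w.im - ηw) := by
      refine hankel_left_eq (C := C) (a := a) ha (fun v _ hv => hcont w v (hL _ hv).2.2)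
        (fun v _ hv => hexp w v (hL _ hv).1 (hL _ hv).2.1 (hL _ hv).2.2) fun φ hφ => ?_
      refine (hcont w _ ?_).continuousAt
      have hsub2 : uIcc (-w₀.im + η₀) (-w.im - ηw) ⊆ Icc (-θ₂) θ₂ :=
        uIcc_subset_Icc (abs_le.1 (hin0 _ left_mem_uIcc)) (abs_le.1 (hinw _ right_mem_uIcc))
      rw [pt_im]; exact abs_le.2 (hsub2 hφ)
    have s2 : hankel (G w) 0 (-w₀.im + η₀) (-w.im - ηw) =
        hankel (G w) 0 (-w₀.im + η₀) (-w₀.im - η₀) := by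
      refine hankel_right_eq (C := C) (a := a) ha (fun v _ hv => hcont w v (hR _ hv).2.2)
        (fun v _ hv => hexp w v (hR _ hv).1 (hR _ hv).2.1 (hR _ hv).2.2) fun φ hφ => ?_
      refine (hcont w _ ?_).continuousAt
      rw [pt_im]; exact hin0 _ hφ
    rw [s1, s2]
  have hball : ∀ᶠ w in 𝓝 w₀, w ∈ Metric.ball w₀ r := Metric.ball_mem_nhds w₀ hr0
  refine DifferentiableAt.congr_of_eventuallyEq ?_ (hball.mono hfix)
  refine DifferentiableAt.const_mul ?_ _
  obtain ⟨B, hB, hBb⟩ := Differentiable.exists_bound_closedBall hE.diff (Real.exp (-w₀.re + r))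
  obtain ⟨D, A, b, hD, hA, hb0, hDb⟩ := h₂.exp_bound hM₂ hθ₂
  refine differentiableAt_hankel (C := C) (a := a) (B := B * D) hr0 ha
    (fun w _ v hv => (hcont w v (hin0 _ hv)).continuousAt) (fun v hv w hw => ?_) ?_ ?_ ?_
  · have h3 : DifferentiableAt ℂ (fun w => borelKernel e₁ (Complex.exp (-w - v))) w :=
      (hE.diff _).comp w (f := fun w => Complex.exp (-w - v)) (by fun_prop)
    exact h3.mul_const _
  · intro w hw s _
    have hw1 := abs_lt.1 (him w hw).1
    have e1 : w.im + (-w₀.im + η₀) = (w.im - w₀.im) + η₀ := by ring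
    have h4 := hexp w (pt s (-w₀.im + η₀)) (by
      rw [pt_im, e1, abs_of_nonneg (by linarith)]; linarith) (by
      rw [pt_im, e1, abs_of_nonneg (by linarith)]; linarith) (by
      rw [pt_im]; exact hin0 _ left_mem_uIcc)
    rwa [pt_re] at h4
  · intro w hw s _
    have hw1 := abs_lt.1 (him w hw).1
    have e1 : w.im + (-w₀.im - η₀) = (w.im - w₀.im) - η₀ := by ring
    have h4 := hexp w (pt s (-w₀.im - η₀)) (by
      rw [pt_im, e1, abs_of_nonpos (by linarith)]; linarith) (by
      rw [pt_im, e1, abs_of_nonpos (by linarith)]; linarith) (by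
      rw [pt_im]; exact hin0 _ right_mem_uIcc)
    rwa [pt_re] at h4
  · intro w hw φ hφ
    have h1 : |w.re - w₀.re| < r := by
      have := Complex.abs_re_le_norm (w - w₀)
      rw [Complex.sub_re] at this
      exact this.trans_lt (mem_ball_iff_norm.1 hw)
    have h5 := hBb (Complex.exp (-w - pt 0 φ)) (by
      rw [Complex.norm_exp]
      refine Real.exp_le_exp.2 ?_
      rw [Complex.sub_re, Complex.neg_re, pt_re]
      linarith [(abs_lt.1 h1).1])
    have h6 := hDb 0 (-(pt 0 φ)) (by simpa using hin0 φ hφ)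
    simp only [Nat.cast_zero, Real.exp_zero, mul_one, pow_zero, hM₂.zero, Complex.neg_re,
      pt_re, neg_zero, abs_zero, mul_zero] at h6
    rw [hG, accelIntegrand, norm_mul]
    gcongr

theorem accelKernel_kernelBound {M₁ : ℕ → ℝ} (hω₁ : 0 < ω₁) (hlt : ω₁ < ω₂) (hω₂ : ω₂ < 2)
    (hM₁ : IsWeightSequence M₁) (hn₁ : M₁ 1 = 1) (hg : ∃ C K : ℝ, 0 < C ∧ 0 < K ∧
      ∀ z : ℂ, ‖borelKernel e₁ z‖ ≤ C * Real.exp (omegaFun M₁ (‖z‖ / K)))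
    (hM₂ : IsRegularSeq M₂) (hE : BorelBound ω₁ (borelKernel e₁)) (h₂ : KernelBound M₂ ω₂ e₂) :
    KernelBound (M₂ / M₁) (ω₂ - ω₁) (accelKernel ω₁ ω₂ e₁ e₂) := by
  have hπ := Real.pi_pos
  have hN : ∀ p, 0 < (M₂ / M₁) p := fun p => div_pos (hM₂.pos p) (hM₁.pos p)
  refine ⟨fun w hw => (differentiableAt_accelKernel hω₁ hlt hω₂ hM₂ hE h₂
    (by simpa [sector, argument] using hw)).differentiableWithinAt, ?_⟩
  obtain ⟨a, ha, h⟩ := exists_norm_accelKernel_le_exp hω₁ hlt hω₂ hM₂ hE h₂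
  refine ⟨a, ha, fun θ hθ => ?_⟩
  have hmax : max θ 0 < (ω₂ - ω₁) * Real.pi / 2 := max_lt hθ (by
    have : 0 < ω₂ - ω₁ := by linarith
    positivity)
  obtain ⟨C, hC, hCb⟩ := h (max θ 0) (le_max_right _ _) hmax
  obtain ⟨C', k, hC', hk, hCb'⟩ := exists_norm_accelKernel_le_hFun hω₁ hlt hω₂ hM₁ hn₁ hg hM₂ hE h₂
    (le_max_right θ 0) hmax
  refine ⟨max C C', k, lt_max_of_lt_left hC, hk, fun w hw => ?_⟩
  have hw' : |w.im| ≤ max θ 0 := hw.trans (le_max_left _ _)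
  have hh : 0 ≤ hFun (M₂ / M₁) (k * Real.exp (-w.re)) := hFun_nonneg hN (by positivity)
  constructor
  · refine (hCb w hw').trans ?_
    gcongr
    exact le_max_left _ _
  · refine (hCb' w hw').trans ?_
    gcongr
    exact le_max_right _ _

end

/-! ### Positive kernels -/

section
variable {N : ℕ → ℝ} {ω : ℝ} {e : ℂ → ℂ}

theorem norm_eq_of_pos (hpos : ∀ s : ℝ, ∃ y : ℝ, 0 < y ∧ e (pt s 0) = y) (s : ℝ) :
    0 < ‖e (pt s 0)‖ ∧ e (pt s 0) = (‖e (pt s 0)‖ : ℂ) := by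
  obtain ⟨y, hy, h⟩ := hpos s
  rw [h, Complex.norm_real, Real.norm_eq_abs, abs_of_pos hy]
  exact ⟨hy, rfl⟩

theorem integrable_norm_mul_exp (hN : IsRegularSeq N) (hω : 0 < ω) (h : KernelBound N ω e) (n : ℕ) :
    Integrable fun s : ℝ => ‖e (pt s 0)‖ * Real.exp (n * s) := by
  have := (h.integrable_exp_mul hN (θ := 0) (by have := Real.pi_pos; rw [abs_zero]; positivity) n).norm
  refine this.congr (Eventually.of_forall fun s => ?_)
  simp [Complex.norm_exp, mul_comm]

theorem moment_eq_ofReal (hpos : ∀ s : ℝ, ∃ y : ℝ, 0 < y ∧ e (pt s 0) = y) (n : ℕ) :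
    moment e n = ((∫ s : ℝ, ‖e (pt s 0)‖ * Real.exp (n * s) : ℝ) : ℂ) := by
  rw [moment_nat_eq, ← integral_complex_ofReal]
  congr 1
  ext s
  conv_lhs => rw [(norm_eq_of_pos hpos s).2]
  push_cast
  rw [mul_comm]
  simp [pt]

theorem integral_norm_mul_exp_pos (hN : IsRegularSeq N) (hω : 0 < ω) (h : KernelBound N ω e)
    (hpos : ∀ s : ℝ, ∃ y : ℝ, 0 < y ∧ e (pt s 0) = y) (n : ℕ) :
    0 < ∫ s : ℝ, ‖e (pt s 0)‖ * Real.exp (n * s) := by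
  have hp : ∀ s : ℝ, 0 < ‖e (pt s 0)‖ * Real.exp (n * s) := fun s =>
    mul_pos (norm_eq_of_pos hpos s).1 (Real.exp_pos _)
  rw [integral_pos_iff_support_of_nonneg (fun s => (hp s).le) (integrable_norm_mul_exp hN hω h n)]
  have : (Function.support fun s : ℝ => ‖e (pt s 0)‖ * Real.exp (n * s)) = univ :=
    eq_univ_of_forall fun s => (hp s).ne'
  simp [this]

theorem moment_ne_zero (hN : IsRegularSeq N) (hω : 0 < ω) (h : KernelBound N ω e)
    (hpos : ∀ s : ℝ, ∃ y : ℝ, 0 < y ∧ e (pt s 0) = y) (n : ℕ) : moment e n ≠ 0 := by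
  rw [moment_eq_ofReal hpos]
  exact_mod_cast (integral_norm_mul_exp_pos hN hω h hpos n).ne'

theorem norm_moment (hN : IsRegularSeq N) (hω : 0 < ω) (h : KernelBound N ω e)
    (hpos : ∀ s : ℝ, ∃ y : ℝ, 0 < y ∧ e (pt s 0) = y) (n : ℕ) :
    ‖moment e n‖ = ∫ s : ℝ, ‖e (pt s 0)‖ * Real.exp (n * s) := by
  rw [moment_eq_ofReal hpos, Complex.norm_real, Real.norm_eq_abs,
    abs_of_pos (integral_norm_mul_exp_pos hN hω h hpos n)]

/-- A positive kernel has positive moments, so the Taylor coefficients of `E` are positive. -/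
theorem norm_borelKernel_le (hN : IsRegularSeq N) (hω : 0 < ω) (h : KernelBound N ω e)
    (hpos : ∀ s : ℝ, ∃ y : ℝ, 0 < y ∧ e (pt s 0) = y)
    (hent : ∀ z : ℂ, Summable fun n : ℕ => z ^ n / moment e n) (z : ℂ) :
    ‖borelKernel e z‖ ≤ ‖borelKernel e (‖z‖ : ℂ)‖ := by
  have h1 : ∀ n : ℕ, ((‖z‖ : ℝ) : ℂ) ^ n / moment e n = ((‖z ^ n / moment e n‖ : ℝ) : ℂ) := by
    intro n
    rw [norm_div, norm_moment hN hω h hpos, moment_eq_ofReal hpos, norm_pow]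
    push_cast; rfl
  have h2 : borelKernel e (‖z‖ : ℂ) = ((∑' n : ℕ, ‖z ^ n / moment e n‖ : ℝ) : ℂ) := by
    unfold borelKernel
    rw [Complex.ofReal_tsum]
    exact tsum_congr h1
  rw [h2, Complex.norm_real]
  exact (norm_tsum_le_tsum_norm (hent z).norm).trans (le_abs_self _)

/-- The Laplace transform of `u ↦ E(ζ u)` is the Cauchy kernel. -/
theorem integral_mul_borelKernel (hN : IsRegularSeq N) (hω : 0 < ω) (h : KernelBound N ω e)
    (hpos : ∀ s : ℝ, ∃ y : ℝ, 0 < y ∧ e (pt s 0) = y) {y : ℝ} {v : ℂ} (hv : y < v.re) :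
    ∫ s : ℝ, e (pt (s - y) 0) * borelKernel e (Complex.exp (s - v)) =
      1 / (1 - Complex.exp (y - v)) := by
  have hπ := Real.pi_pos
  set F : ℕ → ℝ → ℂ := fun n s => e (pt (s - y) 0) * (Complex.exp (s - v) ^ n / moment e n) with hF
  set q := Complex.exp (y - v) with hq
  have hqn : ‖q‖ < 1 := by
    rw [hq, Complex.norm_exp, Real.exp_lt_one_iff]; simp; linarith
  have hFe : ∀ n s, F n s = (Complex.exp (n * pt (s - y) 0) * e (pt (s - y) 0)) *
      (q ^ n / moment e n) := by
    intro n s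
    have : Complex.exp (s - v) ^ n = Complex.exp (n * pt (s - y) 0) * q ^ n := by
      rw [hq, ← Complex.exp_nat_mul, ← Complex.exp_nat_mul, ← Complex.exp_add]
      congr 1; simp [pt]; ring
    simp only [hF, this]; ring
  have hint := h.integrable_exp_mul hN (θ := 0) (by rw [abs_zero]; positivity)
  have hFint : ∀ n, Integrable (F n) := by
    intro n
    rw [funext (hFe n)]
    exact ((hint n).comp_sub_right y).mul_const _
  have hFval : ∀ n, ∫ s, F n s = q ^ n := by
    intro n
    rw [funext (hFe n), integral_mul_const,
      integral_sub_right_eq_self (fun s => Complex.exp (n * pt s 0) * e (pt s 0)),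
      ← moment_nat_eq, mul_div_cancel₀ _ (moment_ne_zero hN hω h hpos n)]
  -- Positivity of `e` on the axis makes this an equality, so termwise integration is justified by
  -- the geometric series alone.
  have hFnorm : ∀ n, ∫ s, ‖F n s‖ = ‖q‖ ^ n := by
    intro n
    have : (fun s => ‖F n s‖) = fun s => (fun s => ‖e (pt s 0)‖ * Real.exp (n * s)) (s - y) *
        (‖q‖ ^ n / ‖moment e n‖) := by
      ext s
      rw [hFe, norm_mul, norm_mul, norm_div, norm_pow, Complex.norm_exp]
      simp [mul_comm]
    rw [this, integral_mul_const,
      integral_sub_right_eq_self (fun s => ‖e (pt s 0)‖ * Real.exp (n * s)), norm_moment hN hω h hpos,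
      mul_div_cancel₀ _ (integral_norm_mul_exp_pos hN hω h hpos n).ne']
  have hsum := hasSum_integral_of_summable_integral_norm hFint (by
    simp_rw [hFnorm]; exact summable_geometric_of_lt_one (norm_nonneg _) hqn)
  simp_rw [hFval] at hsum
  have h2 := hsum.unique (hasSum_geometric_of_norm_lt_one hqn)
  simp only [hF, tsum_mul_left] at h2
  rw [one_div]
  exact h2

theorem one_sub_exp_ne_zero {y : ℝ} {v : ℂ} (h : v.im ≠ 0) (h2 : |v.im| < 2 * Real.pi) :
    1 - Complex.exp (y - v) ≠ 0 := by
  have hπ := Real.pi_pos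
  intro h0
  obtain ⟨n, hn⟩ := Complex.exp_eq_one_iff.1 (sub_eq_zero.1 h0).symm
  have him := congrArg Complex.im hn
  simp at him
  have h3 : |(n : ℝ)| < 1 := by
    have : |v.im| = |(n : ℝ)| * (2 * Real.pi) := by
      rw [← abs_neg, him, abs_mul, abs_of_pos (show 0 < 2 * Real.pi by positivity)]
    rw [this] at h2
    exact lt_of_mul_lt_mul_right (by linarith) (by positivity : 0 ≤ 2 * Real.pi)
  have h4 : n = 0 := by
    have : |n| < 1 := by exact_mod_cast h3
    exact Int.abs_lt_one_iff.1 this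
  rw [h4] at him
  simp at him
  exact h him

theorem integrable_kernel_sub (hN : IsRegularSeq N) (hω : 0 < ω) (h : KernelBound N ω e) (y : ℝ) :
    Integrable fun s : ℝ => ‖e (pt (s - y) 0)‖ := by
  have := (integrable_norm_mul_exp hN hω h 0).comp_sub_right y
  simpa using this

theorem KernelBound.continuous_sub (hω : 0 < ω) (h : KernelBound N ω e) (y : ℝ) :
    Continuous fun s : ℝ => e (pt (s - y) 0) := by
  have hπ := Real.pi_pos
  exact (h.continuous_pt (θ := 0) (by rw [abs_zero]; positivity)).comp (by fun_prop)

/-- Termwise integration needs `y < re v`. Both sides are holomorphic in the strip of arguments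
where `E` is bounded, so the identity theorem removes that condition there; the period `2πi` gives
the lower strip. -/
theorem integral_mul_borelKernel_of_im (hN : IsRegularSeq N) (hω : 0 < ω)
    (h : KernelBound N ω e) (hE : BorelBound ω (borelKernel e))
    (hpos : ∀ s : ℝ, ∃ y : ℝ, 0 < y ∧ e (pt s 0) = y) {y : ℝ} {v : ℂ}
    (hv : ω * Real.pi / 2 < |v.im|) (hv2 : |v.im| < 2 * Real.pi - ω * Real.pi / 2) :
    ∫ s : ℝ, e (pt (s - y) 0) * borelKernel e (Complex.exp (s - v)) =
      1 / (1 - Complex.exp (y - v)) := by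
  have hπ := Real.pi_pos
  have h0 : 0 < ω * Real.pi / 2 := by positivity
  set Φ : ℂ → ℂ := fun v => ∫ s : ℝ, e (pt (s - y) 0) * borelKernel e (Complex.exp (s - v)) with hΦ
  set U : Set ℂ := Complex.im ⁻¹' Ioo (ω * Real.pi / 2) (2 * Real.pi - ω * Real.pi / 2) with hU
  have hUo : IsOpen U := isOpen_Ioo.preimage Complex.continuous_im
  have hUc : IsPreconnected U :=
    ((convex_Ioo _ _).linear_preimage Complex.imLm : Convex ℝ U).isPreconnected
  obtain ⟨b, hb, hEb⟩ := hE.bound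
  have hd1 : DifferentiableOn ℂ Φ U := by
    intro v₀ hv₀
    obtain ⟨θ, hθ1, hθ2⟩ := exists_between (lt_min hv₀.1
      (by linarith [hv₀.2] : ω * Real.pi / 2 < 2 * Real.pi - v₀.im))
    obtain ⟨C, hC, hCb⟩ := hEb θ hθ1
    have hVo : IsOpen (Complex.im ⁻¹' Ioo θ (2 * Real.pi - θ)) :=
      isOpen_Ioo.preimage Complex.continuous_im
    obtain ⟨r, hr, hball⟩ := Metric.isOpen_iff.1 hVo v₀ ⟨hθ2.trans_le (min_le_left _ _),
      by linarith [hθ2.trans_le (min_le_right _ _)]⟩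
    refine (differentiableAt_integral_param (μ := volume) (F := fun v s => e (pt (s - y) 0) *
      borelKernel e (Complex.exp (s - v))) (bound := fun s => ‖e (pt (s - y) 0)‖ * C) hr
      (fun w hw => ?_) (Eventually.of_forall fun s w hw => ?_)
      ((integrable_kernel_sub hN hω h y).mul_const _)
      (Eventually.of_forall fun s w hw => ?_)).differentiableWithinAt
    · refine ((h.continuous_sub hω y).mul (hE.diff.continuous.comp ?_)).aestronglyMeasurable
      fun_prop
    · have hwi : 0 < w.im := by linarith [(hball hw).1]
      have hi : |((s : ℂ) - w).im| = w.im := by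
        rw [Complex.sub_im, Complex.ofReal_im, zero_sub, abs_neg, abs_of_pos hwi]
      have := hCb 0 le_rfl hb.le (s - w) (by rw [hi]; exact (hball hw).1.le)
        (by rw [hi]; exact (hball hw).2.le)
      rw [norm_mul]
      gcongr
      simpa using this
    · have h3 : DifferentiableAt ℂ (fun w => borelKernel e (Complex.exp (s - w))) w :=
        (hE.diff _).comp w (f := fun w => Complex.exp (s - w)) (by fun_prop)
      exact h3.const_mul _
  have hd2 : DifferentiableOn ℂ (fun v => 1 / (1 - Complex.exp (y - v))) U := by
    intro v₀ hv₀
    have hpos' : 0 < v₀.im := h0.trans hv₀.1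
    refine DifferentiableAt.differentiableWithinAt (DifferentiableAt.div (by fun_prop)
      (by fun_prop) (one_sub_exp_ne_zero hpos'.ne' ?_))
    rw [abs_of_pos hpos']; linarith [hv₀.2]
  have hmain : EqOn Φ (fun v => 1 / (1 - Complex.exp (y - v))) U := by
    have hz : pt (y + 1) Real.pi ∈ U := by
      constructor
      · rw [pt_im]; linarith [hv.trans hv2]
      · rw [pt_im]; linarith [hv.trans hv2]
    refine (hd1.analyticOnNhd hUo).eqOn_of_preconnected_of_eventuallyEq
      (hd2.analyticOnNhd hUo) hUc hz ?_
    have hre : IsOpen {v : ℂ | y < v.re} := isOpen_lt continuous_const Complex.continuous_re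
    filter_upwards [hre.mem_nhds (show y < (pt (y + 1) Real.pi).re by simp)] with v hv
    exact integral_mul_borelKernel hN hω h hpos hv
  rcases le_total 0 v.im with hv0 | hv0
  · rw [abs_of_nonneg hv0] at hv hv2
    exact hmain ⟨hv, hv2⟩
  · rw [abs_of_nonpos hv0] at hv hv2
    have h1 : v + 2 * Real.pi * Complex.I ∈ U := by
      constructor <;> simp <;> linarith
    have h2 := hmain h1
    have h3 : ∀ x : ℂ, Complex.exp (x - (v + 2 * Real.pi * Complex.I)) = Complex.exp (x - v) := by
      intro x
      rw [← Complex.exp_periodic (x - (v + 2 * Real.pi * Complex.I))]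
      congr 1; ring
    simp only [hΦ, h3] at h2
    exact h2

end

/-! ### A residue computation -/

/-- A bound near `-∞` extends up to `x₀` by compactness of the rectangle in between. -/
theorem exists_exp_bound_of_far {g : ℂ → ℂ} {x₁ x₀ θ θ' C a : ℝ} (ha : 0 < a)
    (hc : ∀ v : ℂ, x₁ ≤ v.re → v.re ≤ x₀ → v.im ∈ uIcc θ θ' → ContinuousAt g v)
    (hfar : ∀ v : ℂ, v.re ≤ x₁ → v.im ∈ uIcc θ θ' → ‖g v‖ ≤ C * Real.exp (a * v.re)) :
    ∃ C', ∀ v : ℂ, v.re ≤ x₀ → v.im ∈ uIcc θ θ' → ‖g v‖ ≤ C' * Real.exp (a * v.re) := by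
  obtain ⟨B, hB⟩ := (isCompact_Icc.reProdIm isCompact_uIcc :
    IsCompact (Icc x₁ x₀ ×ℂ uIcc θ θ')).exists_bound_of_continuousOn (f := g)
    (fun v hv => (hc v hv.1.1 hv.1.2 hv.2).continuousWithinAt)
  refine ⟨max C (max B 0 * Real.exp (-a * x₁)), fun v hv hv' => ?_⟩
  rcases le_total v.re x₁ with h | h
  · refine (hfar v h hv').trans ?_
    gcongr
    exact le_max_left _ _
  · calc ‖g v‖ ≤ max B 0 * 1 := by
          rw [mul_one]; exact (hB v ⟨⟨h, hv⟩, hv'⟩).trans (le_max_left _ _)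
      _ ≤ max B 0 * (Real.exp (-a * x₁) * Real.exp (a * v.re)) := by
          gcongr
          rw [← Real.exp_add]
          exact Real.one_le_exp (by nlinarith)
      _ = max B 0 * Real.exp (-a * x₁) * Real.exp (a * v.re) := by ring
      _ ≤ _ := by
          gcongr
          exact le_max_right _ _

theorem norm_one_div_one_sub_exp_le {y : ℝ} {v : ℂ} (hv : v.re ≤ y - 1) :
    ‖1 / (1 - Complex.exp (y - v))‖ ≤ 2 * Real.exp (-y) * Real.exp (1 * v.re) := by
  have h1 : ‖Complex.exp (y - v)‖ = Real.exp (y - v.re) := by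
    rw [Complex.norm_exp]; simp
  have h2 : 2 ≤ Real.exp (y - v.re) := by
    have := Real.add_one_le_exp (y - v.re); linarith
  have h3 : Real.exp (y - v.re) / 2 ≤ ‖1 - Complex.exp (y - v)‖ := by
    have := norm_sub_norm_le (Complex.exp (y - v)) 1
    rw [norm_sub_rev, h1, norm_one] at this
    linarith
  rw [norm_div, norm_one]
  calc 1 / ‖1 - Complex.exp (y - v)‖ ≤ 1 / (Real.exp (y - v.re) / 2) := by gcongr
    _ = 2 * Real.exp (-y) * Real.exp (1 * v.re) := by
        rw [one_div_div, mul_assoc, ← Real.exp_add, div_eq_mul_inv, ← Real.exp_neg]; ring_nf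

theorem hankel_add {g h : ℂ → ℂ} {x θ θ' : ℝ}
    (hg : IntegrableOn (fun s => g (pt s θ)) (Iic x)) (hg' : IntegrableOn (fun s => g (pt s θ')) (Iic x))
    (hh : IntegrableOn (fun s => h (pt s θ)) (Iic x)) (hh' : IntegrableOn (fun s => h (pt s θ')) (Iic x))
    (hgv : ∀ φ ∈ uIcc θ θ', ContinuousAt g (pt x φ))
    (hhv : ∀ φ ∈ uIcc θ θ', ContinuousAt h (pt x φ)) :
    hankel (fun v => g v + h v) x θ θ' = hankel g x θ θ' + hankel h x θ θ' := by
  unfold hankel horiz vert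
  simp only [mul_add]
  rw [integral_add hg hh, integral_add hg' hh', intervalIntegral.integral_add
    (intervalIntegrable_vert hgv) (intervalIntegrable_vert hhv)]
  ring

theorem hankel_const_mul (c : ℂ) (g : ℂ → ℂ) (x θ θ' : ℝ) :
    hankel (fun v => c * g v) x θ θ' = c * hankel g x θ θ' := by
  unfold hankel horiz vert
  simp only [mul_left_comm Complex.I c]
  rw [integral_const_mul, integral_const_mul, intervalIntegral.integral_const_mul]
  ring

theorem hankel_congr {g h : ℂ → ℂ} {x θ θ' : ℝ} (h1 : ∀ s ≤ x, g (pt s θ) = h (pt s θ))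
    (h2 : ∀ s ≤ x, g (pt s θ') = h (pt s θ')) (h3 : ∀ φ ∈ uIcc θ θ', g (pt x φ) = h (pt x φ)) :
    hankel g x θ θ' = hankel h x θ θ' := by
  have h4 : ∫ φ in θ..θ', Complex.I * g (pt x φ) = ∫ φ in θ..θ', Complex.I * h (pt x φ) :=
    intervalIntegral.integral_congr fun φ hφ => by simp only [h3 φ hφ]
  unfold hankel horiz vert
  rw [setIntegral_congr_fun measurableSet_Iic fun s hs => h1 s hs,
    setIntegral_congr_fun measurableSet_Iic fun s hs => h2 s hs, h4]

section residue
variable {y x₀ η : ℝ}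

theorem one_sub_exp_ne_zero_of_re {v : ℂ} (hv : y < v.re) : 1 - Complex.exp (y - v) ≠ 0 := by
  intro h0
  have h1 := congrArg norm (sub_eq_zero.1 h0)
  rw [Complex.norm_exp, norm_one] at h1
  have h2 : Real.exp ((y : ℂ) - v).re < 1 := by
    rw [Real.exp_lt_one_iff]; simp; exact hv
  linarith

theorem differentiableAt_one_div_one_sub_exp {v : ℂ} (h : 1 - Complex.exp (y - v) ≠ 0) :
    DifferentiableAt ℂ (fun v => 1 / (1 - Complex.exp (y - v))) v :=
  DifferentiableAt.div (by fun_prop) (by fun_prop) h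

/-- At heights `π` and `-π` the two rays carry equal values, by periodicity, and cancel. The
vertical segment becomes a full circle, run clockwise, on which `1 / (ζ - exp y)` is integrated. -/
theorem hankel_one_div_one_sub_exp (hx₀ : y < x₀) (hη : 0 < η) (hηπ : η < Real.pi) :
    hankel (fun v => 1 / (1 - Complex.exp (y - v))) x₀ η (-η) = -(2 * Real.pi * Complex.I) := by
  have hπ := Real.pi_pos
  set q : ℂ → ℂ := fun v => 1 / (1 - Complex.exp (y - v)) with hq
  have hne1 : ∀ v : ℂ, v.im ∈ uIcc η Real.pi → 1 - Complex.exp (y - v) ≠ 0 := by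
    intro v hv
    rw [uIcc_of_le hηπ.le] at hv
    have : 0 < v.im := hη.trans_le hv.1
    exact one_sub_exp_ne_zero this.ne' (by rw [abs_of_pos this]; linarith [hv.2])
  have hne2 : ∀ v : ℂ, v.im ∈ uIcc (-η) (-Real.pi) → 1 - Complex.exp (y - v) ≠ 0 := by
    intro v hv
    rw [uIcc_of_ge (by linarith)] at hv
    have : v.im < 0 := by linarith [hv.2]
    exact one_sub_exp_ne_zero this.ne (by rw [abs_of_neg this]; linarith [hv.1])
  have hcv : ∀ φ, ContinuousAt q (pt x₀ φ) := fun φ =>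
    (differentiableAt_one_div_one_sub_exp (one_sub_exp_ne_zero_of_re (by simpa))).continuousAt
  obtain ⟨C₁, hC₁⟩ := exists_exp_bound_of_far (g := q) (x₁ := y - 1) (x₀ := x₀) one_pos
    (fun v _ _ hv => (differentiableAt_one_div_one_sub_exp (hne1 v hv)).continuousAt)
    (fun v hv _ => norm_one_div_one_sub_exp_le hv)
  obtain ⟨C₂, hC₂⟩ := exists_exp_bound_of_far (g := q) (x₁ := y - 1) (x₀ := x₀) one_pos
    (fun v _ _ hv => (differentiableAt_one_div_one_sub_exp (hne2 v hv)).continuousAt)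
    (fun v hv _ => norm_one_div_one_sub_exp_le hv)
  rw [← hankel_left_eq (θ₂ := Real.pi) one_pos
      (fun v _ hv => differentiableAt_one_div_one_sub_exp (hne1 v hv)) hC₁ fun φ _ => hcv φ,
    ← hankel_right_eq (θ₂ := -Real.pi) one_pos
      (fun v _ hv => differentiableAt_one_div_one_sub_exp (hne2 v hv)) hC₂ fun φ _ => hcv φ]
  have hper : ∀ s φ : ℝ, q (pt s (φ + 2 * Real.pi)) = q (pt s φ) := by
    intro s φ
    simp only [hq]
    rw [← Complex.exp_periodic ((y : ℂ) - pt s (φ + 2 * Real.pi))]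
    congr 3
    simp [pt]; ring
  have hray : horiz q x₀ Real.pi = horiz q x₀ (-Real.pi) := by
    unfold horiz
    congr 1
    ext s
    rw [← hper s (-Real.pi)]; congr 2; ring
  have hvert : vert q x₀ Real.pi (-Real.pi) = -(2 * Real.pi * Complex.I) := by
    have hp : Function.Periodic (fun φ : ℝ => Complex.I * q (pt x₀ φ)) (2 * Real.pi) := fun φ => by
      simp only [hper]
    have h1 := hp.intervalIntegral_add_eq (-Real.pi) 0
    have h2 : -Real.pi + 2 * Real.pi = Real.pi := by ring
    have hmem : Complex.exp y ∈ Metric.ball (0 : ℂ) (Real.exp x₀) := by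
      rw [mem_ball_zero_iff, Complex.norm_exp, Complex.ofReal_re]
      exact Real.exp_lt_exp.2 hx₀
    have h3 := circleIntegral.integral_sub_inv_of_mem_ball hmem
    rw [h2, zero_add] at h1
    unfold vert
    rw [intervalIntegral.integral_symm, h1, ← h3]
    congr 1
    unfold circleIntegral
    refine intervalIntegral.integral_congr fun φ _ => ?_
    have e1 : circleMap 0 (Real.exp x₀) φ = Complex.exp (pt x₀ φ) := by
      simp [circleMap, pt, Complex.exp_add]
    have e2 : Complex.exp ((y : ℂ) - pt x₀ φ) = Complex.exp y / Complex.exp (pt x₀ φ) :=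
      Complex.exp_sub _ _
    have e3 := Complex.exp_ne_zero (pt x₀ φ)
    simp only [hq, deriv_circleMap, smul_eq_mul, e1, e2]
    rw [one_sub_div e3, one_div_div]
    ring
  unfold hankel
  rw [hray, hvert]; ring

/-- The residue at the simple pole `y`, the only zero of the denominator in the strip. After `f y`
is subtracted from `f` the quotient is a ratio of two `dslope`s, holomorphic and decaying, with
integral zero; the constant `f y` gives the previous integral. -/
theorem hankel_div_one_sub_exp {f : ℂ → ℂ} {θ₂ D : ℝ} (hx₀ : y < x₀) (hη : 0 < η)
    (hθ₂ : η < θ₂) (hθπ : θ₂ < Real.pi)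
    (hf : ∀ v : ℂ, |v.im| < θ₂ → DifferentiableAt ℂ f v) (hfb : ∀ v : ℂ, |v.im| ≤ η → ‖f v‖ ≤ D) :
    hankel (fun v => f v * (1 / (1 - Complex.exp (y - v)))) x₀ η (-η) =
      -(2 * Real.pi * Complex.I) * f y := by
  have hπ := Real.pi_pos
  set q : ℂ → ℂ := fun v => 1 / (1 - Complex.exp (y - v)) with hq
  set ψ : ℂ → ℂ := fun v => 1 - Complex.exp (y - v) with hψ
  have hψy : ψ y = 0 := by simp [hψ]
  set S : Set ℂ := {v | |v.im| < θ₂} with hS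
  have hSo : IsOpen S := isOpen_lt (by fun_prop) continuous_const
  have hyS : (y : ℂ) ∈ S := by simp [hS]; linarith
  have hψne : ∀ v ∈ S, v ≠ y → ψ v ≠ 0 := by
    intro v hv hvy h0
    obtain ⟨n, hn⟩ := Complex.exp_eq_one_iff.1 (sub_eq_zero.1 h0).symm
    by_cases him : v.im = 0
    · have h1 := congrArg norm (sub_eq_zero.1 h0)
      rw [Complex.norm_exp, norm_one, eq_comm, Real.exp_eq_one_iff] at h1
      refine hvy (Complex.ext ?_ (by simpa using him))
      simp at h1
      simp; linarith
    · exact one_sub_exp_ne_zero him (hv.trans (by linarith)) h0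
  have hdψ : HasDerivAt ψ 1 y := by
    have h1 : HasDerivAt (fun v : ℂ => (y : ℂ) - v) (-1) y := (hasDerivAt_id _).const_sub _
    have h2 := (h1.cexp).const_sub 1
    simpa [hψ] using h2
  have hdsψ : ∀ v ∈ S, dslope ψ y v ≠ 0 := by
    intro v hv
    by_cases hvy : v = y
    · rw [hvy, dslope_same, hdψ.deriv]; exact one_ne_zero
    · rw [dslope_of_ne _ hvy, slope_def_field, hψy, sub_zero]
      exact div_ne_zero (hψne v hv hvy) (sub_ne_zero.2 hvy)
  have hfS : DifferentiableOn ℂ (dslope f y) S :=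
    (Complex.differentiableOn_dslope (hSo.mem_nhds hyS)).2 fun v hv => (hf v hv).differentiableWithinAt
  have hψS : DifferentiableOn ℂ (dslope ψ y) S :=
    (Complex.differentiableOn_dslope (hSo.mem_nhds hyS)).2 (by
      intro v _; exact DifferentiableAt.differentiableWithinAt (by fun_prop))
  set Q : ℂ → ℂ := fun v => dslope f y v / dslope ψ y v with hQ
  have hQd : ∀ v ∈ S, DifferentiableAt ℂ Q v := fun v hv =>
    (hfS.differentiableAt (hSo.mem_nhds hv)).div (hψS.differentiableAt (hSo.mem_nhds hv)) (hdsψ v hv)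
  have hQe : ∀ v : ℂ, v ≠ y → Q v = (f v - f y) * q v := by
    intro v hvy
    simp only [hQ, hq]
    rw [dslope_of_ne _ hvy, dslope_of_ne _ hvy, slope_def_field, slope_def_field, hψy, sub_zero,
      div_div_div_cancel_right₀ (sub_ne_zero.2 hvy), div_eq_mul_one_div]
  have hin : ∀ φ, φ ∈ uIcc η (-η) → |φ| ≤ η := by
    intro φ hφ
    rw [uIcc_of_ge (by linarith)] at hφ
    exact abs_le.2 hφ
  have hinS : ∀ v : ℂ, v.im ∈ uIcc η (-η) → v ∈ S := fun v hv => (hin _ hv).trans_lt hθ₂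
  obtain ⟨C, hC⟩ := exists_exp_bound_of_far (g := Q) (x₁ := y - 1) (x₀ := x₀) (θ := η) (θ' := -η)
    (C := 2 * D * (2 * Real.exp (-y))) one_pos
    (fun v _ _ hv => (hQd v (hinS v hv)).continuousAt) (fun v hv hv' => by
      have hvy : v ≠ y := fun h => by rw [h, Complex.ofReal_re] at hv; linarith
      have h1 := hfb v (hin _ hv')
      have h2 := hfb y (by simpa using hη.le)
      have h3 : ‖f v - f y‖ ≤ 2 * D := (norm_sub_le _ _).trans (by linarith)
      rw [hQe v hvy, norm_mul]
      calc _ ≤ (2 * D) * (2 * Real.exp (-y) * Real.exp (1 * v.re)) :=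
            mul_le_mul h3 (norm_one_div_one_sub_exp_le hv) (norm_nonneg _)
              ((norm_nonneg _).trans h3)
        _ = _ := by ring)
  have hQ0 : hankel Q x₀ η (-η) = 0 :=
    hankel_eq_zero one_pos (fun v _ hv => hQd v (hinS v hv)) hC
  have hqc : ∀ v : ℂ, v ∈ S → v ≠ y → ContinuousAt q v := fun v hv hvy =>
    (differentiableAt_one_div_one_sub_exp (hψne v hv hvy)).continuousAt
  have hney : ∀ s φ : ℝ, φ ≠ 0 → pt s φ ≠ (y : ℂ) := fun s φ hφ h => hφ (by
    have := congrArg Complex.im h; simpa using this)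
  have hneyx : ∀ φ : ℝ, pt x₀ φ ≠ (y : ℂ) := fun φ h => by
    have := congrArg Complex.re h
    simp at this; linarith
  have hqi : ∀ φ ∈ uIcc η (-η), φ ≠ 0 → IntegrableOn (fun s => f y * q (pt s φ)) (Iic x₀) := by
    intro φ hφ hφ0
    obtain ⟨C', hC'⟩ := exists_exp_bound_of_far (g := q) (x₁ := y - 1) (x₀ := x₀) (θ := φ) (θ' := φ)
      one_pos (fun v _ _ hv => hqc v (hinS v (by
          rw [uIcc_self, mem_singleton_iff] at hv; rw [hv]; exact hφ)) (fun h => by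
          rw [uIcc_self, mem_singleton_iff] at hv
          rw [h, Complex.ofReal_im] at hv; exact hφ0 hv.symm))
      (fun v hv _ => norm_one_div_one_sub_exp_le hv)
    refine Integrable.const_mul (integrableOn_of_exp_bound one_pos (C := C') (fun s _ => ?_)
      fun s hs => ?_) _
    · exact hqc _ (hinS _ (by simpa using hφ)) (hney s φ hφ0)
    · simpa using hC' (pt s φ) (by simpa using hs) (by simp)
  have hQi : ∀ φ ∈ uIcc η (-η), IntegrableOn (fun s => Q (pt s φ)) (Iic x₀) := fun φ hφ =>
    integrableOn_of_exp_bound one_pos (C := C)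
      (fun s _ => (hQd _ (hinS _ (by simpa using hφ))).continuousAt)
      (fun s hs => by simpa using hC (pt s φ) (by simpa using hs) (by simpa using hφ))
  have hη0 : -η ≠ 0 := by linarith
  have hsplit : ∀ v : ℂ, v ≠ y → f v * q v = Q v + f y * q v := fun v hv => by
    rw [hQe v hv]; ring
  rw [hankel_congr (h := fun v => Q v + f y * q v) (fun s _ => hsplit _ (hney s _ hη.ne'))
    (fun s _ => hsplit _ (hney s _ hη0)) (fun φ _ => hsplit _ (hneyx φ)),
    hankel_add (h := fun v => f y * q v) (hQi _ left_mem_uIcc) (hQi _ right_mem_uIcc) (hqi _ left_mem_uIcc hη.ne')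
      (hqi _ right_mem_uIcc hη0) (fun φ hφ => (hQd _ (hinS _ (by simpa using hφ))).continuousAt)
      (fun φ hφ => continuousAt_const.mul (hqc _ (hinS _ (by simpa using hφ)) (hneyx φ))),
    hQ0, hankel_const_mul, hankel_one_div_one_sub_exp hx₀ hη (hθ₂.trans hθπ)]
  ring

end residue

/-! ### The acceleration kernel and the Laplace transform -/

theorem integral_mul_swap {ν : Measure ℝ} [SFinite ν] {k : ℝ → ℝ → ℂ} {h : ℝ → ℂ} {A : ℝ → ℝ}
    (hk : Continuous fun p : ℝ × ℝ => k p.1 p.2) (hA : Integrable A) (hh : Integrable h ν)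
    (hb : ∀ s σ, ‖k s σ‖ ≤ A s) :
    Integrable (fun s => ∫ σ, k s σ * h σ ∂ν) ∧
      ∫ s, ∫ σ, k s σ * h σ ∂ν = ∫ σ, (∫ s, k s σ) * h σ ∂ν := by
  have hint : Integrable (fun p : ℝ × ℝ => k p.1 p.2 * h p.2) (volume.prod ν) := by
    refine (hA.mul_prod hh.norm).mono' (hk.aestronglyMeasurable.mul
      hh.aestronglyMeasurable.comp_snd) (Eventually.of_forall fun p => ?_)
    rw [norm_mul]
    gcongr
    exact hb _ _
  refine ⟨hint.integral_prod_left, ?_⟩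
  rw [integral_integral_swap (f := fun s σ => k s σ * h σ) hint]
  simp_rw [integral_mul_const]

section
variable {M₁ M₂ : ℕ → ℝ} {ω₁ ω₂ : ℝ} {e₁ e₂ : ℂ → ℂ}

theorem integrable_norm_mul_borelKernel (hM₁ : IsRegularSeq M₁) (hω₁ : 0 < ω₁)
    (h₁ : KernelBound M₁ ω₁ e₁) (hpos : ∀ s : ℝ, ∃ y : ℝ, 0 < y ∧ e₁ (pt s 0) = y)
    {x y : ℝ} (hxy : y < x) :
    Integrable fun s : ℝ => ‖e₁ (pt (s - y) 0)‖ * ‖borelKernel e₁ (Complex.exp (s - x))‖ := by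
  simp_rw [← norm_mul]
  refine Integrable.norm ?_
  -- A non-integrable function would have integral 0 by convention, but the value found for this
  -- integral is not 0.
  by_contra h
  have h1 := integral_mul_borelKernel hM₁ hω₁ h₁ hpos (y := y) (v := x) (by simpa using hxy)
  rw [integral_undef h] at h1
  exact one_div_ne_zero (one_sub_exp_ne_zero_of_re (y := y) (v := x) (by simpa using hxy)) h1.symm

/-- The Laplace transform with kernel `e₁` of the acceleration kernel is `e₂`. -/
theorem integral_mul_accelKernel (hω₁ : 0 < ω₁) (hlt : ω₁ < ω₂) (hω₂ : ω₂ < 2)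
    (hM₁ : IsRegularSeq M₁) (hM₂ : IsRegularSeq M₂) (h₁ : KernelBound M₁ ω₁ e₁)
    (h₂ : KernelBound M₂ ω₂ e₂) (hpos : ∀ s : ℝ, ∃ y : ℝ, 0 < y ∧ e₁ (pt s 0) = y)
    (hent : ∀ z : ℂ, Summable fun n : ℕ => z ^ n / moment e₁ n)
    (hE : BorelBound ω₁ (borelKernel e₁)) (y : ℝ) :
    ∫ s : ℝ, e₁ (pt (s - y) 0) * accelKernel ω₁ ω₂ e₁ e₂ (pt (-s) 0) = e₂ (pt (-y) 0) := by
  have hπ := Real.pi_pos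
  have h0 : 0 < ω₁ * Real.pi / 2 := by positivity
  have hd0 : 0 < (ω₂ - ω₁) * Real.pi / 2 := by
    have : 0 < ω₂ - ω₁ := by linarith
    positivity
  obtain ⟨η', θ₂, hη', hθ₂, hb⟩ := exists_accelEta_bounds hω₁ hlt hω₂ hd0 le_rfl
  obtain ⟨hb1, hb2, hb3⟩ := hb 0 (by simp)
  set η := accelEta ω₁ ω₂ 0 with hη
  rw [abs_zero, zero_add] at hb3
  have hη1 : ω₁ * Real.pi / 2 < η := hη'.trans_le hb1
  have hη2 : η < 2 * Real.pi - ω₁ * Real.pi / 2 := by linarith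
  have hη0 : 0 < η := h0.trans hη1
  have hηω : η < ω₂ * Real.pi / 2 := hb3.trans_lt hθ₂
  have hωπ : ω₂ * Real.pi / 2 < Real.pi := by nlinarith
  -- The arc must lie beyond the pole `v = y`. All points `pt (-s) 0` have argument 0, so one path,
  -- with half-opening `η` and arc at `x₀`, serves for every `s`.
  obtain ⟨x₀, hx₀⟩ := exists_gt y
  obtain ⟨b, hbp, hEb⟩ := hE.bound
  obtain ⟨C, hC, hCb⟩ := hEb η hη1
  obtain ⟨C₂, b₂, hb₂, hC₂⟩ := h₂.norm_exp_mul_le hM₂ hηω 0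
  simp only [Nat.cast_zero, zero_mul, Complex.exp_zero, one_mul] at hC₂
  have hC₂0 : 0 ≤ C₂ := by
    have := (norm_nonneg _).trans (hC₂ 0 (by simpa using hη0.le))
    simpa using this
  set g : ℂ → ℂ := fun v => e₂ (-v) with hg
  have hgd : ∀ v : ℂ, |v.im| < ω₂ * Real.pi / 2 → DifferentiableAt ℂ g v := fun v hv =>
    (h₂.differentiableAt (w := -v) (by simpa using hv)).comp v (f := fun v => -v) (by fun_prop)
  have hgb : ∀ v : ℂ, |v.im| ≤ η → ‖g v‖ ≤ C₂ * Real.exp (-b₂ * |v.re|) := fun v hv => by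
    simpa using hC₂ (-v) (by simpa using hv)
  have hgi : ∀ θ, |θ| = η → IntegrableOn (fun s => g (pt s θ)) (Iic x₀) := fun θ hθ => by
    refine Integrable.integrableOn (Integrable.mono' ((integrable_exp_neg_mul_abs hb₂ 0).const_mul C₂)
      ?_ (Eventually.of_forall fun s => ?_))
    · refine Continuous.aestronglyMeasurable ?_
      rw [← continuousOn_univ]
      exact continuousOn_comp_pt fun s _ => (hgd _ (by rw [pt_im, hθ]; exact hηω)).continuousAt
    · simpa using hgb (pt s θ) (by rw [pt_im, hθ])
  have hEc := hE.diff.continuous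
  have hec : Continuous fun s : ℝ => e₁ (pt (s - y) 0) := h₁.continuous_sub hω₁ y
  obtain ⟨k, hk⟩ : ∃ k : ℂ → ℝ → ℂ, ∀ v s, k v s =
    e₁ (pt (s - y) 0) * borelKernel e₁ (Complex.exp (s - v)) := ⟨_, fun _ _ => rfl⟩
  have hk1 : ∀ v : ℂ, |v.im| = η → ∫ s, k v s = 1 / (1 - Complex.exp (y - v)) := fun v hv => by
    simp_rw [hk]
    exact integral_mul_borelKernel_of_im hM₁ hω₁ h₁ hE hpos (by linarith)
      (by linarith)
  have hk2 : ∀ φ, ∫ s, k (pt x₀ φ) s = 1 / (1 - Complex.exp (y - pt x₀ φ)) := fun φ => by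
    simp_rw [hk]
    exact integral_mul_borelKernel hM₁ hω₁ h₁ hpos (by simpa using hx₀)
  have hkc : ∀ γ : ℝ → ℂ, Continuous γ → Continuous fun p : ℝ × ℝ => k (γ p.2) p.1 := by
    intro γ hγ
    simp_rw [hk]
    refine (hec.comp continuous_fst).mul (hEc.comp ?_)
    fun_prop
  have hray : ∀ θ, |θ| = η → Integrable (fun s => ∫ σ in Iic x₀, k (pt σ θ) s * g (pt σ θ)) ∧
      ∫ s, ∫ σ in Iic x₀, k (pt σ θ) s * g (pt σ θ) =
        ∫ σ in Iic x₀, g (pt σ θ) * (1 / (1 - Complex.exp (y - pt σ θ))) := by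
    intro θ hθ
    obtain ⟨i1, i2⟩ := integral_mul_swap (ν := volume.restrict (Iic x₀))
      (k := fun s σ => k (pt σ θ) s) (A := fun s => ‖e₁ (pt (s - y) 0)‖ * C)
      (hkc _ (continuous_pt_left θ)) ((integrable_kernel_sub hM₁ hω₁ h₁ y).mul_const C) (hgi θ hθ)
      (fun s σ => by
        have hi : |((s : ℂ) - pt σ θ).im| = η := by simpa using hθ
        have := hCb 0 le_rfl hbp.le (s - pt σ θ) hi.ge (by rw [hi]; linarith)
        rw [hk, norm_mul]
        gcongr
        simpa using this)
    refine ⟨i1, i2.trans ?_⟩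
    congr 1
    ext σ
    rw [hk1 _ (by rw [pt_im, hθ]), mul_comm]
  obtain ⟨i1, j1⟩ := hray η (abs_of_pos hη0)
  obtain ⟨i3, j3⟩ := hray (-η) (by rw [abs_neg, abs_of_pos hη0])
  have hle : -η ≤ η := by linarith
  have harc : IntegrableOn (fun φ => Complex.I * g (pt x₀ φ)) (Ioc (-η) η) :=
    (intervalIntegrable_iff_integrableOn_Ioc_of_le hle).1 (intervalIntegrable_vert fun φ hφ =>
      (hgd _ (by
        rw [uIcc_of_le hle] at hφ
        rw [pt_im]; exact (abs_le.2 hφ).trans_lt hηω)).continuousAt)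
  -- On the arc `E` need not be bounded in `s`; it is dominated by its values on the positive axis,
  -- whose product with `e₁` is integrable because `y < x₀`.
  obtain ⟨i2, j2⟩ := integral_mul_swap (ν := volume.restrict (Ioc (-η) η))
      (k := fun s φ => k (pt x₀ φ) s) (hkc _ (continuous_pt_right x₀))
      (integrable_norm_mul_borelKernel hM₁ hω₁ h₁ hpos hx₀) harc (fun s φ => by
        rw [hk, norm_mul]
        gcongr
        refine (norm_borelKernel_le hM₁ hω₁ h₁ hpos hent _).trans (le_of_eq ?_)
        rw [Complex.norm_exp, Complex.ofReal_exp]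
        simp)
  have hsplit : ∀ s : ℝ, e₁ (pt (s - y) 0) * accelKernel ω₁ ω₂ e₁ e₂ (pt (-s) 0) =
      (-1 / (2 * Real.pi * Complex.I)) * ((∫ σ in Iic x₀, k (pt σ η) s * g (pt σ η)) +
        -(∫ φ in Ioc (-η) η, k (pt x₀ φ) s * (Complex.I * g (pt x₀ φ))) -
          ∫ σ in Iic x₀, k (pt σ (-η)) s * g (pt σ (-η))) := by
    intro s
    have hneg : -pt (-s) 0 = s := by simp [pt]
    rw [accelKernel_eq_hankel hω₁ hlt hω₂ hM₂ hE h₂ (by simpa using hd0) x₀]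
    simp only [hankel, horiz, vert, accelIntegrand, pt_im, neg_zero, zero_add, zero_sub, hneg,
      intervalIntegral.integral_of_ge hle, hk, mul_assoc, integral_const_mul, ← hη, hg]
    simp only [mul_left_comm _ Complex.I, integral_const_mul]
    ring
  simp_rw [hsplit]
  have hlin : ∀ A B D : ℝ → ℂ, Integrable A → Integrable B → Integrable D →
      ∫ s, A s + -B s - D s = (∫ s, A s) + -(∫ s, B s) - ∫ s, D s := fun A B D hA hB hD => by
    rw [integral_sub (f := fun s => A s + -B s) (hA.add hB.neg) hD,
      integral_add (g := fun s => -B s) hA hB.neg, integral_neg]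
  rw [integral_const_mul, hlin _ _ _ i1 i2 i3, j1, j2, j3]
  have hres := hankel_div_one_sub_exp (f := g) (θ₂ := (η + ω₂ * Real.pi / 2) / 2) (D := C₂) hx₀ hη0
    (by linarith) (by linarith) (fun v hv => hgd v (by linarith)) (fun v hv => by
      refine (hgb v hv).trans (mul_le_of_le_one_right hC₂0 (Real.exp_le_one_iff.2 ?_))
      have := abs_nonneg v.re
      nlinarith)
  simp only [hankel, horiz, vert, intervalIntegral.integral_of_ge hle] at hres
  simp_rw [hk2]
  have h2 : ∀ φ, 1 / (1 - Complex.exp (y - pt x₀ φ)) * (Complex.I * g (pt x₀ φ)) =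
    Complex.I * (g (pt x₀ φ) * (1 / (1 - Complex.exp (y - pt x₀ φ)))) := fun φ => by ring
  simp_rw [h2]
  rw [hres]
  have hpi : (Real.pi : ℂ) ≠ 0 := by exact_mod_cast hπ.ne'
  have : g y = e₂ (pt (-y) 0) := by simp [hg, pt]
  rw [this]
  field_simp

/-- In logarithmic coordinates `integral_mul_accelKernel` says that `e₂` is a convolution of `e₁ ◁
e₂` with `e₁`. The weight `exp (p s)` is multiplicative, and the integral of a convolution is the
product of the integrals. -/
theorem moment_accelKernel_mul (hω₁ : 0 < ω₁) (hlt : ω₁ < ω₂) (hω₂ : ω₂ < 2)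
    (hM₁ : IsRegularSeq M₁) (hM₂ : IsRegularSeq M₂) (hN : IsRegularSeq (M₂ / M₁))
    (h₁ : KernelBound M₁ ω₁ e₁)
    (h₂ : KernelBound M₂ ω₂ e₂) (hpos : ∀ s : ℝ, ∃ y : ℝ, 0 < y ∧ e₁ (pt s 0) = y)
    (hent : ∀ z : ℂ, Summable fun n : ℕ => z ^ n / moment e₁ n)
    (hE : BorelBound ω₁ (borelKernel e₁))
    (ha : KernelBound (M₂ / M₁) (ω₂ - ω₁) (accelKernel ω₁ ω₂ e₁ e₂)) (p : ℕ) :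
    moment (accelKernel ω₁ ω₂ e₁ e₂) p * moment e₁ p = moment e₂ p := by
  have hπ := Real.pi_pos
  have hd : 0 < ω₂ - ω₁ := by linarith
  set acc := accelKernel ω₁ ω₂ e₁ e₂ with hacc
  have ia := ha.integrable_exp_mul hN (θ := 0) (by rw [abs_zero]; positivity) p
  have i1 := h₁.integrable_exp_mul hM₁ (θ := 0) (by rw [abs_zero]; positivity) p
  have hconv := integral_convolution (μ := volume) (ν := volume) (ContinuousLinearMap.mul ℂ ℂ) ia i1
  rw [moment_nat_eq acc, moment_nat_eq e₁, moment_nat_eq e₂]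
  simp only [ContinuousLinearMap.mul_apply'] at hconv
  rw [← hconv]
  congr 1
  ext x
  rw [convolution_def]
  have key := integral_mul_accelKernel hω₁ hlt hω₂ hM₁ hM₂ h₁ h₂ hpos hent hE (-x)
  rw [neg_neg] at key
  rw [← key, ← integral_const_mul, ← integral_neg_eq_self]
  congr 1
  ext t
  simp only [ContinuousLinearMap.mul_apply', ← hacc]
  have : Complex.exp (p * pt x 0) =
      Complex.exp (p * pt (-t) 0) * Complex.exp (p * pt (x - -t) 0) := by
    rw [← Complex.exp_add]; congr 1; simp [pt]; ring
  rw [this, show t - -x = x - -t by ring]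
  ring

end

/-! ### Asymptotic expansions -/

/-- Growth of a polynomial that is bounded on a disc. -/
theorem norm_sum_mul_pow_le {a : ℕ → ℂ} {p : ℕ} {z₀ : ℂ} {r X : ℝ} (hr : 0 < r)
    (h : ∀ z, ‖z - z₀‖ ≤ r → ‖∑ n ∈ Finset.range p, a n * z ^ n‖ ≤ X) (z : ℂ) :
    ‖∑ n ∈ Finset.range p, a n * z ^ n‖ ≤ X * (1 + ‖z - z₀‖ / r) ^ p := by
  have hX : 0 ≤ X := (norm_nonneg _).trans (h z₀ (by simpa using hr.le))
  have hq : 0 ≤ ‖z - z₀‖ / r := by positivity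
  rcases le_total ‖z - z₀‖ r with hz | hz
  · exact (h z hz).trans (le_mul_of_one_le_right hX (one_le_pow₀ (by linarith)))
  have hz0 : z - z₀ ≠ 0 := norm_pos_iff.1 (hr.trans_le hz)
  have hrc : (r : ℂ) ≠ 0 := by exact_mod_cast hr.ne'
  -- The Bernstein-Walsh argument: `ξ ^ p P(z₀ + r / ξ)` is a polynomial in `ξ`, because `P` has
  -- degree below `p`. The maximum principle on the unit disc turns the bound on `|z - z₀| = r` into
  -- a growth bound outside that circle.
  set g : ℂ → ℂ := fun ξ => ∑ n ∈ Finset.range p, a n * (z₀ * ξ + r) ^ n * ξ ^ (p - n) with hg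
  have hge : ∀ ξ, ξ ≠ 0 → g ξ = ξ ^ p * ∑ n ∈ Finset.range p, a n * (z₀ + r / ξ) ^ n := by
    intro ξ hξ
    rw [hg, Finset.mul_sum]
    refine Finset.sum_congr rfl fun n hn => ?_
    have h1 : z₀ * ξ + r = (z₀ + r / ξ) * ξ := by field_simp
    have h2 : ξ ^ p = ξ ^ n * ξ ^ (p - n) := by
      rw [← pow_add, Nat.add_sub_cancel' (Finset.mem_range.1 hn).le]
    rw [h1, mul_pow, h2]; ring
  have hgd : Differentiable ℂ g := by fun_prop
  have hgb : ∀ ξ ∈ closure (Metric.ball (0 : ℂ) 1), ‖g ξ‖ ≤ X := by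
    intro ξ hξ
    refine Complex.norm_le_of_forall_mem_frontier_norm_le Metric.isBounded_ball hgd.diffContOnCl
      (fun ξ hξ => ?_) hξ
    rw [frontier_ball _ one_ne_zero, mem_sphere_zero_iff_norm] at hξ
    have hξ0 : ξ ≠ 0 := norm_pos_iff.1 (by rw [hξ]; exact one_pos)
    rw [hge ξ hξ0, norm_mul, norm_pow, hξ, one_pow, one_mul]
    refine h _ ?_
    rw [add_sub_cancel_left, norm_div, hξ, div_one, Complex.norm_real, Real.norm_eq_abs,
      abs_of_pos hr]
  have hξ0 : (r : ℂ) / (z - z₀) ≠ 0 := div_ne_zero hrc hz0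
  have hnξ : ‖(r : ℂ) / (z - z₀)‖ = r / ‖z - z₀‖ := by
    rw [norm_div, Complex.norm_real, Real.norm_eq_abs, abs_of_pos hr]
  have h1 := hgb (r / (z - z₀)) (by
    rw [closure_ball _ one_ne_zero, mem_closedBall_zero_iff, hnξ]
    exact div_le_one_of_le₀ hz (norm_nonneg _))
  rw [hge _ hξ0, div_div_cancel₀ hrc, add_sub_cancel, norm_mul, norm_pow, hnξ] at h1
  have hpos : 0 < r / ‖z - z₀‖ := div_pos hr (hr.trans_le hz)
  have h2 := (le_div_iff₀' (pow_pos hpos p)).2 h1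
  calc _ ≤ X / (r / ‖z - z₀‖) ^ p := h2
    _ = X * (‖z - z₀‖ / r) ^ p := by rw [div_eq_mul_inv, ← inv_pow, inv_div]
    _ ≤ _ := by gcongr; linarith

/-- The points of the plane near `exp (i d)` have logarithms near `i d`. -/
theorem exists_log_near (d : ℝ) {ε : ℝ} (hε : 0 < ε) :
    ∃ r : ℝ, 0 < r ∧ ∀ z : ℂ, ‖z - Complex.exp (d * Complex.I)‖ ≤ r →
      ∃ w : ℂ, Complex.exp w = z ∧ |w.re| < ε ∧ |w.im - d| < ε := by
  set z₀ := Complex.exp (d * Complex.I) with hz₀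
  have hz₀0 : z₀ ≠ 0 := Complex.exp_ne_zero _
  have hn : ‖z₀‖ = 1 := Complex.norm_exp_ofReal_mul_I d
  have hc : ContinuousAt Complex.log 1 := continuousAt_clog (by simp)
  obtain ⟨δ, hδ, hball⟩ := Metric.continuousAt_iff.1 hc ε hε
  refine ⟨min (δ / 2) (1 / 2), by positivity, fun z hz => ?_⟩
  have h1 : ‖z / z₀ - 1‖ ≤ min (δ / 2) (1 / 2) := by
    rwa [div_sub_one hz₀0, norm_div, hn, div_one]
  have h2 : z / z₀ ≠ 0 := fun h0 => by
    rw [h0, zero_sub, norm_neg, norm_one] at h1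
    linarith [h1.trans (min_le_right _ _)]
  have h3 := hball (x := z / z₀) (by
    rw [dist_eq_norm]; linarith [h1.trans (min_le_left _ _)])
  rw [Complex.log_one, dist_zero_right] at h3
  refine ⟨d * Complex.I + Complex.log (z / z₀), ?_, ?_, ?_⟩
  · rw [Complex.exp_add, Complex.exp_log h2, ← hz₀, mul_div_cancel₀ _ hz₀0]
  · simpa using (Complex.abs_re_le_norm _).trans_lt h3
  · simpa using (Complex.abs_im_le_norm _).trans_lt h3

/-- For `|z| ≤ 1` this is the expansion. For `|z| ≥ 1` the function is bounded by its growth,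
absorbed into `A ^ p * M' p` through `B ^ p ≤ M' p`. The partial sum is bounded on a disc by
comparing it with `f`, and from there by `norm_sum_mul_pow_le`; bounds of the single coefficients
would not do, since nothing compares `M' n` with `M' p` for `n < p`. -/
theorem MemGrowth.exists_remainder_bound {N M' : ℕ → ℝ} {d α B : ℝ} {f : ℂ → ℂ}
    {fhat : PowerSeries ℂ} (hN : IsRegularSeq N) (hα : 0 < α) (hM' : ∀ p, 0 < M' p) (hB : 0 < B)
    (hBM : ∀ p, B ^ p ≤ M' p) (hf : MemGrowth N (sector d α) f)
    (hfe : HasAsymptoticExpansion M' (sector d α) f fhat) {θ : ℝ} (hθ : θ < α * Real.pi / 2) :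
    ∃ C A k : ℝ, 0 < C ∧ 0 < A ∧ 0 < k ∧ ∀ p : ℕ, ∀ w : ℂ, |w.im - d| ≤ θ →
      ‖f w - ∑ n ∈ Finset.range p, PowerSeries.coeff n fhat * Complex.exp w ^ n‖ ≤
        C * A ^ p * M' p * Real.exp (p * w.re) / hFun N (k * Real.exp (-w.re)) := by
  have hπ := Real.pi_pos
  obtain ⟨β, hβ, hβα, hθβ⟩ := exists_opening_between hα hθ
  obtain ⟨C, A, hC, hA, hexp⟩ := hfe.2 _ (isBddProperSubsector_of_lt (d := d) (r := 2) hβ two_pos hβα)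
  obtain ⟨c, k, hc, hk, hfb⟩ := hf.bound hN hα hθ
  -- The disc is so small that its points have a logarithm in the sector of opening `β` and radius
  -- 2, where the expansion is uniform.
  obtain ⟨r, hr, hlog⟩ := exists_log_near d (ε := min (Real.log 2) (β * Real.pi / 2))
    (lt_min (Real.log_pos one_lt_two) (by positivity))
  set a : ℕ → ℂ := fun n => PowerSeries.coeff n fhat with ha
  set z₀ := Complex.exp (d * Complex.I) with hz₀
  have hn₀ : ‖z₀‖ = 1 := Complex.norm_exp_ofReal_mul_I d
  have hBp : ∀ p, 1 ≤ (1 / B) ^ p * M' p := fun p => by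
    calc (1 : ℝ) = (1 / B) ^ p * B ^ p := by rw [← mul_pow, one_div_mul_cancel hB.ne', one_pow]
      _ ≤ _ := by gcongr; exact hBM p
  set A₁ := 1 / B + 2 * A with hA₁
  have hA₁0 : 0 < A₁ := by positivity
  set C₁ := C * M' 0 + C with hC₁
  have hC₁0 : 0 < C₁ := by have := hM' 0; positivity
  have hB1 : 1 / B ≤ A₁ := by rw [hA₁]; linarith
  have hB2 : 2 * A ≤ A₁ := by
    have : 0 < 1 / B := by positivity
    linarith
  have hdisc : ∀ p z, ‖z - z₀‖ ≤ r → ‖∑ n ∈ Finset.range p, a n * z ^ n‖ ≤ C₁ * A₁ ^ p * M' p := by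
    intro p z hz
    obtain ⟨w, rfl, hw1, hw2⟩ := hlog z hz
    have hwm : modulus w < 2 := by
      rw [modulus, ← Real.lt_log_iff_exp_lt two_pos]
      exact (le_abs_self _).trans_lt (hw1.trans_le (min_le_left _ _))
    have hwT : w ∈ bddSector d β 2 := ⟨hw2.trans_le (min_le_right _ _), hwm⟩
    have h0 := hexp 0 w hwT
    have hp := hexp p w hwT
    simp only [Finset.range_zero, Finset.sum_empty, sub_zero, pow_zero, mul_one] at h0
    have hm0 : 0 < modulus w := Real.exp_pos _
    calc ‖∑ n ∈ Finset.range p, a n * Complex.exp w ^ n‖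
        = ‖f w - (f w - ∑ n ∈ Finset.range p, a n * Complex.exp w ^ n)‖ := by rw [sub_sub_cancel]
      _ ≤ ‖f w‖ + ‖f w - ∑ n ∈ Finset.range p, a n * Complex.exp w ^ n‖ := norm_sub_le _ _
      _ ≤ C * M' 0 + C * A ^ p * M' p * modulus w ^ p := add_le_add h0 hp
      _ ≤ C * M' 0 * ((1 / B) ^ p * M' p) + C * A ^ p * M' p * 2 ^ p := by
          have := hM' 0
          have := hM' p
          exact add_le_add (le_mul_of_one_le_right (by positivity) (hBp p)) (by gcongr)
      _ = C * M' 0 * (1 / B) ^ p * M' p + C * (2 * A) ^ p * M' p := by rw [mul_pow]; ring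
      _ ≤ C * M' 0 * A₁ ^ p * M' p + C * A₁ ^ p * M' p := by
          have := hM' 0
          have := hM' p
          gcongr
      _ = _ := by rw [hC₁]; ring
  set A₂ := A₁ * (1 + 2 / r) with hA₂
  have hA₁₂ : A₁ ≤ A₂ := le_mul_of_one_le_right hA₁0.le (by
    have : 0 < 2 / r := by positivity
    linarith)
  refine ⟨C + (c + C₁), A₂, k, by positivity, by positivity, hk, fun p w hw => ?_⟩
  have hMp := hM' p
  have hh0 : 0 < hFun N (k * Real.exp (-w.re)) := hN.hFun_pos (by positivity)
  have hh1 : hFun N (k * Real.exp (-w.re)) ≤ 1 := hN.hFun_le_one (by positivity)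
  have hpow : modulus w ^ p = Real.exp (p * w.re) := by rw [modulus, ← Real.exp_nat_mul]
  rw [le_div_iff₀ hh0]
  rcases le_total w.re 0 with h0 | h0
  · have hwT : w ∈ bddSector d β 2 := ⟨hw.trans_lt hθβ, by
      have := Real.exp_le_one_iff.2 h0
      rw [modulus]; linarith⟩
    have hp := hexp p w hwT
    rw [hpow] at hp
    calc _ ≤ (C * A ^ p * M' p * Real.exp (p * w.re)) * 1 :=
          mul_le_mul hp hh1 hh0.le ((norm_nonneg _).trans hp)
      _ ≤ _ := by
          rw [mul_one]
          gcongr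
          · linarith
          · linarith
  · have h1 : 1 ≤ Real.exp w.re := Real.one_le_exp h0
    have hP := norm_sum_mul_pow_le hr (hdisc p) (Complex.exp w)
    have hP2 : 1 + ‖Complex.exp w - z₀‖ / r ≤ (1 + 2 / r) * Real.exp w.re := by
      have h2 : ‖Complex.exp w - z₀‖ ≤ 2 * Real.exp w.re := by
        refine (norm_sub_le _ _).trans ?_
        rw [hn₀, Complex.norm_exp]; linarith
      calc 1 + ‖Complex.exp w - z₀‖ / r ≤ Real.exp w.re + 2 * Real.exp w.re / r := by gcongr
        _ = _ := by ring
    have hP3 : ‖∑ n ∈ Finset.range p, a n * Complex.exp w ^ n‖ ≤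
        C₁ * A₂ ^ p * M' p * Real.exp (p * w.re) := by
      refine hP.trans ?_
      calc _ ≤ C₁ * A₁ ^ p * M' p * ((1 + 2 / r) * Real.exp w.re) ^ p := by gcongr
        _ = _ := by rw [hA₂, mul_pow, mul_pow, ← Real.exp_nat_mul]; ring
    have hfw : ‖f w‖ * hFun N (k * Real.exp (-w.re)) ≤ c * A₂ ^ p * M' p * Real.exp (p * w.re) := by
      refine ((le_div_iff₀ hh0).1 (hfb w hw)).trans ?_
      have e1 : 1 ≤ Real.exp (p * w.re) := Real.one_le_exp (by positivity)
      calc c ≤ c * (((1 / B) ^ p * M' p) * Real.exp (p * w.re)) :=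
            le_mul_of_one_le_right hc.le (one_le_mul_of_one_le_of_one_le (hBp p) e1)
        _ ≤ c * ((A₂ ^ p * M' p) * Real.exp (p * w.re)) := by
            gcongr
            exact hB1.trans hA₁₂
        _ = _ := by ring
    calc _ ≤ (‖f w‖ + ‖∑ n ∈ Finset.range p, a n * Complex.exp w ^ n‖) *
          hFun N (k * Real.exp (-w.re)) := by gcongr; exact norm_sub_le _ _
      _ = ‖f w‖ * hFun N (k * Real.exp (-w.re)) +
          ‖∑ n ∈ Finset.range p, a n * Complex.exp w ^ n‖ * hFun N (k * Real.exp (-w.re)) := by ring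
      _ ≤ c * A₂ ^ p * M' p * Real.exp (p * w.re) +
          C₁ * A₂ ^ p * M' p * Real.exp (p * w.re) * 1 := by gcongr
      _ = (c + C₁) * A₂ ^ p * M' p * Real.exp (p * w.re) := by ring
      _ ≤ _ := by gcongr ?_ * _ * _ * _; linarith

section
variable {N : ℕ → ℝ} {ω d α : ℝ} {e f : ℂ → ℂ}

theorem KernelBound.integral_mul_pow (hN : IsRegularSeq N) (he : KernelBound N ω e) {τ : ℝ} {w : ℂ}
    (hw : |w.im - τ| < ω * Real.pi / 2) (n : ℕ) :
    Integrable (fun s => e (pt s τ - w) * Complex.exp (pt s τ) ^ n) ∧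
      ∫ s, e (pt s τ - w) * Complex.exp (pt s τ) ^ n = moment e n * Complex.exp w ^ n := by
  have hφ : |τ - w.im| < ω * Real.pi / 2 := by rwa [abs_sub_comm]
  have h1 : (fun s => e (pt s τ - w) * Complex.exp (pt s τ) ^ n) = fun s =>
      (fun s => Complex.exp (n * pt s (τ - w.im)) * e (pt s (τ - w.im))) (s - w.re) *
        Complex.exp w ^ n := by
    ext s
    have e1 : pt s τ - w = pt (s - w.re) (τ - w.im) := by apply Complex.ext <;> simp
    have e2 : Complex.exp (pt s τ) =
        Complex.exp (pt (s - w.re) (τ - w.im)) * Complex.exp w := by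
      rw [← Complex.exp_add, ← e1, sub_add_cancel]
    rw [e2, e1, mul_pow]
    simp only [Complex.exp_nat_mul]
    ring
  rw [h1]
  refine ⟨((he.integrable_exp_mul hN hφ n).comp_sub_right w.re).mul_const _, ?_⟩
  rw [integral_mul_const, integral_sub_right_eq_self
    (fun s => Complex.exp (n * pt s (τ - w.im)) * e (pt s (τ - w.im))), he.moment_eq hN hφ]

/-- The Laplace transform of a function with an asymptotic expansion. -/
theorem KernelBound.exists_laplaceBound_and_expansion {M' : ℕ → ℝ} {B : ℝ} {fhat : PowerSeries ℂ}
    (hN : IsRegularSeq N) (hα : 0 < α) (hω : 0 < ω) (he : KernelBound N ω e)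
    (hM' : ∀ p, 0 < M' p) (hB : 0 < B) (hBM : ∀ p, B ^ p ≤ M' p)
    (hf : MemGrowth N (sector d α) f) (hfe : HasAsymptoticExpansion M' (sector d α) f fhat) :
    ∃ R : ℕ → ℝ, (∀ n, 0 < R n) ∧ LaplaceBound ω e d α f R ∧
      HasAsymptoticExpansion (M' * N) (levelRegion d (α + ω) R) (laplaceVal ω e d α f)
        (PowerSeries.mk fun p => PowerSeries.coeff p fhat * moment e p) := by
  have hπ := Real.pi_pos
  obtain ⟨R₁, hR₁, hLB₁⟩ := he.exists_laplaceBound hN hα hω hf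
  obtain ⟨a, ha, hbd⟩ := he.bound
  have hlt : ∀ n x, 0 < x → lvl n * (x * Real.pi / 2) < x * Real.pi / 2 := fun n x hx =>
    mul_lt_of_lt_one_left (by positivity) (lvl_lt_one n)
  have key : ∀ n, ∃ R D A b : ℝ, 0 < R ∧ 0 < D ∧ 0 < A ∧ 0 < b ∧ ∀ τ w s, Admissible ω d α n τ w →
      Real.exp w.re < R → ∀ p : ℕ,
      ‖laplaceIntegrand e f τ w s - e (pt s τ - w) *
        ∑ n ∈ Finset.range p, PowerSeries.coeff n fhat * Complex.exp (pt s τ) ^ n‖ ≤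
        D * A ^ p * (M' p * N p) * modulus w ^ p * Real.exp (-b * |s - w.re|) := by
    intro n
    obtain ⟨C, k, hC, hk, hkb⟩ := hbd _ (hlt n ω hω)
    obtain ⟨c, A', k', hc, hA', hk', hfb⟩ :=
      hf.exists_remainder_bound hN hα hM' hB hBM hfe (hlt n α hα)
    obtain ⟨ρ, D, A, b, hρ, hD, hA, hb, hg⟩ := hN.growth_bound ha hC hk hk'
    refine ⟨ρ, D * c, A * A', b, hρ, by positivity, by positivity, hb, fun τ w s hadm hw p => ?_⟩
    obtain ⟨h1, h2⟩ := hkb (pt s τ - w) (by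
      rw [Complex.sub_im, pt_im, abs_sub_comm]; exact hadm.2)
    have h3 := hfb p (pt s τ) (by rw [pt_im]; exact hadm.1)
    rw [Complex.sub_re, pt_re] at h1 h2
    rw [pt_re] at h3
    have h4 := hg (s - w.re) w.re _ (norm_nonneg _) hw h1 h2 p
    rw [sub_add_cancel] at h4
    have hMp := hM' p
    have e1 : Real.exp (p * s) = Real.exp (p * (s - w.re)) * modulus w ^ p := by
      rw [modulus, ← Real.exp_nat_mul, ← Real.exp_add]; ring_nf
    have hm : 0 < modulus w := Real.exp_pos _
    rw [laplaceIntegrand, ← mul_sub, norm_mul]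
    calc _ ≤ ‖e (pt s τ - w)‖ *
          (c * A' ^ p * M' p * Real.exp (p * s) / hFun N (k' * Real.exp (-s))) := by gcongr
      _ = (‖e (pt s τ - w)‖ / hFun N (k' * Real.exp (-s)) * Real.exp (p * (s - w.re))) *
          (c * A' ^ p * M' p * modulus w ^ p) := by rw [e1]; ring
      _ ≤ (D * A ^ p * N p * Real.exp (-b * |s - w.re|)) * (c * A' ^ p * M' p * modulus w ^ p) := by
          gcongr
      _ = _ := by rw [mul_pow]; ring
  choose R₂ D A b hR₂ hD hA hb hkey using key
  set R : ℕ → ℝ := fun n => min (R₁ n) (R₂ n) with hR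
  have hRpos : ∀ n, 0 < R n := fun n => lt_min (hR₁ n) (hR₂ n)
  have hLB : LaplaceBound ω e d α f R := fun n => by
    obtain ⟨C, a, ha, h⟩ := hLB₁ n
    exact ⟨C, a, ha, fun τ w s h1 h2 => h τ w s h1 (h2.trans_le (min_le_left _ _))⟩
  have hL := hLB.isLaplaceTransform hα hω hRpos he.holo hf.holo
  refine ⟨R, hRpos, hLB, hL.holo, fun T hT => ?_⟩
  obtain ⟨n, hn⟩ := hT.subset_level
  set J := ∫ s : ℝ, Real.exp (-b n * |s|) with hJ
  have hJ0 : 0 ≤ J := integral_nonneg fun s => (Real.exp_pos _).le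
  refine ⟨D n * (J + 1), A n, by have := hD n; positivity, hA n, fun p w hw => ?_⟩
  have hwn := hn hw
  have hadm := admissible_canonDir hα hω hwn
  set τ := canonDir ω d α w.im with hτ
  have harg := hadm.arg_lt hω
  -- The transform multiplies each monomial by a moment, so partial sums go to partial sums and the
  -- error is the integral of the remainder.
  have hpoly : ∑ n ∈ Finset.range p, PowerSeries.coeff n
      (PowerSeries.mk fun p => PowerSeries.coeff p fhat * moment e p) * proj w ^ n =
      ∫ s, e (pt s τ - w) *
        ∑ n ∈ Finset.range p, PowerSeries.coeff n fhat * Complex.exp (pt s τ) ^ n := by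
    simp_rw [Finset.mul_sum, mul_left_comm (e _)]
    rw [integral_finsetSum _ fun n _ => (he.integral_mul_pow hN harg n).1.const_mul _]
    refine Finset.sum_congr rfl fun n _ => ?_
    rw [integral_const_mul, (he.integral_mul_pow hN harg n).2, PowerSeries.coeff_mk, proj, mul_assoc]
  have hpi : Integrable fun s => e (pt s τ - w) *
        ∑ n ∈ Finset.range p, PowerSeries.coeff n fhat * Complex.exp (pt s τ) ^ n := by
    simp_rw [Finset.mul_sum, mul_left_comm (e _)]
    exact integrable_finsetSum _ fun n _ => (he.integral_mul_pow hN harg n).1.const_mul _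
  have hfi := hLB.integrable hα hω he.holo hf.holo hadm hwn.2
  rw [hpoly, hLB.laplaceVal_eq hα hω he.holo hf.holo hwn hadm, ← integral_sub hfi hpi]
  have hm : 0 < modulus w := Real.exp_pos _
  have hMp := hM' p
  have hNp := hN.pos p
  have hDn := hD n
  have hAn := hA n
  refine (norm_integral_le_of_norm_le ((integrable_exp_neg_mul_abs (hb n) w.re).const_mul _)
    (Eventually.of_forall fun s => hkey n τ w s hadm (hwn.2.trans_le (min_le_right _ _)) p)).trans ?_
  rw [integral_const_mul, integral_sub_right_eq_self (fun s => Real.exp (-b n * |s|)), ← hJ,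
    Pi.mul_apply]
  calc _ = D n * J * A n ^ p * (M' p * N p) * modulus w ^ p := by ring
    _ ≤ _ := by gcongr; linarith

end

/-! ### Acceleration of functions of growth `M₂` -/

/-- A Laplace bound at every radius `exp n` thus gives a transform on the whole sector, which is the
extension asserted in (ii). -/
theorem levelRegion_exp {d γ : ℝ} (hγ : 0 < γ) :
    levelRegion d γ (fun n => Real.exp n) = sector d γ := by
  refine Subset.antisymm (isSectorialRegion_levelRegion hγ fun n => Real.exp_pos _).subset_sector
    fun w hw => ?_
  have hπ := Real.pi_pos
  obtain ⟨n, h1, h2⟩ := ((eventually_le_lvl_mul (by positivity) hw).and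
    (tendsto_natCast_atTop_atTop.eventually_gt_atTop w.re)).exists
  refine mem_iUnion.2 ⟨n, ?_, Real.exp_lt_exp.2 h2⟩
  calc |argument w - d| < lvl n * (γ * Real.pi / 2) := h1
    _ = _ := by ring

section
variable {N L M : ℕ → ℝ} {ω d α : ℝ} {e f : ℂ → ℂ}

theorem KernelBound.exists_laplaceIntegrand_bound (hN : IsRegularSeq N) (hL : IsRegularSeq L)
    (hM : IsRegularSeq M) (hMNL : ∀ p, M p = N p * L p) (hα : 0 < α)
    (he : KernelBound N ω e) (hf : MemGrowth M (sector d α) f) {θ θ' : ℝ}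
    (hθ : θ < ω * Real.pi / 2) (hθ' : θ' < α * Real.pi / 2) :
    ∃ D b k : ℝ, 0 < D ∧ 0 < b ∧ 0 < k ∧ ∀ τ w s, |τ - d| ≤ θ' → |w.im - τ| ≤ θ →
      ‖laplaceIntegrand e f τ w s‖ ≤
        D * Real.exp (-b * |s - w.re|) / hFun L (k * Real.exp (-w.re)) := by
  obtain ⟨a, ha, hbd⟩ := he.bound
  obtain ⟨C, k, hC, hk, hkb⟩ := hbd θ hθ
  obtain ⟨c, k', hc, hk', hfb⟩ := hf.bound hM hα hθ'
  obtain ⟨D, b, k'', hD, hb, hk'', hg⟩ := hN.growth_bound_mul hL hMNL ha hC hk hk'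
  refine ⟨D * c, b, k'', by positivity, hb, hk'', fun τ w s h1 h2 => ?_⟩
  obtain ⟨h3, h4⟩ := hkb (pt s τ - w) (by rw [Complex.sub_im, pt_im, abs_sub_comm]; exact h2)
  have h5 := hfb (pt s τ) (by rw [pt_im]; exact h1)
  rw [Complex.sub_re, pt_re] at h3 h4
  rw [pt_re] at h5
  have h6 := hg (s - w.re) w.re _ (norm_nonneg _) h3 h4
  rw [sub_add_cancel] at h6
  rw [laplaceIntegrand, norm_mul]
  calc _ ≤ ‖e (pt s τ - w)‖ * (c / hFun M (k' * Real.exp (-s))) := by gcongr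
    _ = ‖e (pt s τ - w)‖ / hFun M (k' * Real.exp (-s)) * c := by ring
    _ ≤ D * Real.exp (-b * |s - w.re|) / hFun L (k'' * Real.exp (-w.re)) * c := by gcongr
    _ = _ := by ring

theorem KernelBound.laplaceBound_exp (hN : IsRegularSeq N) (hL : IsRegularSeq L)
    (hM : IsRegularSeq M) (hMNL : ∀ p, M p = N p * L p) (hα : 0 < α) (hω : 0 < ω)
    (he : KernelBound N ω e) (hf : MemGrowth M (sector d α) f) :
    LaplaceBound ω e d α f (fun n => Real.exp n) := by
  have hπ := Real.pi_pos
  have hlt : ∀ n x, 0 < x → lvl n * (x * Real.pi / 2) < x * Real.pi / 2 := fun n x hx =>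
    mul_lt_of_lt_one_left (by positivity) (lvl_lt_one n)
  intro n
  obtain ⟨D, b, k, hD, hb, hk, h⟩ := he.exists_laplaceIntegrand_bound hN hL hM hMNL hα hf
    (hlt n ω hω) (hlt n α hα)
  refine ⟨D / hFun L (k * Real.exp (-n)), b, hb, fun τ w s hadm hw => ?_⟩
  refine (h τ w s hadm.1 hadm.2).trans ?_
  rw [div_mul_eq_mul_div]
  have h0 : 0 < hFun L (k * Real.exp (-n)) := hL.hFun_pos (by positivity)
  have h1 : hFun L (k * Real.exp (-n)) ≤ hFun L (k * Real.exp (-w.re)) := by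
    refine hFun_mono hL.pos (by positivity) ?_
    have := Real.exp_lt_exp.1 hw
    gcongr
  gcongr

/-- The limit is `ℓ * moment e 0`, where `ℓ` is the limit of `f`. Translating the variable by `re w`
fixes `|u/z|` while `u` tends to the origin, and dominated convergence applies to the difference
between the integrand and `ℓ` times the kernel. -/
theorem KernelBound.laplaceVal_continuousAtOrigin (hN : IsRegularSeq N) (hL : IsRegularSeq L)
    (hM : IsRegularSeq M) (hMNL : ∀ p, M p = N p * L p) (hα : 0 < α) (hω : 0 < ω)
    (he : KernelBound N ω e) (hf : MemGrowth M (sector d α) f) :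
    ContinuousAtOrigin (sector d (α + ω)) (laplaceVal ω e d α f) := by
  have hπ := Real.pi_pos
  have hlt : ∀ n x, 0 < x → lvl n * (x * Real.pi / 2) < x * Real.pi / 2 := fun n x hx =>
    mul_lt_of_lt_one_left (by positivity) (lvl_lt_one n)
  intro T hT
  rw [← levelRegion_exp (by linarith)] at hT
  obtain ⟨n, hn⟩ := hT.subset_level
  have hLB := he.laplaceBound_exp hN hL hM hMNL hα hω hf
  obtain ⟨β, hβ, hβα, hβl⟩ := exists_opening_between hα (hlt n α hα)
  obtain ⟨ℓ, hℓ⟩ := hf.contOrigin _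
    (isBddProperSubsector_of_lt (d := d) (r := 1) hβ one_pos hβα)
  refine ⟨ℓ * moment e (0 : ℕ), ?_⟩
  obtain ⟨C, b, hb, hCb⟩ := hLB n
  obtain ⟨C', b', hb', hCb'⟩ := he.norm_exp_mul_le hN (hlt n ω hω) 0
  simp only [Nat.cast_zero, zero_mul, Complex.exp_zero, one_mul] at hCb'
  set l := comap (fun w : ℂ => w.re) atBot ⊓ 𝓟 T with hl
  have hlT : ∀ᶠ w in l, w ∈ T := mem_inf_of_right (mem_principal_self T)
  have hadm : ∀ w ∈ T, Admissible ω d α n (canonDir ω d α w.im) w := fun w hw =>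
    admissible_canonDir hα hω (hn hw)
  have hre : Tendsto (fun w : ℂ => w.re) l atBot := tendsto_comap.mono_left inf_le_left
  have harg : ∀ w ∈ T, |canonDir ω d α w.im - w.im| < ω * Real.pi / 2 := fun w hw => by
    rw [abs_sub_comm]; exact (hadm w hw).arg_lt hω
  have hpt : ∀ x w, pt (x + w.re) (canonDir ω d α w.im) - w = pt x (canonDir ω d α w.im - w.im) :=
    fun x w => by apply Complex.ext <;> simp
  set F : ℂ → ℝ → ℂ := fun w x => laplaceIntegrand e f (canonDir ω d α w.im) w (x + w.re) -
    ℓ * e (pt x (canonDir ω d α w.im - w.im)) with hF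
  have hbe : ∀ w ∈ T, ∀ x, ‖e (pt x (canonDir ω d α w.im - w.im))‖ ≤ C' * Real.exp (-b' * |x|) :=
    fun w hw x => by
      have := hCb' (pt x (canonDir ω d α w.im - w.im)) (by
        rw [pt_im, abs_sub_comm]; exact (hadm w hw).2)
      simpa using this
  have hlim : Tendsto (fun w => ∫ x, F w x) l (𝓝 (∫ _ : ℝ, (0 : ℂ))) := by
    refine tendsto_integral_filter_of_dominated_convergence
      (fun x => C * Real.exp (-b * |x|) + ‖ℓ‖ * (C' * Real.exp (-b' * |x|))) ?_ ?_ ?_ ?_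
    · filter_upwards [hlT] with w hw
      refine Continuous.aestronglyMeasurable (Continuous.sub ?_ ((he.continuous_pt
        (harg w hw)).const_mul _))
      exact (continuous_laplaceIntegrand he.holo hf.holo ((hadm w hw).dir_lt hα)
        ((hadm w hw).arg_lt hω)).comp (by fun_prop)
    · filter_upwards [hlT] with w hw
      refine Eventually.of_forall fun x => (norm_sub_le _ _).trans (add_le_add ?_ ?_)
      · have := hCb _ w (x + w.re) (hadm w hw) (hn hw).2
        rwa [add_sub_cancel_right] at this
      · rw [norm_mul]
        gcongr
        exact hbe w hw x
    · have i1 := integrable_exp_neg_mul_abs hb 0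
      have i2 := integrable_exp_neg_mul_abs hb' 0
      simp only [sub_zero] at i1 i2
      exact (i1.const_mul _).add ((i2.const_mul _).const_mul _)
    · refine Eventually.of_forall fun x => ?_
      have h1 : Tendsto (fun w => pt (x + w.re) (canonDir ω d α w.im)) l
          (comap (fun w : ℂ => w.re) atBot ⊓ 𝓟 (bddSector d β 1)) := by
        refine tendsto_inf.2 ⟨tendsto_comap_iff.2 ?_, tendsto_principal.2 ?_⟩
        · refine (tendsto_atBot_add_const_left _ x hre).congr fun w => ?_
          simp
        · filter_upwards [hlT, hre.eventually_lt_atBot (-x)] with w hw hwx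
          refine ⟨?_, ?_⟩
          · rw [argument, pt_im]; exact (hadm w hw).1.trans_lt hβl
          · rw [modulus, pt_re, Real.exp_lt_one_iff]; linarith
      have h2 : Tendsto (fun w => ‖f (pt (x + w.re) (canonDir ω d α w.im)) - ℓ‖) l (𝓝 0) :=
        tendsto_iff_norm_sub_tendsto_zero.1 (hℓ.comp h1)
      have h3 := h2.const_mul (C' * Real.exp (-b' * |x|))
      rw [mul_zero] at h3
      refine squeeze_zero_norm' ?_ h3
      filter_upwards [hlT] with w hw
      rw [hF]
      simp only [laplaceIntegrand]
      rw [hpt, mul_comm ℓ, ← mul_sub, norm_mul]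
      gcongr
      exact hbe w hw x
  rw [integral_zero] at hlim
  have hval : ∀ w ∈ T, ∫ x, F w x = laplaceVal ω e d α f w - ℓ * moment e (0 : ℕ) := by
    intro w hw
    have i1 := hLB.integrable hα hω he.holo hf.holo (hadm w hw) (hn hw).2
    have i2 := he.integrable_exp_mul hN (harg w hw) 0
    have h3 := he.moment_eq hN (harg w hw) 0
    simp only [Nat.cast_zero, zero_mul, Complex.exp_zero, one_mul] at i2 h3
    rw [integral_sub (f := fun x => laplaceIntegrand e f (canonDir ω d α w.im) w (x + w.re))
      (i1.comp_add_right w.re) (i2.const_mul _), integral_const_mul, h3,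
      integral_add_right_eq_self, laplaceVal, Nat.cast_zero]
  have h4 := (hlim.congr' (by
    filter_upwards [hlT] with w hw using hval w hw)).add_const (ℓ * moment e (0 : ℕ))
  simpa using h4

theorem IsUnbddProperSubsector.exists_level {γ : ℝ} (hγ : 0 < γ) {T : Set ℂ}
    (hT : IsUnbddProperSubsector T (sector d γ)) :
    ∃ n, ∀ w ∈ T, |w.im - d| < γ * lvl n * Real.pi / 2 := by
  obtain ⟨⟨d', β, hβ, rfl⟩, hcl⟩ := hT
  have h1 : IsBddProperSubsector (bddSector d' β 1) (levelRegion d γ fun n => Real.exp n) :=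
    ⟨⟨d', β, 1, hβ, one_pos, rfl⟩, by
      rw [levelRegion_exp hγ]
      exact (closure_mono (bddSector_subset_sector _ _ _)).trans hcl⟩
  obtain ⟨n, hn⟩ := h1.subset_level
  refine ⟨n, fun w hw => ?_⟩
  have h2 : pt (-1) w.im ∈ bddSector d' β 1 := ⟨by simpa [argument, sector] using hw, by
    rw [modulus, pt_re, Real.exp_lt_one_iff]; norm_num⟩
  simpa [argument] using (hn h2).1

/-- Meant for `N = M₂ / M₁`, `L = M₁`, `M = M₂`. The bound of the integrand holds for every modulus
of `z`, so integrating it gives both the transform on the whole sector and its growth; the threshold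
`r = 1` is arbitrary. -/
theorem KernelBound.laplaceVal_memGrowth (hN : IsRegularSeq N) (hL : IsRegularSeq L)
    (hM : IsRegularSeq M) (hMNL : ∀ p, M p = N p * L p) (hα : 0 < α) (hω : 0 < ω)
    (he : KernelBound N ω e) (hf : MemGrowth M (sector d α) f) :
    IsLaplaceTransform ω e d α f (sector d (α + ω)) (laplaceVal ω e d α f) ∧
      MemGrowth L (sector d (α + ω)) (laplaceVal ω e d α f) := by
  have hπ := Real.pi_pos
  have hlt : ∀ n x, 0 < x → lvl n * (x * Real.pi / 2) < x * Real.pi / 2 := fun n x hx =>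
    mul_lt_of_lt_one_left (by positivity) (lvl_lt_one n)
  have hLB := he.laplaceBound_exp hN hL hM hMNL hα hω hf
  have hT := hLB.isLaplaceTransform hα hω (fun n => Real.exp_pos _) he.holo hf.holo
  rw [levelRegion_exp (by linarith)] at hT
  refine ⟨hT, hT.holo, he.laplaceVal_continuousAtOrigin hN hL hM hMNL hα hω hf, fun T hTs => ?_⟩
  obtain ⟨n, hn⟩ := hTs.exists_level (by linarith)
  obtain ⟨D, b, k, hD, hb, hk, h⟩ := he.exists_laplaceIntegrand_bound hN hL hM hMNL hα hf
    (hlt n ω hω) (hlt n α hα)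
  set J := ∫ s : ℝ, Real.exp (-b * |s|) with hJ
  have hJ0 : 0 ≤ J := integral_nonneg fun s => (Real.exp_pos _).le
  refine ⟨1, D * (J + 1), k, one_pos, by positivity, hk, fun w hw _ => ?_⟩
  have hadm : Admissible ω d α n (canonDir ω d α w.im) w :=
    have := canonDir_sub_lt hα hω (hn w hw)
    ⟨this.1.le, this.2.le⟩
  have hm : k / modulus w = k * Real.exp (-w.re) := by
    rw [modulus, Real.exp_neg, div_eq_mul_inv]
  have hh : 0 < hFun L (k * Real.exp (-w.re)) := hL.hFun_pos (by positivity)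
  rw [hm]
  have hi : Integrable fun s => D * Real.exp (-b * |s - w.re|) / hFun L (k * Real.exp (-w.re)) :=
    ((integrable_exp_neg_mul_abs hb w.re).const_mul _).div_const _
  refine (norm_integral_le_of_norm_le hi (Eventually.of_forall fun s =>
    h _ w s hadm.1 hadm.2)).trans ?_
  rw [integral_div, integral_const_mul,
    integral_sub_right_eq_self (fun s => Real.exp (-b * |s|)), ← hJ]
  gcongr
  linarith

end

/-! ### Iterated Laplace transforms -/

section
variable {M₁ M₂ : ℕ → ℝ} {ω₁ ω₂ d α : ℝ} {e₁ e₂ f : ℂ → ℂ}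

theorem canonDir_self (ω d α : ℝ) : canonDir ω d α d = d := by simp [canonDir]

/-- On the bisecting ray the kernel is evaluated at argument 0, where `integral_mul_accelKernel` is
available. -/
theorem laplaceVal_pt (ω : ℝ) (e f : ℂ → ℂ) (d α y : ℝ) :
    laplaceVal ω e d α f (pt y d) = ∫ s, e (pt (s - y) 0) * f (pt s d) := by
  have h : ∀ s, pt s d - pt y d = pt (s - y) 0 := fun s => by apply Complex.ext <;> simp
  simp only [laplaceVal, pt_im, canonDir_self, laplaceIntegrand, h]

/-- The iterated Laplace transform near the origin, on the bisecting ray. -/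
theorem exists_laplaceVal_comp_eq (hω₁ : 0 < ω₁) (hlt : ω₁ < ω₂) (hω₂ : ω₂ < 2)
    (hM₁ : IsRegularSeq M₁) (hM₂ : IsRegularSeq M₂) (hN : IsRegularSeq (M₂ / M₁))
    (h₁ : KernelBound M₁ ω₁ e₁) (h₂ : KernelBound M₂ ω₂ e₂)
    (hpos : ∀ s : ℝ, ∃ y : ℝ, 0 < y ∧ e₁ (pt s 0) = y)
    (hent : ∀ z : ℂ, Summable fun n : ℕ => z ^ n / moment e₁ n)
    (hE : BorelBound ω₁ (borelKernel e₁))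
    (ha : KernelBound (M₂ / M₁) (ω₂ - ω₁) (accelKernel ω₁ ω₂ e₁ e₂))
    (hα : 0 < α) (hf : MemGrowth M₂ (sector d α) f) :
    ∃ y₀ : ℝ, ∀ y < y₀,
      laplaceVal ω₁ e₁ d (α + (ω₂ - ω₁))
        (laplaceVal (ω₂ - ω₁) (accelKernel ω₁ ω₂ e₁ e₂) d α f) (pt y d) =
      laplaceVal ω₂ e₂ d α f (pt y d) := by
  have hπ := Real.pi_pos
  have hd : 0 < ω₂ - ω₁ := by linarith
  set acc := accelKernel ω₁ ω₂ e₁ e₂ with hacc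
  have h0 : ∀ x : ℝ, 0 < x → 0 < x * Real.pi / 2 := fun x hx => by positivity
  have hMul : ∀ p, M₂ p = (M₂ / M₁) p * M₁ p := fun p => by
    rw [Pi.div_apply, div_mul_cancel₀ _ (hM₁.pos p).ne']
  obtain ⟨D, b, k, hD, hb, hk, hDb⟩ := ha.exists_laplaceIntegrand_bound hN hM₁ hM₂ hMul hα hf
    (h0 _ hd) (h0 _ hα)
  obtain ⟨a₁, ha₁, hbd⟩ := h₁.bound
  obtain ⟨C, k₁, hC, hk₁, hCb⟩ := hbd 0 (h0 _ hω₁)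
  obtain ⟨ρ, D', A, b', hρ, hD', -, hb', hg⟩ := hM₁.growth_bound ha₁ hC hk₁ hk
  refine ⟨Real.log ρ, fun y hy => ?_⟩
  have hyρ : Real.exp y < ρ := (Real.lt_log_iff_exp_lt hρ).1 hy
  simp_rw [laplaceVal_pt, ← integral_const_mul]
  -- The inner transform brings growth `M₁` in `s`, which `e₁` cancels because `exp y < ρ`. What
  -- remains is the integrand of a convolution of two integrable exponentials, so Fubini applies.
  have hbound : ∀ σ s : ℝ, ‖e₁ (pt (s - y) 0) * (acc (pt (σ - s) 0) * f (pt σ d))‖ ≤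
      D * D' * (Real.exp (-b' * |s - y|) * Real.exp (-b * |σ - s|)) := by
    intro σ s
    have e1 := hDb d (pt s d) σ (by simp) (by simp)
    have hpt : pt σ d - pt s d = pt (σ - s) 0 := by apply Complex.ext <;> simp
    rw [laplaceIntegrand, hpt, pt_re] at e1
    obtain ⟨e2, e3⟩ := hCb (pt (s - y) 0) (by simp)
    rw [pt_re] at e2 e3
    have e4 := hg (s - y) y _ (norm_nonneg _) hyρ e2 e3 0
    simp only [pow_zero, mul_one, hM₁.zero, Nat.cast_zero, zero_mul, Real.exp_zero,
      sub_add_cancel] at e4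
    rw [norm_mul]
    calc _ ≤ ‖e₁ (pt (s - y) 0)‖ *
          (D * Real.exp (-b * |σ - s|) / hFun M₁ (k * Real.exp (-s))) := by gcongr
      _ = ‖e₁ (pt (s - y) 0)‖ / hFun M₁ (k * Real.exp (-s)) * (D * Real.exp (-b * |σ - s|)) := by
          ring
      _ ≤ (D' * Real.exp (-b' * |s - y|)) * (D * Real.exp (-b * |σ - s|)) := by gcongr
      _ = _ := by ring
  have hac : Continuous fun s : ℝ => acc (pt s 0) :=
    ha.continuous_pt (by rw [abs_zero]; exact h0 _ hd)
  have hfc : Continuous fun s : ℝ => f (pt s d) := by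
    rw [← continuousOn_univ]
    exact continuousOn_comp_pt fun s _ =>
      (differentiableAt_of_sector hf.holo (by simpa using h0 _ hα)).continuousAt
  have hprod : Integrable (fun q : ℝ × ℝ => e₁ (pt (q.2 - y) 0) *
      (acc (pt (q.1 - q.2) 0) * f (pt q.1 d))) (volume.prod volume) := by
    have i2 := integrable_exp_neg_mul_abs hb 0
    simp only [sub_zero] at i2
    have hconv := ((integrable_exp_neg_mul_abs hb' y).convolution_integrand
      (ContinuousLinearMap.mul ℝ ℝ) i2).const_mul (D * D')
    simp only [ContinuousLinearMap.mul_apply'] at hconv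
    refine hconv.mono' (Continuous.aestronglyMeasurable ?_)
      (Eventually.of_forall fun q => hbound q.1 q.2)
    exact ((h₁.continuous_sub hω₁ y).comp continuous_snd).mul
      ((hac.comp (continuous_fst.sub continuous_snd)).mul (hfc.comp continuous_fst))
  rw [← integral_integral_swap (f := fun σ s => e₁ (pt (s - y) 0) *
      (acc (pt (σ - s) 0) * f (pt σ d))) hprod]
  congr 1
  ext σ
  simp_rw [← mul_assoc]
  rw [integral_mul_const]
  congr 1
  have key := integral_mul_accelKernel hω₁ hlt hω₂ hM₁ hM₂ h₁ h₂ hpos hent hE (y - σ)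
  rw [neg_sub] at key
  rw [← key, ← integral_add_right_eq_self _ σ]
  congr 1
  ext s
  rw [show s + σ - y = s - (y - σ) by ring, show σ - (s + σ) = -s by ring]

/-- Acceleration followed by the Laplace transform with kernel `e₁` is the Laplace transform with
kernel `e₂`. -/
theorem exists_common_laplaceTransform (hω₁ : 0 < ω₁) (hlt : ω₁ < ω₂) (hω₂ : ω₂ < 2)
    (hM₁ : IsRegularSeq M₁) (hM₂ : IsRegularSeq M₂) (hN : IsRegularSeq (M₂ / M₁))
    (h₁ : KernelBound M₁ ω₁ e₁) (h₂ : KernelBound M₂ ω₂ e₂)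
    (hpos : ∀ s : ℝ, ∃ y : ℝ, 0 < y ∧ e₁ (pt s 0) = y)
    (hent : ∀ z : ℂ, Summable fun n : ℕ => z ^ n / moment e₁ n)
    (hE : BorelBound ω₁ (borelKernel e₁))
    (ha : KernelBound (M₂ / M₁) (ω₂ - ω₁) (accelKernel ω₁ ω₂ e₁ e₂))
    (hα : 0 < α) (hf : MemGrowth M₂ (sector d α) f)
    (hAf : MemGrowth M₁ (sector d (α + (ω₂ - ω₁)))
      (laplaceVal (ω₂ - ω₁) (accelKernel ω₁ ω₂ e₁ e₂) d α f)) :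
    ∃ (G : Set ℂ) (F : ℂ → ℂ),
      IsLaplaceTransform ω₁ e₁ d (α + (ω₂ - ω₁))
        (laplaceVal (ω₂ - ω₁) (accelKernel ω₁ ω₂ e₁ e₂) d α f) G F ∧
      IsLaplaceTransform ω₂ e₂ d α f G F := by
  have hd : 0 < ω₂ - ω₁ := by linarith
  have hαω : 0 < α + (ω₂ - ω₁) := by linarith
  have hω₂0 : 0 < ω₂ := hω₁.trans hlt
  obtain ⟨R₁, hR₁, hb₁⟩ := h₁.exists_laplaceBound hM₁ hαω hω₁ hAf
  obtain ⟨R₂, hR₂, hb₂⟩ := h₂.exists_laplaceBound hM₂ hα hω₂0 hf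
  have hT₁ := hb₁.isLaplaceTransform hαω hω₁ hR₁ h₁.holo hAf.holo
  have hT₂ := hb₂.isLaplaceTransform hα hω₂0 hR₂ h₂.holo hf.holo
  have hsum : α + (ω₂ - ω₁) + ω₁ = α + ω₂ := by ring
  have hreg := hT₁.region
  rw [hsum] at hreg
  obtain ⟨G, hG, hG₁, hG₂⟩ := hreg.exists_inter (by linarith) hT₂.region
  rw [← hsum] at hG₁
  have hT₁' := hT₁.restrict (by rw [hsum]; exact hG) hG₁
  have hT₂' := hT₂.restrict hG hG₂
  refine ⟨G, _, hT₁'.congr ?_, hT₂'⟩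
  obtain ⟨y₀, hy₀⟩ := exists_laplaceVal_comp_eq hω₁ hlt hω₂ hM₁ hM₂ hN h₁ h₂ hpos hent hE ha hα hf
  obtain ⟨ρ, hρ, hs⟩ := hG.exists_subset ((α + ω₂) / 2) (by linarith) (by linarith)
  set y₁ := min y₀ (Real.log ρ) - 1 with hy₁
  have hy₁0 : y₁ < y₀ := by linarith [min_le_left y₀ (Real.log ρ)]
  have hz : pt y₁ d ∈ G := hs (mem_bddSector_pt (by linarith) (by
    rw [← Real.lt_log_iff_exp_lt hρ]
    linarith [min_le_right y₀ (Real.log ρ)]))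
  -- The transforms agree near one point of the bisecting ray, along that ray, and the region is
  -- connected.
  refine (hT₂'.holo.analyticOnNhd hG.isOpen).eqOn_of_preconnected_of_frequently_eq
    (hT₁'.holo.analyticOnNhd hG.isOpen) hG.isConnected.isPreconnected hz ?_
  have ht : Tendsto (fun y => pt y d) (𝓝[≠] y₁) (𝓝[≠] pt y₁ d) := by
    refine tendsto_nhdsWithin_of_tendsto_nhds_of_eventually_within _
      ((continuous_pt_left d).continuousAt.mono_left nhdsWithin_le_nhds) ?_
    filter_upwards [self_mem_nhdsWithin] with y hy h
    exact hy (by simpa using congrArg Complex.re h)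
  refine ht.frequently (Eventually.frequently ?_)
  filter_upwards [nhdsWithin_le_nhds (Iio_mem_nhds hy₁0)] with y hy
  exact (hy₀ y hy).symm

end

theorem moment_ratio {M₁ M₂ : ℕ → ℝ} {ω₁ ω₂ : ℝ} {e₁ e₂ : ℂ → ℂ} (hω₁ : 0 < ω₁) (hlt : ω₁ < ω₂)
    (hω₂ : ω₂ < 2) (hM₁ : IsRegularSeq M₁) (hM₂ : IsRegularSeq M₂) (hN : IsRegularSeq (M₂ / M₁))
    (h₁ : KernelBound M₁ ω₁ e₁) (h₂ : KernelBound M₂ ω₂ e₂)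
    (hpos : ∀ s : ℝ, ∃ y : ℝ, 0 < y ∧ e₁ (pt s 0) = y)
    (hent : ∀ z : ℂ, Summable fun n : ℕ => z ^ n / moment e₁ n)
    (hE : BorelBound ω₁ (borelKernel e₁))
    (ha : KernelBound (M₂ / M₁) (ω₂ - ω₁) (accelKernel ω₁ ω₂ e₁ e₂)) (fhat : PowerSeries ℂ) :
    (PowerSeries.mk fun p => PowerSeries.coeff p fhat * moment (accelKernel ω₁ ω₂ e₁ e₂) p) =
      formalAcceleration e₁ e₂ fhat := by
  unfold formalAcceleration
  congr 1
  ext p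
  rw [← moment_accelKernel_mul hω₁ hlt hω₂ hM₁ hM₂ hN h₁ h₂ hpos hent hE ha p, ← mul_assoc,
    mul_div_cancel_right₀ _ (moment_ne_zero hM₁ hω₁ h₁ hpos p)]

end Accel

theorem mainTheorem7
    (M₁ M₂ : ℕ → ℝ)
    (hM₁ : IsWeightSequence M₁) (hM₂ : IsWeightSequence M₂)
    (hnorm₁ : M₁ 1 = 1) (hnorm₂ : M₂ 1 = 1)
    (hpo₁ : AdmitsNonzeroProximateOrder M₁) (hpo₂ : AdmitsNonzeroProximateOrder M₂)
    (hlt : growthIndex M₁ < growthIndex M₂) (hlt2 : growthIndex M₂ < 2)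
    (e₁ e₂ : LogSurface → ℂ)
    (he₁ : IsStrongKernel M₁ e₁) (he₂ : IsStrongKernel M₂ e₂)
    (d α : ℝ) (hα : 0 < α) :
    (∀ (M' : ℕ → ℝ), (∀ p, 0 < M' p) → (∃ B : ℝ, 0 < B ∧ ∀ p, B ^ p ≤ M' p) →
      ∀ (f : LogSurface → ℂ) (fhat : PowerSeries ℂ),
        MemGrowth (M₂ / M₁) (sector d α) f →
        HasAsymptoticExpansion M' (sector d α) f fhat →
        ∃ (G : Set LogSurface) (Af : LogSurface → ℂ),
          IsSectorialRegion d (α + growthIndex (M₂ / M₁)) G ∧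
          IsAcceleration M₁ M₂ e₁ e₂ d α f G Af ∧
          HasAsymptoticExpansion (M' * (M₂ / M₁)) G Af (formalAcceleration e₁ e₂ fhat)) ∧
    (∀ f : LogSurface → ℂ, MemGrowth M₂ (sector d α) f →
      ∃ Af : LogSurface → ℂ,
        IsAcceleration M₁ M₂ e₁ e₂ d α f (sector d (α + growthIndex (M₂ / M₁))) Af ∧
        MemGrowth M₁ (sector d (α + growthIndex (M₂ / M₁))) Af ∧
        ∃ (G : Set LogSurface) (F : LogSurface → ℂ),
          IsLaplaceTransform (growthIndex M₁) e₁ d (α + growthIndex (M₂ / M₁)) Af G F ∧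
          IsLaplaceTransform (growthIndex M₂) e₂ d α f G F) := by
  have hω₁ := growthIndex_pos hM₁ hnorm₁ hpo₁
  have hR₁ := hM₁.isRegularSeq hnorm₁ hpo₁
  have hR₂ := hM₂.isRegularSeq hnorm₂ hpo₂
  have hN := isRegularSeq_div hM₁ hM₂ hnorm₁ hnorm₂ hpo₁ hpo₂ hlt
  have hk₁ := he₁.kernelBound hR₁ hω₁
  have hk₂ := he₂.kernelBound hR₂ (hω₁.trans hlt)
  have hE := he₁.borelBound (hlt.trans hlt2)
  have ha := accelKernel_kernelBound hω₁ hlt hlt2 hM₁ hnorm₁ he₁.growth hR₂ hE hk₂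
  have hω : 0 < growthIndex M₂ - growthIndex M₁ := sub_pos.2 hlt
  unfold IsAcceleration
  rw [growthIndex_div hM₁ hM₂ hnorm₁ hnorm₂ hpo₁ hpo₂]
  constructor
  · rintro M' hM' ⟨B, hB, hBM⟩ f fhat hf hfe
    obtain ⟨R, hR, hb, hexp⟩ :=
      ha.exists_laplaceBound_and_expansion hN hα hω hM' hB hBM hf hfe
    rw [moment_ratio hω₁ hlt hlt2 hR₁ hR₂ hN hk₁ hk₂ he₁.pos he₁.entire hE ha] at hexp
    have hT := hb.isLaplaceTransform hα hω hR ha.holo hf.holo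
    exact ⟨_, _, hT.region, hT, hexp⟩
  · intro f hf
    obtain ⟨hT, hAf⟩ := ha.laplaceVal_memGrowth hN hR₁ hR₂ (fun p => by
      rw [Pi.div_apply, div_mul_cancel₀ _ (hR₁.pos p).ne']) hα hω hf
    exact ⟨_, hT, hAf, exists_common_laplaceTransform hω₁ hlt hlt2 hR₁ hR₂ hN hk₁ hk₂ he₁.pos
      he₁.entire hE ha hα hf hAf⟩
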